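/- **Setting.** Let $d\ge 2$, let $(\mathbb M,\mathcal F_{\mathbb M},\mathbb Q_{\mathbb M})$ be a probability space (of marks), and let $\mathbf N$ be the set of locally finite sets of points $\hat x=(x,m_x)\in\mathbb R^d\times\mathbb M$ (finitely many points over each bounded subset of $\mathbb R^d$), with the $\sigma$-field generated by the counts $\mathcal M\mapsto|\mathcal M\cap B|$, $B\subseteq\mathbb R^d\times\mathbb M$ measurable. For $\mathcal M\in\mathbf N$, the sets $\mathcal M+y$ and $x+a(\mathcal M-x)$, $a>0$, are formed in the spatial coordinate, marks being kept; $\mathcal M^{\hat x}:=\mathcal M\cup\{\hat x\}$. Write $\lambda_d$ for Lebesgue measure, $B^d(x,r)$ for the closed ball and $\widehat B^d(x,r):=B^d(x,r)\times\mathbb M$. Let $W\subseteq\mathbb R^d$ be measurable with $\lambda_d(\partial W)=0$, and let $g:W\to(0,\infty)$ be measurable, bounded and almost everywhere continuous on $W$. For $s\ge1$ let $\mathcal P_{sg}$ be a Poisson process on $\mathbb R^d\times\mathbb M$ with intensity measure $s\,g\mathbf 1_W\lambda_d\otimes\mathbb Q_{\mathbb M}$, and for $u>0$ let $\mathcal P_u$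 be a Poisson process with intensity measure $u\,\lambda_d\otimes\mathbb Q_{\mathbb M}$. $M_x$ denotes a random mark with distribution $\mathbb Q_{\mathbb M}$ attached to the point $x$; marks of different points are independent of each other and of the Poisson processes. Let $\xi^{(1)},\dots,\xi^{(m)}:(\mathbb R^d\times\mathbb M)\times\mathbf N\to\mathbb R$ be measurable and translation invariant, i.e. $\xi^{(i)}((x,m_x),\mathcal M)=\xi^{(i)}((x+y,m_x),\mathcal M+y)$ for all $x,y,m_x,\mathcal M$. For $s\ge1$ let $$\xi^{(i)}_s((x,m_x),\mathcal M):=\xi^{(i)}((x,m_x),x+s^{1/d}(\mathcal M-x))$$ be the scaled scores. As a convention, $\xi^{(i)}_s(\hat x,\mathcal M)=\xi^{(i)}_s(\hat x,\mathcal M^{\hat x})$ for $\hat x\in W\times\mathbb M$, $\hat x\notin\mathcal M$, $s\geq 1$. Assume: * (*Intrinsic exponential stabilization.*) There are measurable $R_s:(W\times\mathbb M)\times\mathbf N\to[0,\infty)$, $s\ge1$, and constants $C,c\in(0,\infty)$ such that for all $s\ge1$, $i$, $\hat x=(x,m_x)\in W\times\mathbb M$ and $\mathcal M\in\mathbf N$: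 $\xi_s^{(i)}(\hat x,(\mathcal M\cup\hat{\mathcal A})\cap\widehat B^d(x,R_s(\hat x,\mathcal M)))=\xi_s^{(i)}(\hat x,\mathcal M\cup\hat{\mathcal A})$ for every $\hat{\mathcal A}\subset\mathbb R^d\times\mathbb M$ with $|\hat{\mathcal A}|\le9$; $R_s(\hat x,\mathcal M)\ge R_s(\hat x,\mathcal M')$ if $\mathcal M\subseteq\mathcal M'\in\mathbf N$; for $r\ge0$, $R_s(\hat x,\mathcal M)\le r$ if and only if $R_s(\hat x,\mathcal M\cap\widehat B^d(x,r))\le r$; and for all $r\ge0$ and $y\in W$, both $\mathbb P(R_s((x,M_x),\mathcal P_{sg})\ge r)$ and $\mathbb P(R_s((x,M_x),\mathcal P_{sg(y)})\ge r)$ are at most $C\exp(-c\,s\,r^d)$. * (*Moments.*) For some $p>0$ and $C'\in(0,\infty)$, for all $i$, $s\ge1$ and $x,y\in W$: $\mathbb E|\xi^{(i)}_s((x,M_x),\mathcal P_{sg}\cup(\mathcal A,M_{\mathcal A}))|^{6+p}\le C'$ for all $\mathcal A\subset W\setminus\{x\}$ with $|\mathcal A|\le 9$, and $\mathbb E|\xi^{(i)}_s((x,M_x),\mathcal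 P_{sg(y)}\cup(\mathcal A,M_{\mathcal A}))|^{6+p}\le C'$ for all $\mathcal A\subset\mathbb R^d\setminus\{x\}$ with $|\mathcal A|\le9$, where $(\mathcal A,M_{\mathcal A}):=\{(a,M_a):a\in\mathcal A\}$. * (*Stationary input.*) There is a bounded measurable set $A\subset\mathbb R^d$ such that for every $u>0$ the covariance matrix of $$\frac1{\sqrt s}\Big(\sum_{\hat x\in\mathcal P_{su}\cap(A\times\mathbb M)}\xi^{(1)}_s(\hat x,\mathcal P_{su}),\dots,\sum_{\hat x\in\mathcal P_{su}\cap(A\times\mathbb M)}\xi^{(m)}_s(\hat x,\mathcal P_{su})\Big)$$ converges as $s\to\infty$ to a positive definite matrix. **Claim.** Let $A_1,\dots,A_m\subseteq W$ be measurable and bounded, and let $f_i:A_i\to\mathbb R$ be measurable and bounded with $\lambda_d(\{x\in A_i:f_i(x)\ne0\})>0$, $i=1,\dots,m$. For $i,j\in\{1,\dots,m\}$ set $$\begin{aligned}\sigma_{ij}:={}&\int_{A_i\cap A_j}\mathbb E\big[\xi^{(i)}((x,M_x),\mathcal P_{g(x)})\,\xi^{(j)}((x,M_x),\mathcal P_{g(x)})\big]f_i(x)f_j(x)g(x)\,dx\\&+\int_{A_i\cap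 A_j}\int_{\mathbb R^d}\Big(\mathbb E\big[\xi^{(i)}((x,M_x),\mathcal P_{g(x)}^{(x+y,M_{x+y})})\,\xi^{(j)}((x,M_{x+y}),\mathcal P_{g(x)}^{(x,M_x)}-y)\big]\\&\qquad-\mathbb E\,\xi^{(i)}((x,M_x),\mathcal P_{g(x)})\;\mathbb E\,\xi^{(j)}((x,M_{x+y}),\mathcal P_{g(x)}-y)\Big)f_i(x)f_j(x)g(x)^2\,dy\,dx.\end{aligned}$$ Then these expectations (for almost every $y$, where they involve $y$) and integrals converge absolutely, and the matrix $\Sigma:=(\sigma_{ij})_{i,j=1,\dots,m}$ is positive definite. -/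

import Mathlib

open MeasureTheory ProbabilityTheory Filter Topology Set
open scoped ENNReal NNReal

noncomputable section

namespace StabScore

/-- Marked points: a location in Euclidean space together with a mark. -/
abbrev Pt (d : ℕ) (M : Type*) := EuclideanSpace ℝ (Fin d) × M

/-- Simple locally finite marked point configurations: sets of marked points that have only
finitely many elements above every bounded set of locations. -/
structure Config (d : ℕ) (M : Type*) where
  carrier : Set (Pt d M)
  locallyFinite : ∀ B : Set (EuclideanSpace ℝ (Fin d)), Bornology.IsBounded B →
    (carrier ∩ Prod.fst ⁻¹' B).Finite

namespace Config

variable {d : ℕ} {M : Type*}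

/-- The number of points of the configuration in `B`. -/
def count (B : Set (Pt d M)) (S : Config d M) : ℕ∞ := (S.carrier ∩ B).encard

/-- The smallest σ-field making all counts of measurable sets measurable. -/
instance [MeasurableSpace M] : MeasurableSpace (Config d M) :=
  ⨆ (B : Set (Pt d M)) (_ : MeasurableSet B), MeasurableSpace.comap (count B) inferInstance

instance : Union (Config d M) where
  union S T :=
    { carrier := S.carrier ∪ T.carrier
      locallyFinite := fun B hB => by
        rw [union_inter_distrib_right]
        exact (S.locallyFinite B hB).union (T.locallyFinite B hB) }

/-- A finite set of marked points as a configuration. -/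
def ofFinite (T : Set (Pt d M)) (hT : T.Finite) : Config d M where
  carrier := T
  locallyFinite := fun _ _ => hT.subset inter_subset_left

/-- `S ∪ {p}`. -/
def add (S : Config d M) (p : Pt d M) : Config d M :=
  S ∪ ofFinite {p} (finite_singleton p)

/-- The points of `S` whose location lies in the closed ball of radius `r` around `x`. -/
def inBall (S : Config d M) (x : EuclideanSpace ℝ (Fin d)) (r : ℝ) : Config d M where
  carrier := S.carrier ∩ Prod.fst ⁻¹' Metric.closedBall x r
  locallyFinite := fun B hB =>
    (S.locallyFinite B hB).subset (inter_subset_inter_left _ inter_subset_left)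

/-- The translate `S + y` (marks are kept). -/
def translate (S : Config d M) (y : EuclideanSpace ℝ (Fin d)) : Config d M where
  carrier := (fun q : Pt d M => (q.1 + y, q.2)) '' S.carrier
  locallyFinite := fun B hB => by
    obtain ⟨r, hr⟩ := hB.exists_norm_le
    refine ((S.locallyFinite (Metric.closedBall 0 (r + ‖y‖)) Metric.isBounded_closedBall).image
      (fun q : Pt d M => (q.1 + y, q.2))).subset ?_
    rintro _ ⟨⟨q, hq, rfl⟩, hqB⟩
    refine ⟨q, ⟨hq, ?_⟩, rfl⟩
    have h1 := hr _ hqB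
    have h2 := norm_sub_le (q.1 + y) y
    simp only [add_sub_cancel_right] at h1 h2
    simp only [mem_preimage, mem_closedBall_zero_iff]
    linarith

/-- The dilation `x + a (S - x)` about `x` by a factor `a ≠ 0` (marks are kept); for the
unused factor `a = 0` it is the empty configuration. -/
def dilateAbout (S : Config d M) (x : EuclideanSpace ℝ (Fin d)) (a : ℝ) : Config d M where
  carrier := (fun q : Pt d M => (x + a • (q.1 - x), q.2)) '' {q ∈ S.carrier | a ≠ 0}
  locallyFinite := fun B hB => by
    obtain ⟨r, hr⟩ := hB.exists_norm_le
    refine ((S.locallyFinite (Metric.closedBall 0 (‖x‖ + ‖a⁻¹‖ * (r + ‖x‖)))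
      Metric.isBounded_closedBall).image
      (fun q : Pt d M => (x + a • (q.1 - x), q.2))).subset ?_
    rintro _ ⟨⟨q, ⟨hq, ha⟩, rfl⟩, hqB⟩
    refine ⟨q, ⟨hq, ?_⟩, rfl⟩
    have h1 : ‖x + a • (q.1 - x)‖ ≤ r := hr _ hqB
    have h2 := norm_sub_le (x + a • (q.1 - x)) x
    have h3 : q.1 = x + a⁻¹ • (x + a • (q.1 - x) - x) := by
      rw [add_sub_cancel_left, smul_smul, inv_mul_cancel₀ ha, one_smul]
      abel
    have h4 : ‖q.1‖ ≤ ‖x‖ + ‖a⁻¹‖ * ‖x + a • (q.1 - x) - x‖ := by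
      conv_lhs => rw [h3]
      exact (norm_add_le _ _).trans (by rw [norm_smul])
    simp only [mem_preimage, mem_closedBall_zero_iff]
    refine h4.trans ?_
    gcongr
    linarith

end Config

variable {d : ℕ} {M : Type*}

/-- `P` is the law of a Poisson process with intensity measure `μ`: the number of points in a
measurable set `B` is Poisson distributed with parameter `μ B` (almost surely infinite if
`μ B = ∞`), and the numbers of points in disjoint measurable sets are independent. -/
structure IsPoissonLaw [MeasurableSpace M] (μ : Measure (Pt d M))
    (P : Measure (Config d M)) : Prop where
  isProbabilityMeasure : IsProbabilityMeasure P
  map_count : ∀ B : Set (Pt d M), MeasurableSet B → μ B ≠ ∞ →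
    P.map (Config.count B) = (poissonMeasure (μ B).toNNReal).map (fun k : ℕ => (k : ℕ∞))
  count_eq_top : ∀ B : Set (Pt d M), MeasurableSet B → μ B = ∞ →
    ∀ᵐ S ∂P, Config.count B S = ⊤
  iIndepFun_count : ∀ (n : ℕ) (B : Fin n → Set (Pt d M)), (∀ k, MeasurableSet (B k)) →
    Pairwise (fun k l => Disjoint (B k) (B l)) → iIndepFun (fun k => Config.count (B k)) P

/-- `u` times the product of Lebesgue measure and the mark distribution `Q`. -/
def stationaryIntensity [MeasurableSpace M] (d : ℕ) (Q : Measure M) (u : ℝ) :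
    Measure (Pt d M) :=
  ENNReal.ofReal u • (volume : Measure (EuclideanSpace ℝ (Fin d))).prod Q

/-- `s` times the product of the measure with density `g 1_W` and the mark distribution `Q`. -/
def intensity [MeasurableSpace M] (Q : Measure M) (W : Set (EuclideanSpace ℝ (Fin d)))
    (g : EuclideanSpace ℝ (Fin d) → ℝ) (s : ℝ) : Measure (Pt d M) :=
  ENNReal.ofReal s •
    ((volume.restrict W).withDensity (fun x => ENNReal.ofReal (g x))).prod Q

/-- Score functions. -/
abbrev Score (d : ℕ) (M : Type*) := Pt d M → Config d M → ℝ

/-- The scaled score `ξ_s((x, m), S) = ξ((x, m), x + s^{1/d} (S - x))` generated by `ξ`. -/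
def scaledScore (ξ : Score d M) (s : ℝ) : Score d M :=
  fun p S => ξ p (S.dilateAbout p.1 (s ^ (1 / (d : ℝ))))

/-- Translation invariance in the spatial coordinate. -/
def TranslationInvariant (ξ : Score d M) : Prop :=
  ∀ (x y : EuclideanSpace ℝ (Fin d)) (m : M) (S : Config d M),
    ξ (x, m) S = ξ (x + y, m) (S.translate y)

/-- Convention on scores at points that do not belong to the configuration: the point is added. -/
def AddsOwnPoint (W : Set (EuclideanSpace ℝ (Fin d))) (ξ : Score d M) : Prop :=
  ∀ s : ℝ, 1 ≤ s → ∀ x ∈ W, ∀ (m : M) (S : Config d M), (x, m) ∉ S.carrier →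
    scaledScore ξ s (x, m) S = scaledScore ξ s (x, m) (S.add (x, m))

/-- `R` is a radius of stabilization for the scores `η i` (those at a fixed scale). -/
def IsRadiusOfStabilization {k : ℕ} (W : Set (EuclideanSpace ℝ (Fin d)))
    (η : Fin k → Score d M) (R : Pt d M → Config d M → ℝ≥0) : Prop :=
  ∀ i, ∀ x ∈ W, ∀ (m : M) (S : Config d M) (T : Set (Pt d M)) (hT : T.Finite), T.ncard ≤ 9 →
    η i (x, m) ((S ∪ Config.ofFinite T hT).inBall x (R (x, m) S)) =
      η i (x, m) (S ∪ Config.ofFinite T hT)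

/-- The scaled scores generated by `ξ 1, …, ξ k` are intrinsically exponentially stabilizing.
`Pg s` is the law of the Poisson process with density `s g` on `W`, and `Pst u` the law of the
stationary Poisson process of intensity `u`. -/
def IntrinsicallyExponentiallyStabilizing [MeasurableSpace M] {k : ℕ} (Q : Measure M)
    (W : Set (EuclideanSpace ℝ (Fin d))) (g : EuclideanSpace ℝ (Fin d) → ℝ)
    (Pg Pst : ℝ → Measure (Config d M)) (ξ : Fin k → Score d M) : Prop :=
  ∃ R : ℝ → Pt d M → Config d M → ℝ≥0,
    (∀ s, 1 ≤ s → Measurable (Function.uncurry (R s))) ∧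
    (∀ s, 1 ≤ s → IsRadiusOfStabilization W (fun i => scaledScore (ξ i) s) (R s)) ∧
    -- monotone
    (∀ s, 1 ≤ s → ∀ x ∈ W, ∀ (m : M) (S₁ S₂ : Config d M), S₁.carrier ⊆ S₂.carrier →
      R s (x, m) S₂ ≤ R s (x, m) S₁) ∧
    -- locally determined
    (∀ s, 1 ≤ s → ∀ x ∈ W, ∀ (m : M) (S : Config d M) (r : ℝ), 0 ≤ r →
      ((R s (x, m) S : ℝ) ≤ r ↔ (R s (x, m) (S.inBall x r) : ℝ) ≤ r)) ∧
    -- exponential tails, for the given and for the stationary Poisson processes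
    ∃ C c : ℝ, 0 < C ∧ 0 < c ∧
      (∀ s, 1 ≤ s → ∀ x ∈ W, ∀ r : ℝ, 0 ≤ r →
        (Q.prod (Pg s)) {q | r ≤ R s (x, q.1) q.2} ≤
          ENNReal.ofReal (C * Real.exp (-c * s * r ^ d))) ∧
      (∀ s, 1 ≤ s → ∀ x ∈ W, ∀ y ∈ W, ∀ r : ℝ, 0 ≤ r →
        (Q.prod (Pst (s * g y))) {q | r ≤ R s (x, q.1) q.2} ≤
          ENNReal.ofReal (C * Real.exp (-c * s * r ^ d)))

/-- `(𝒜, t)`: the points of the finite set `𝒜` equipped with the marks `t`. -/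
def withMarks (𝒜 : Finset (EuclideanSpace ℝ (Fin d))) (t : 𝒜 → M) : Config d M :=
  Config.ofFinite (range fun a : 𝒜 => ((a : EuclideanSpace ℝ (Fin d)), t a))
    (finite_range _)

/-- `E |η((x, M_x), S ∪ (𝒜, M_𝒜))|^q`, where `S` has law `P` and the marks `M_x` and `M_a`,
`a ∈ 𝒜`, are independent of each other and of `S` and have distribution `Q`. -/
def scoreMoment [MeasurableSpace M] (Q : Measure M) (P : Measure (Config d M)) (η : Score d M)
    (x : EuclideanSpace ℝ (Fin d)) (𝒜 : Finset (EuclideanSpace ℝ (Fin d))) (q : ℝ) : ℝ≥0∞ :=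
  ∫⁻ w, ‖η (x, w.1) (w.2.2 ∪ withMarks 𝒜 w.2.1)‖ₑ ^ q
    ∂(Q.prod ((Measure.pi fun _ : 𝒜 => Q).prod P))

/-- The moment condition of order `6 + p`, for the given and for the stationary Poisson
processes. -/
def MomentCondition [MeasurableSpace M] {k : ℕ} (Q : Measure M)
    (W : Set (EuclideanSpace ℝ (Fin d))) (g : EuclideanSpace ℝ (Fin d) → ℝ)
    (Pg Pst : ℝ → Measure (Config d M)) (ξ : Fin k → Score d M) (p : ℝ) : Prop :=
  ∃ C : ℝ, 0 < C ∧
    (∀ i, ∀ 𝒜 : Finset (EuclideanSpace ℝ (Fin d)), ↑𝒜 ⊆ W → 𝒜.card ≤ 9 →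
      ∀ s, 1 ≤ s → ∀ x ∈ W, x ∉ 𝒜 →
        scoreMoment Q (Pg s) (scaledScore (ξ i) s) x 𝒜 (6 + p) ≤ ENNReal.ofReal C) ∧
    (∀ i, ∀ 𝒜 : Finset (EuclideanSpace ℝ (Fin d)), 𝒜.card ≤ 9 →
      ∀ s, 1 ≤ s → ∀ x ∈ W, ∀ y ∈ W, x ∉ 𝒜 →
        scoreMoment Q (Pst (s * g y)) (scaledScore (ξ i) s) x 𝒜 (6 + p) ≤ ENNReal.ofReal C)

/-- The sum of the scores `η(q, S)` over the points `q` of `S` with location in `A` (a finite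
sum if `A` is bounded). -/
def scoreSum (η : Score d M) (A : Set (EuclideanSpace ℝ (Fin d))) (S : Config d M) : ℝ :=
  ∑ᶠ q ∈ S.carrier ∩ Prod.fst ⁻¹' A, η q S

/-- `V` is the limit, as `s → ∞`, of the covariance matrices of the vectors
`s^{-1/2} (∑_{q ∈ S, q ∈ A × M} ξ i_s(q, S))_i`, where `S` is a stationary Poisson process of
intensity `s u`. -/
def IsAsymptoticCovariance [MeasurableSpace M] {k : ℕ} (Pst : ℝ → Measure (Config d M))
    (ξ : Fin k → Score d M) (A : Set (EuclideanSpace ℝ (Fin d))) (u : ℝ)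
    (V : Matrix (Fin k) (Fin k) ℝ) : Prop :=
  ∀ i j, Tendsto
    (fun s : ℝ => covariance
      (fun S => 1 / √s * scoreSum (scaledScore (ξ i) s) A S)
      (fun S => 1 / √s * scoreSum (scaledScore (ξ j) s) A S) (Pst (s * u)))
    atTop (𝓝 (V i j))

section Sigma

variable [MeasurableSpace M] (Q : Measure M) (P : Measure (Config d M)) (ξ₁ ξ₂ : Score d M)

/-- The random variable `ξ₁((x, M_x), S) ξ₂((x, M_x), S)`, as a function of `(M_x, S)`. -/
def diagProd (x : EuclideanSpace ℝ (Fin d)) (w : M × Config d M) : ℝ :=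
  ξ₁ (x, w.1) w.2 * ξ₂ (x, w.1) w.2

/-- The random variable
`ξ₁((x, M_x), S ∪ {(x + y, M_{x+y})}) ξ₂((x, M_{x+y}), (S ∪ {(x, M_x)}) - y)`,
as a function of `(M_x, M_{x+y}, S)`. -/
def offDiagProd (x y : EuclideanSpace ℝ (Fin d)) (w : M × M × Config d M) : ℝ :=
  ξ₁ (x, w.1) (w.2.2.add (x + y, w.2.1)) *
    ξ₂ (x, w.2.1) ((w.2.2.add (x, w.1)).translate (-y))

/-- `E ξ₁((x, M_x), S ∪ {(x + y, M_{x+y})}) ξ₂((x, M_{x+y}), (S ∪ {(x, M_x)}) - y)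
- E ξ₁((x, M_x), S) E ξ₂((x, M_{x+y}), S - y)`, where `S` has law `P`. -/
def pairCov (x y : EuclideanSpace ℝ (Fin d)) : ℝ :=
  ∫ w, offDiagProd ξ₁ ξ₂ x y w ∂(Q.prod (Q.prod P)) -
    (∫ w, ξ₁ (x, w.1) w.2 ∂(Q.prod P)) * ∫ w, ξ₂ (x, w.1) (w.2.translate (-y)) ∂(Q.prod P)

end Sigma

/-- The entry `σ_ij` of the asymptotic covariance matrix, for the scores `ξ₁ = ξ i`, `ξ₂ = ξ j`,
the sets `A₁ = A i`, `A₂ = A j` and the test functions `f₁ = f i`, `f₂ = f j`. -/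
def sigmaEntry [MeasurableSpace M] (Q : Measure M) (g : EuclideanSpace ℝ (Fin d) → ℝ)
    (Pst : ℝ → Measure (Config d M)) (ξ₁ ξ₂ : Score d M)
    (A₁ A₂ : Set (EuclideanSpace ℝ (Fin d))) (f₁ f₂ : EuclideanSpace ℝ (Fin d) → ℝ) : ℝ :=
  (∫ x in A₁ ∩ A₂, (∫ w, diagProd ξ₁ ξ₂ x w ∂(Q.prod (Pst (g x)))) * f₁ x * f₂ x * g x) +
    ∫ x in A₁ ∩ A₂, ∫ y, pairCov Q (Pst (g x)) ξ₁ ξ₂ x y * f₁ x * f₂ x * g x ^ 2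

/-- All expectations and integrals in the definition of `σ_ij` converge absolutely. -/
def SigmaEntryConverges [MeasurableSpace M] (Q : Measure M) (g : EuclideanSpace ℝ (Fin d) → ℝ)
    (Pst : ℝ → Measure (Config d M)) (ξ₁ ξ₂ : Score d M)
    (A₁ A₂ : Set (EuclideanSpace ℝ (Fin d))) (f₁ f₂ : EuclideanSpace ℝ (Fin d) → ℝ) : Prop :=
  (∀ x ∈ A₁ ∩ A₂,
    Integrable (diagProd ξ₁ ξ₂ x) (Q.prod (Pst (g x))) ∧
    Integrable (fun w => ξ₁ (x, w.1) w.2) (Q.prod (Pst (g x))) ∧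
    (∀ᵐ y : EuclideanSpace ℝ (Fin d),
      Integrable (offDiagProd ξ₁ ξ₂ x y) (Q.prod (Q.prod (Pst (g x)))) ∧
      Integrable (fun w => ξ₂ (x, w.1) (w.2.translate (-y))) (Q.prod (Pst (g x)))) ∧
    Integrable (fun y => pairCov Q (Pst (g x)) ξ₁ ξ₂ x y * f₁ x * f₂ x * g x ^ 2)) ∧
  IntegrableOn (fun x => (∫ w, diagProd ξ₁ ξ₂ x w ∂(Q.prod (Pst (g x)))) * f₁ x * f₂ x * g x)
    (A₁ ∩ A₂) ∧
  IntegrableOn (fun x => ∫ y, ‖pairCov Q (Pst (g x)) ξ₁ ξ₂ x y * f₁ x * f₂ x * g x ^ 2‖)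
    (A₁ ∩ A₂)

/-- The asymptotic covariance matrix `Σ = (σ_ij)`. -/
def sigmaMatrix [MeasurableSpace M] {k : ℕ} (Q : Measure M) (g : EuclideanSpace ℝ (Fin d) → ℝ)
    (Pst : ℝ → Measure (Config d M)) (ξ : Fin k → Score d M)
    (A : Fin k → Set (EuclideanSpace ℝ (Fin d))) (f : Fin k → EuclideanSpace ℝ (Fin d) → ℝ) :
    Matrix (Fin k) (Fin k) ℝ :=
  Matrix.of fun i j => sigmaEntry Q g Pst (ξ i) (ξ j) (A i) (A j) (f i) (f j)

end StabScore

end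

/-! ### Point configurations: counts, counting measures, joint measurability of adding a point. -/

noncomputable section

namespace StabScore

namespace Config

variable {d : ℕ} {M : Type*}

/-! Fix `x ∈ W`, put `u = g x`, and let `D_ij(x)` be `covDensity`: `u` times the diagonal
expectation plus `u²` times the integral over `y` of `pairCov`. Then `σ_ij` is the integral of `D_ij
f_i f_j` over `A_i ∩ A_j`, so the quadratic form of `Σ` at `c` is the integral of `v(x)ᵀ D(x) v(x)`
with `v_i = c_i 1_{A_i} f_i`. If every `D(x)` is positive definite, the integrand is nonnegative and
is positive wherever `v(x) ≠ 0`. For `c ≠ 0` this set has positive measure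
(`posDef_of_setIntegral`).

Positive definiteness of `D(x)` comes from the assumption on stationary input, by uniqueness of
limits. The bivariate Mecke equation and stationarity express the covariance of two score sums over
a bounded set as its volume times the diagonal term plus an integral of `pairCov` against the
overlap of the set with its translate (`covariance_scoreSum`). A dilation by `s^{1/d}` turns scaled
scores at intensity `s u` into unscaled scores at intensity `u` on a blown-up set. After division by
`s` the volume factor cancels, and dominated convergence gives the limit `|A| D(x)`
(`tendsto_covariance_scaled`). The limit is positive definite by assumption, hence so is `D(x)`.

Everything rests on integrability of `pairCov` in `y`, uniformly in `x` (`abs_pairCov_le`). When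
both radii of stabilization are at most `‖y‖/3`, the two scores ignore each other's added point and
depend on the process in disjoint balls, where a Poisson process is independent. The exceptional
events have Gaussian-small probability because `d ≥ 2`, and fourth moments control what happens on
them.

A Poisson law is given here only through its counts. Independence over disjoint sets, uniqueness,
the Mecke equations and measurable dependence on the intensity are therefore derived from
finite-dimensional count distributions, by splitting finitely many sets into disjoint atoms and
using a π-system argument. -/

@[ext]
theorem ext {S T : Config d M} (h : S.carrier = T.carrier) : S = T := by
  cases S; cases T; cases h; rfl

@[simp]
theorem carrier_union (S T : Config d M) : (S ∪ T).carrier = S.carrier ∪ T.carrier := rfl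

@[simp]
theorem carrier_ofFinite (T : Set (Pt d M)) (hT : T.Finite) : (ofFinite T hT).carrier = T := rfl

@[simp]
theorem carrier_add (S : Config d M) (p : Pt d M) : (S.add p).carrier = insert p S.carrier := by
  simp [add]

@[simp]
theorem carrier_inBall (S : Config d M) (x : EuclideanSpace ℝ (Fin d)) (r : ℝ) :
    (S.inBall x r).carrier = S.carrier ∩ Prod.fst ⁻¹' Metric.closedBall x r := rfl

@[simp]
theorem carrier_translate (S : Config d M) (y : EuclideanSpace ℝ (Fin d)) :
    (S.translate y).carrier = (fun q : Pt d M => (q.1 + y, q.2)) '' S.carrier := rfl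

theorem carrier_dilateAbout (S : Config d M) (x : EuclideanSpace ℝ (Fin d)) {a : ℝ} (ha : a ≠ 0) :
    (S.dilateAbout x a).carrier =
      (fun q : Pt d M => (x + a • (q.1 - x), q.2)) '' S.carrier := by
  simp [dilateAbout, ha]

theorem translate_translate (S : Config d M) (y z : EuclideanSpace ℝ (Fin d)) :
    (S.translate y).translate z = S.translate (y + z) := by
  ext1; simp [image_image, add_assoc]

theorem translate_add (S : Config d M) (p : Pt d M) (y : EuclideanSpace ℝ (Fin d)) :
    (S.add p).translate y = (S.translate y).add (p.1 + y, p.2) := by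
  ext1; simp [image_insert_eq]

theorem add_comm (S : Config d M) (p q : Pt d M) : (S.add p).add q = (S.add q).add p := by
  ext1; simp [insert_comm]

theorem add_of_mem {S : Config d M} {p : Pt d M} (h : p ∈ S.carrier) : S.add p = S := by
  ext1; simp [h]

theorem dilateAbout_one (S : Config d M) (x : EuclideanSpace ℝ (Fin d)) :
    S.dilateAbout x 1 = S := by
  ext1; simp [carrier_dilateAbout]

theorem count_image {S T : Config d M} {t : Pt d M → Pt d M} (ht : Function.Injective t)
    (h : T.carrier = t '' S.carrier) (B : Set (Pt d M)) : count B T = count (t ⁻¹' B) S := by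
  rw [count, count, h, ← image_inter_preimage, ht.encard_image]

theorem count_inBall (S : Config d M) (x : EuclideanSpace ℝ (Fin d)) (r : ℝ) (B : Set (Pt d M)) :
    count B (S.inBall x r) = count (Prod.fst ⁻¹' Metric.closedBall x r ∩ B) S := by
  simp [count, inter_assoc]

theorem count_lt_top (S : Config d M) {B : Set (Pt d M)} {K : Set (EuclideanSpace ℝ (Fin d))}
    (hK : Bornology.IsBounded K) (hB : B ⊆ Prod.fst ⁻¹' K) : count B S < ⊤ := by
  rw [count, encard_lt_top_iff]
  exact (S.locallyFinite K hK).subset (inter_subset_inter_right _ hB)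

/-- Marked points whose location has norm in `[n, n + 1)`. -/
def shell (d : ℕ) (M : Type*) (n : ℕ) : Set (Pt d M) := {q | ⌊‖q.1‖⌋₊ = n}

theorem shell_subset (n : ℕ) :
    shell d M n ⊆ Prod.fst ⁻¹' Metric.closedBall (0 : EuclideanSpace ℝ (Fin d)) (n + 1) := by
  intro q hq
  have h := Nat.lt_floor_add_one ‖q.1‖
  rw [show ⌊‖q.1‖⌋₊ = n from hq] at h
  simpa using h.le

theorem iUnion_shell : ⋃ n, shell d M n = univ := by
  ext q; simp [shell]

theorem pairwise_disjoint_shell : Pairwise (Function.onFun Disjoint (shell d M)) := by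
  intro m n hmn
  rw [Function.onFun, Set.disjoint_left]
  intro q hm hn
  exact hmn (hm.symm.trans hn)

/-- The set of configurations and points such that the configuration has no point at the
location of the given point. -/
def freePairs (d : ℕ) (M : Type*) : Set (Config d M × Pt d M) :=
  {z | count (Prod.fst ⁻¹' {z.2.1}) z.1 = 0}

theorem notMem_of_mem_freePairs {S : Config d M} {p : Pt d M} (h : (S, p) ∈ freePairs d M) :
    p ∉ S.carrier := by
  intro hp
  have h' : (S.carrier ∩ Prod.fst ⁻¹' {p.1}).encard = 0 := h
  rw [encard_eq_zero] at h'
  exact (h' ▸ (⟨hp, rfl⟩ : p ∈ S.carrier ∩ Prod.fst ⁻¹' {p.1}) : p ∈ (∅ : Set (Pt d M)))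

theorem count_add_of_notMem {S : Config d M} {p : Pt d M} (h : p ∉ S.carrier)
    (B : Set (Pt d M)) : count B (S.add p) = count B S + B.indicator 1 p := by
  classical
  rw [count, carrier_add]
  by_cases hp : p ∈ B
  · rw [insert_inter_of_mem hp, encard_insert_of_notMem (fun h' => h h'.1)]
    simp [hp, count]
  · rw [insert_inter_of_notMem hp]
    simp [hp, count]

open Classical in
/-- Adds a point to a configuration unless its location is occupied. This agrees almost surely
with `Config.add` and is jointly measurable. -/
def addFree (S : Config d M) (p : Pt d M) : Config d M :=
  if (S, p) ∈ freePairs d M then S.add p else S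

theorem addFree_of_mem {S : Config d M} {p : Pt d M} (h : (S, p) ∈ freePairs d M) :
    S.addFree p = S.add p := if_pos h

variable [MeasurableSpace M]

theorem measurable_count {B : Set (Pt d M)} (hB : MeasurableSet B) :
    Measurable (count (d := d) (M := M) B) := by
  rw [measurable_iff_comap_le]
  exact le_iSup₂ (f := fun (B : Set (Pt d M)) (_ : MeasurableSet B) =>
    MeasurableSpace.comap (count B) inferInstance) B hB

theorem measurable_of_count {α : Type*} [MeasurableSpace α] {f : α → Config d M}
    (h : ∀ B : Set (Pt d M), MeasurableSet B → Measurable fun a => count B (f a)) :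
    Measurable f := by
  rw [measurable_iff_comap_le]
  change MeasurableSpace.comap f (⨆ (B : Set (Pt d M)) (_ : MeasurableSet B),
    MeasurableSpace.comap (count B) inferInstance) ≤ _
  simp only [MeasurableSpace.comap_iSup, MeasurableSpace.comap_comp, iSup_le_iff]
  intro B hB
  exact measurable_iff_comap_le.1 (h B hB)

theorem measurable_of_toENNReal {α : Type*} [MeasurableSpace α] {N : α → ℕ∞}
    (h : Measurable fun a => (N a : ℝ≥0∞)) : Measurable N := by
  refine measurable_to_countable' fun k => ?_
  have : N ⁻¹' {k} = (fun a => (N a : ℝ≥0∞)) ⁻¹' {(k : ℝ≥0∞)} := by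
    ext a; simp
  rw [this]
  exact h (measurableSet_singleton _)

/-- The counting measure of the points of a configuration. -/
def pointMeasure (S : Config d M) : Measure (Pt d M) :=
  Measure.sum fun q : S.carrier => Measure.dirac (q : Pt d M)

theorem pointMeasure_apply (S : Config d M) {B : Set (Pt d M)} (hB : MeasurableSet B) :
    S.pointMeasure B = (count B S : ℝ≥0∞) := by
  rw [pointMeasure, Measure.sum_apply _ hB, count, ← ENNReal.tsum_set_one,
    tsum_subtype (S.carrier ∩ B) (fun _ => (1 : ℝ≥0∞)),
    tsum_subtype S.carrier (fun q => Measure.dirac q B)]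
  refine tsum_congr fun q => ?_
  rw [← indicator_indicator]
  simp only [indicator, Measure.dirac_apply' _ hB, Pi.one_apply]

/-- The kernel that sends a configuration to its counting measure. -/
def pointKernel (d : ℕ) (M : Type*) [MeasurableSpace M] : Kernel (Config d M) (Pt d M) where
  toFun := pointMeasure
  measurable' := by
    refine Measure.measurable_of_measurable_coe _ fun B hB => ?_
    simp_rw [pointMeasure_apply _ hB]
    exact (measurable_of_countable _).comp (measurable_count hB)

theorem pointKernel_apply (S : Config d M) : pointKernel d M S = S.pointMeasure := rfl

theorem measurableSet_shell (n : ℕ) : MeasurableSet (shell d M n) := by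
  have : Measurable fun q : Pt d M => ⌊‖q.1‖⌋₊ :=
    Nat.measurable_floor.comp measurable_fst.norm
  exact this (measurableSet_singleton n)

-- Counting measures of configurations have no uniform bound, even on a bounded shell. The kernel is
-- therefore cut twice, by shell and by the value of the count in that shell, and each piece is
-- bounded by that value.
open Classical in
instance : IsSFiniteKernel (pointKernel d M) := by
  let E : ℕ × ℕ → Set (Config d M) := fun p => count (shell d M p.1) ⁻¹' {(p.2 : ℕ∞)}
  have hE : ∀ p, MeasurableSet (E p) := fun p =>
    measurable_count (measurableSet_shell p.1) (measurableSet_singleton _)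
  let κ : ℕ × ℕ → Kernel (Config d M) (Pt d M) := fun p =>
    Kernel.piecewise (hE p) ((pointKernel d M).restrict (measurableSet_shell p.1)) 0
  have hκ : ∀ p, IsFiniteKernel (κ p) := by
    intro p
    refine ⟨⟨(p.2 : ℝ≥0∞), ENNReal.natCast_lt_top _, fun S => ?_⟩⟩
    rw [Kernel.piecewise_apply']
    split_ifs with h
    · rw [Kernel.restrict_apply' _ _ _ MeasurableSet.univ, univ_inter, pointKernel_apply,
        pointMeasure_apply _ (measurableSet_shell _), show count _ S = _ from h]
      simp
    · simp
  have hsum : pointKernel d M = Kernel.sum κ := by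
    ext S B hB
    rw [Kernel.sum_apply' _ _ hB, ENNReal.tsum_prod']
    have h1 : (pointKernel d M S) B = ∑' n, (pointKernel d M S) (B ∩ shell d M n) := by
      rw [← measure_iUnion (fun m n hmn => (pairwise_disjoint_shell hmn).mono
        inter_subset_right inter_subset_right) (fun n => hB.inter (measurableSet_shell n)),
        ← inter_iUnion, iUnion_shell, inter_univ]
    rw [h1]
    refine tsum_congr fun n => ?_
    obtain ⟨j, hj⟩ := ENat.ne_top_iff_exists.1
      (S.count_lt_top Metric.isBounded_closedBall (shell_subset (d := d) (M := M) n)).ne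
    -- For a given configuration exactly one of the pieces over shell `n` is switched on, namely the
    -- one labelled by its finite count `j` there.
    rw [tsum_eq_single j]
    · rw [Kernel.piecewise_apply', if_pos (show S ∈ E (n, j) from hj.symm),
        Kernel.restrict_apply' _ _ _ hB]
    · intro i hi
      rw [Kernel.piecewise_apply', if_neg]
      · simp
      · intro h
        apply hi
        have : ((j : ℕ) : ℕ∞) = i := hj.trans h
        exact_mod_cast this.symm
  rw [hsum]
  exact Kernel.isSFiniteKernel_sum

instance (S : Config d M) : SFinite S.pointMeasure := by
  rw [← pointKernel_apply]; infer_instance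

theorem measurable_lintegral_pointMeasure {α : Type*} [MeasurableSpace α] {h : α → Pt d M → ℝ≥0∞}
    {f : α → Config d M} (hf : Measurable f) (hh : Measurable (Function.uncurry h)) :
    Measurable fun a => ∫⁻ q, h a q ∂(f a).pointMeasure :=
  Measurable.lintegral_kernel_prod_right (κ := (pointKernel d M).comap f hf) hh

/-- The count of a set that varies with the parameter is the integral of a jointly measurable
indicator against the s-finite kernel of counting measures. -/
theorem measurable_count_section {α : Type*} [MeasurableSpace α] {f : α → Config d M}
    (hf : Measurable f) {B : α → Set (Pt d M)} (hB : MeasurableSet {z : α × Pt d M | z.2 ∈ B z.1}) :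
    Measurable fun a => count (B a) (f a) := by
  refine measurable_of_toENNReal ?_
  have h := measurable_lintegral_pointMeasure (h := fun a q => (B a).indicator 1 q) hf
    (measurable_one.indicator hB)
  have hBa : ∀ a, MeasurableSet (B a) := fun a => measurable_prodMk_left hB
  simpa only [lintegral_indicator_one (hBa _), pointMeasure_apply _ (hBa _)] using h

theorem measurable_translate :
    Measurable fun z : Config d M × EuclideanSpace ℝ (Fin d) => z.1.translate z.2 := by
  refine measurable_of_count fun B hB => ?_
  have h : ∀ z : Config d M × EuclideanSpace ℝ (Fin d), count B (z.1.translate z.2) =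
      count ((fun q : Pt d M => (q.1 + z.2, q.2)) ⁻¹' B) z.1 := fun z =>
    count_image (fun p q hpq => by simpa [Prod.ext_iff] using hpq) (carrier_translate _ _) B
  simp_rw [h]
  refine measurable_count_section measurable_fst ?_
  have : Measurable fun w : (Config d M × EuclideanSpace ℝ (Fin d)) × Pt d M =>
    (w.2.1 + w.1.2, w.2.2) := by fun_prop
  exact this hB

theorem measurable_translate_right (y : EuclideanSpace ℝ (Fin d)) :
    Measurable fun S : Config d M => S.translate y :=
  measurable_translate.comp (measurable_id.prodMk measurable_const)

theorem measurable_inBall (x : EuclideanSpace ℝ (Fin d)) (r : ℝ) :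
    Measurable fun S : Config d M => S.inBall x r := by
  refine measurable_of_count fun B hB => ?_
  simp_rw [count_inBall]
  exact measurable_count ((Metric.isClosed_closedBall.measurableSet.preimage measurable_fst).inter hB)

/-- Only locations are compared, so the measurable diagonal of Euclidean space suffices and nothing
is required of the mark space. This is why freeness is tested on locations and not on marked points.
-/
theorem measurableSet_freePairs : MeasurableSet (freePairs d M) := by
  refine (measurable_count_section (f := fun z : Config d M × Pt d M => z.1)
    (B := fun z => Prod.fst ⁻¹' {z.2.1}) measurable_fst ?_) (measurableSet_singleton 0)
  exact measurableSet_eq_fun (by fun_prop) (by fun_prop)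

theorem measurable_addFree : Measurable fun z : Config d M × Pt d M => z.1.addFree z.2 := by
  classical
  refine measurable_of_count fun B hB => ?_
  have h : (fun z : Config d M × Pt d M => count B (z.1.addFree z.2)) =
      (freePairs d M).piecewise (fun z => count B z.1 + B.indicator 1 z.2)
        (fun z => count B z.1) := by
    ext1 z
    by_cases hz : z ∈ freePairs d M
    · rw [piecewise_eq_of_mem _ _ _ hz, addFree_of_mem hz,
        count_add_of_notMem (notMem_of_mem_freePairs hz)]
    · rw [piecewise_eq_of_notMem _ _ _ hz, addFree, if_neg hz]
  rw [h]
  have h1 : Measurable fun z : Config d M × Pt d M => count B z.1 :=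
    (measurable_count hB).comp measurable_fst
  have h2 : Measurable fun z : Config d M × Pt d M => B.indicator (1 : Pt d M → ℕ∞) z.2 :=
    (measurable_one.indicator hB).comp measurable_snd
  have h3 : Measurable fun z : Config d M × Pt d M => count B z.1 + B.indicator 1 z.2 :=
    (measurable_of_countable (fun n : ℕ∞ × ℕ∞ => n.1 + n.2)).comp (h1.prodMk h2)
  exact h3.piecewise measurableSet_freePairs h1

theorem pointMeasure_add_of_notMem {S : Config d M} {p : Pt d M} (h : p ∉ S.carrier) :
    (S.add p).pointMeasure = S.pointMeasure + Measure.dirac p := by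
  classical
  ext B hB
  rw [Measure.add_apply, pointMeasure_apply _ hB, pointMeasure_apply _ hB,
    Measure.dirac_apply' _ hB, count_add_of_notMem h]
  by_cases hp : p ∈ B <;> simp [hp]

end Config

end StabScore

end

/-! ### Finite-dimensional count distributions of a Poisson process. -/

noncomputable section

namespace StabScore

open Config

variable {d : ℕ} {M : Type*}

section Atoms

variable {ι : Type*}

/-- The atoms of the partition generated by a family of sets. -/
def atom {α : Type*} (B : ι → Set α) (T : Set ι) : Set α := {q | {i | q ∈ B i} = T}

theorem pairwise_disjoint_atom {α : Type*} (B : ι → Set α) :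
    Pairwise fun T U => Disjoint (atom B T) (atom B U) := by
  intro T U hTU
  rw [Set.disjoint_left]
  intro q hT hU
  exact hTU (hT.symm.trans hU)

theorem measurableSet_atom {α : Type*} [MeasurableSpace α] [Countable ι] {B : ι → Set α}
    (hB : ∀ i, MeasurableSet (B i)) (T : Set ι) : MeasurableSet (atom B T) := by
  have : atom B T = ⋂ i, {q | q ∈ B i ↔ i ∈ T} := by
    ext q; simp [atom, Set.ext_iff]
  rw [this]
  refine MeasurableSet.iInter fun i => ?_
  by_cases hi : i ∈ T
  · simpa [hi] using hB i
  · simp only [hi, iff_false]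
    exact (hB i).compl

theorem iUnion_atom {α : Type*} (B : ι → Set α) (i : ι) :
    B i = ⋃ T : {T : Set ι // i ∈ T}, atom B T := by
  ext q
  simp only [mem_iUnion, Subtype.exists, exists_prop]
  constructor
  · intro hq
    exact ⟨{i | q ∈ B i}, hq, rfl⟩
  · rintro ⟨T, hi, rfl⟩
    exact hi

variable [Fintype ι]

open Classical in
/-- The counts of a family of sets in terms of the counts of the atoms. -/
def sumAtoms (n : Set ι → ℕ∞) (i : ι) : ℕ∞ := ∑ T : {T : Set ι // i ∈ T}, n T

/-- Overlapping sets have dependent counts, but these are functions of the counts of the disjoint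
atoms, which are independent for a Poisson law. -/
theorem count_eq_sumAtoms (B : ι → Set (Pt d M)) (S : Config d M) :
    (fun i => count (B i) S) = sumAtoms fun T => count (atom B T) S := by
  classical
  ext1 i
  rw [sumAtoms, count, iUnion_atom B i, inter_iUnion, encard_iUnion_of_finite,
    finsum_eq_sum_of_fintype]
  · rfl
  · intro T U hTU
    exact (pairwise_disjoint_atom B (fun h => hTU (Subtype.ext h))).mono
      inter_subset_right inter_subset_right

-- A new point lies in exactly one atom `T` and raises precisely the counts of the sets indexed by
-- `T`. This is the combinatorial core of the Mecke equation.
open Classical in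
theorem sumAtoms_add_single (n : Set ι → ℕ∞) (T : Set ι) (i : ι) :
    sumAtoms (n + Pi.single T 1) i = sumAtoms n i + if i ∈ T then 1 else 0 := by
  simp only [sumAtoms, Pi.add_apply, Finset.sum_add_distrib]
  congr 1
  split_ifs with hi
  · rw [Finset.sum_eq_single (⟨T, hi⟩ : {T : Set ι // i ∈ T})]
    · simp
    · intro U _ hU
      rw [Pi.single_eq_of_ne]
      exact fun h => hU (Subtype.ext h)
    · simp
  · refine Finset.sum_eq_zero fun U _ => ?_
    rw [Pi.single_eq_of_ne]
    rintro rfl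
    exact hi U.2

end Atoms

variable [MeasurableSpace M]

/-- The events that depend on the numbers of points in finitely many measurable sets. -/
def countEvents (d : ℕ) (M : Type*) [MeasurableSpace M] : Set (Set (Config d M)) :=
  {E | ∃ t ∈ measurableCylinders (fun _ : {B : Set (Pt d M) // MeasurableSet B} => ℕ∞),
    (fun S B => count B.1 S) ⁻¹' t = E}

theorem isPiSystem_countEvents : IsPiSystem (countEvents d M) :=
  isPiSystem_measurableCylinders.comap _

/-- The σ-field is the pullback of the product σ-field on families of counts, which is generated by
cylinders. Together with `isPiSystem_countEvents`, it reduces equality of finite measures to events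
on finitely many counts. -/
theorem generateFrom_countEvents :
    (inferInstance : MeasurableSpace (Config d M)) = MeasurableSpace.generateFrom (countEvents d M) := by
  have h : countEvents d M = preimage (fun S B => count B.1 S) ''
      measurableCylinders (fun _ : {B : Set (Pt d M) // MeasurableSet B} => ℕ∞) := rfl
  rw [h, ← MeasurableSpace.comap_generateFrom, generateFrom_measurableCylinders]
  change _ = MeasurableSpace.comap _ (⨆ B, MeasurableSpace.comap _ _)
  rw [MeasurableSpace.comap_iSup, iSup_subtype]
  simp only [MeasurableSpace.comap_comp]
  rfl

theorem exists_of_mem_countEvents {E : Set (Config d M)} (hE : E ∈ countEvents d M) :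
    ∃ (I : Finset {B : Set (Pt d M) // MeasurableSet B}) (V : Set (I → ℕ∞)),
      E = {S | (fun B : I => count (B : Set (Pt d M)) S) ∈ V} := by
  obtain ⟨t, ht, rfl⟩ := hE
  obtain ⟨I, V, -, rfl⟩ := (mem_measurableCylinders _).1 ht
  exact ⟨I, V, rfl⟩

theorem measurableSet_of_mem_countEvents {E : Set (Config d M)} (hE : E ∈ countEvents d M) :
    MeasurableSet E := by
  have h := MeasurableSpace.measurableSet_generateFrom hE
  rwa [← generateFrom_countEvents] at h

theorem univ_mem_countEvents : univ ∈ countEvents d M :=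
  ⟨univ, univ_mem_measurableCylinders _, rfl⟩

theorem measurable_countVector {κ : Type*} {D : κ → Set (Pt d M)} (hD : ∀ t, MeasurableSet (D t)) :
    Measurable fun (S : Config d M) t => count (D t) S :=
  measurable_pi_lambda _ fun t => measurable_count (hD t)

namespace IsPoissonLaw

variable {μ : Measure (Pt d M)} {P : Measure (Config d M)}

theorem measure_count_eq_natCast (hP : IsPoissonLaw μ P) {B : Set (Pt d M)} (hB : MeasurableSet B)
    (hfin : μ B ≠ ∞) (n : ℕ) : P {S | count B S = n} =
      ENNReal.ofReal (Real.exp (-(μ B).toReal) * (μ B).toReal ^ n / n.factorial) := by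
  have h := congrArg (fun ν => ν {(n : ℕ∞)}) (hP.map_count B hB hfin)
  rw [Measure.map_apply (measurable_count hB) (measurableSet_singleton _),
    Measure.map_apply (measurable_of_countable _) (measurableSet_singleton _)] at h
  have h2 : (fun k : ℕ => (k : ℕ∞)) ⁻¹' {(n : ℕ∞)} = {n} := by ext; simp
  rw [h2, poissonMeasure_singleton] at h
  exact h

theorem measure_count_eq_top (hP : IsPoissonLaw μ P) {B : Set (Pt d M)} (hB : MeasurableSet B)
    (hfin : μ B ≠ ∞) : P {S | count B S = ⊤} = 0 := by
  have h := congrArg (fun ν => ν {(⊤ : ℕ∞)}) (hP.map_count B hB hfin)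
  rw [Measure.map_apply (measurable_count hB) (measurableSet_singleton _),
    Measure.map_apply (measurable_of_countable _) (measurableSet_singleton _)] at h
  have h2 : (fun k : ℕ => (k : ℕ∞)) ⁻¹' {(⊤ : ℕ∞)} = ∅ := by ext; simp
  rw [h2, measure_empty] at h
  exact h

open Classical in
theorem measure_count_of_eq_top (hP : IsPoissonLaw μ P) {B : Set (Pt d M)} (hB : MeasurableSet B)
    (htop : μ B = ∞) (k : ℕ∞) : P {S | count B S = k} = if k = ⊤ then 1 else 0 := by
  have := hP.isProbabilityMeasure
  have h := hP.count_eq_top B hB htop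
  split_ifs with hk
  · subst hk
    exact (mem_ae_iff_prob_eq_one (measurable_count hB (measurableSet_singleton ⊤))).1 h
  · refine measure_mono_null (fun S hS => ?_) (ae_iff.1 h)
    exact fun h' : count B S = ⊤ => hk ((show count B S = k from hS).symm.trans h')

/-- The Poisson weights satisfy `n p_n = r p_{n-1}`, which is the Mecke equation for a single set.
Writing the shift as `count + 1 = k` avoids subtraction; at `k = 0` and `k = ⊤` both sides vanish.
-/
theorem mul_measure_count (hP : IsPoissonLaw μ P) {B : Set (Pt d M)} (hB : MeasurableSet B)
    (hfin : μ B ≠ ∞) (k : ℕ∞) :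
    (k : ℝ≥0∞) * P {S | count B S = k} = μ B * P {S | count B S + 1 = k} := by
  induction k using ENat.recTopCoe with
  | top =>
    have : {S : Config d M | count B S + 1 = ⊤} = {S | count B S = ⊤} := by
      ext S; simp
    rw [this, hP.measure_count_eq_top hB hfin]; simp
  | coe n =>
    cases n with
    | zero =>
      have : {S : Config d M | count B S + 1 = ((0 : ℕ) : ℕ∞)} = ∅ := by ext S; simp
      rw [this]; simp
    | succ n =>
      have : {S : Config d M | count B S + 1 = ((n + 1 : ℕ) : ℕ∞)} = {S | count B S = n} := by
        ext S; simp [ENat.add_left_injective_of_ne_top ENat.one_ne_top |>.eq_iff]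
      rw [this, hP.measure_count_eq_natCast hB hfin, hP.measure_count_eq_natCast hB hfin]
      set r := (μ B).toReal with hr
      have hμ : μ B = ENNReal.ofReal r := (ENNReal.ofReal_toReal hfin).symm
      have hr0 : 0 ≤ r := ENNReal.toReal_nonneg
      have hc : (((n + 1 : ℕ) : ℕ∞) : ℝ≥0∞) = ENNReal.ofReal (n + 1 : ℝ) := by
        rw [ENat.toENNReal_coe, ← ENNReal.ofReal_natCast]; push_cast; rfl
      rw [hμ, hc, ← ENNReal.ofReal_mul (by positivity), ← ENNReal.ofReal_mul hr0]
      congr 1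
      rw [Nat.factorial_succ]
      push_cast
      have : (n.factorial : ℝ) ≠ 0 := by positivity
      field_simp
      ring

theorem ae_count_eq_zero (hP : IsPoissonLaw μ P) {B : Set (Pt d M)} (hB : MeasurableSet B)
    (h0 : μ B = 0) : ∀ᵐ S ∂P, count B S = 0 := by
  have := hP.isProbabilityMeasure
  have h := hP.measure_count_eq_natCast hB (by simp [h0]) 0
  rw [h0] at h
  simp only [Nat.cast_zero, ENNReal.toReal_zero, neg_zero, Real.exp_zero, pow_zero, mul_one,
    Nat.factorial_zero, Nat.cast_one, div_one, ENNReal.ofReal_one] at h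
  exact (mem_ae_iff_prob_eq_one (measurable_count hB (measurableSet_singleton 0))).2 h

section Family

variable {κ : Type*} [Fintype κ] {D : κ → Set (Pt d M)}

theorem iIndepFun_count_fintype (hP : IsPoissonLaw μ P) (hD : ∀ t, MeasurableSet (D t))
    (hdisj : Pairwise fun t u => Disjoint (D t) (D u)) : iIndepFun (fun t => count (D t)) P := by
  let e := Fintype.equivFin κ
  have h := hP.iIndepFun_count (Fintype.card κ) (fun k => D (e.symm k)) (fun k => hD _)
    (fun k l hkl => hdisj (fun h => hkl (e.symm.injective h)))
  have h2 := h.precomp (g := e) e.injective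
  simpa [Function.comp_def] using h2

theorem measure_countVector_eq (hP : IsPoissonLaw μ P) (hD : ∀ t, MeasurableSet (D t))
    (hdisj : Pairwise fun t u => Disjoint (D t) (D u)) (n : κ → ℕ∞) :
    P {S | (fun t => count (D t) S) = n} = ∏ t, P {S | count (D t) S = n t} := by
  have h := (hP.iIndepFun_count_fintype hD hdisj).meas_iInter
    (s := fun t => {S | count (D t) S = n t}) (fun t => ⟨{n t}, measurableSet_singleton _, rfl⟩)
  rw [← h]
  congr 1
  ext S
  simp [funext_iff]

/-- Count vectors take values in a countable space, so the event splits into countably many atoms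
whose probabilities factor by independence. -/
theorem measure_countVector_mem (hP : IsPoissonLaw μ P) (hD : ∀ t, MeasurableSet (D t))
    (hdisj : Pairwise fun t u => Disjoint (D t) (D u)) (V : Set (κ → ℕ∞)) :
    P {S | (fun t => count (D t) S) ∈ V} = ∑' n : V, ∏ t, P {S | count (D t) S = n.1 t} := by
  have h : {S | (fun t => count (D t) S) ∈ V} = ⋃ n : V, {S | (fun t => count (D t) S) = n} := by
    ext S; simp
  rw [h, measure_iUnion]
  · exact tsum_congr fun n => hP.measure_countVector_eq hD hdisj _
  · intro m n hmn
    rw [Function.onFun, Set.disjoint_left]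
    intro S h1 h2
    exact hmn (Subtype.ext (h1.symm.trans h2))
  · exact fun n => measurable_countVector hD (measurableSet_singleton _)

-- On each value of the count vector independence gives a product; the weight `count (D t₀)` touches
-- only the factor at `t₀`, where `mul_measure_count` applies.
open Classical in
theorem setLIntegral_count (hP : IsPoissonLaw μ P) (hD : ∀ t, MeasurableSet (D t))
    (hdisj : Pairwise fun t u => Disjoint (D t) (D u)) (t₀ : κ) (hfin : μ (D t₀) ≠ ∞)
    (V : Set (κ → ℕ∞)) :
    ∫⁻ S in {S | (fun t => count (D t) S) ∈ V}, (count (D t₀) S : ℝ≥0∞) ∂P =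
      μ (D t₀) * P {S | (fun t => count (D t) S) + Pi.single t₀ 1 ∈ V} := by
  have hm : ∀ n : κ → ℕ∞, MeasurableSet {S : Config d M | (fun t => count (D t) S) = n} :=
    fun n => measurable_countVector hD (measurableSet_singleton _)
  let e : κ → ℕ∞ := Pi.single t₀ 1
  change _ = μ (D t₀) * P {S | (fun t => count (D t) S) + e ∈ V}
  have hm' : ∀ n : κ → ℕ∞, MeasurableSet
      {S : Config d M | (fun t => count (D t) S) + e = n} :=
    fun n => ((measurable_of_countable (fun n : κ → ℕ∞ => n + e)).comp
      (measurable_countVector hD)) (measurableSet_singleton n)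
  have hL : {S | (fun t => count (D t) S) ∈ V} = ⋃ n : V, {S | (fun t => count (D t) S) = n} := by
    ext S; simp
  have hR : {S | (fun t => count (D t) S) + e ∈ V} =
      ⋃ n : V, {S | (fun t => count (D t) S) + e = n} := by
    ext S; simp
  rw [hL, hR, lintegral_iUnion (fun n => hm _), measure_iUnion _ (fun n => hm' _),
    ← ENNReal.tsum_mul_left]
  · refine tsum_congr fun n => ?_
    have h1 : ∫⁻ S in {S | (fun t => count (D t) S) = n.1}, (count (D t₀) S : ℝ≥0∞) ∂P =
        ∫⁻ S in {S | (fun t => count (D t) S) = n.1}, (n.1 t₀ : ℝ≥0∞) ∂P := by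
      refine setLIntegral_congr_fun (hm _) fun S hS => ?_
      rw [← show (fun t => count (D t) S) = n.1 from hS]
    have h2 : P {S | (fun t => count (D t) S) + e = n.1} =
        P {S | count (D t₀) S + 1 = n.1 t₀} *
          ∏ t ∈ Finset.univ.erase t₀, P {S | count (D t) S = n.1 t} := by
      have h := (hP.iIndepFun_count_fintype hD hdisj).meas_iInter
        (s := fun t => {S | count (D t) S + e t = n.1 t})
        (fun t => ⟨{k | k + e t = n.1 t}, .of_discrete, rfl⟩)
      rw [← Finset.mul_prod_erase _ _ (Finset.mem_univ t₀)] at h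
      rw [show {S | (fun t => count (D t) S) + e = n.1} =
        ⋂ t, {S | count (D t) S + e t = n.1 t} by
          ext S; simp [funext_iff], h]
      congr 1
      · simp [e]
      · refine Finset.prod_congr rfl fun t ht => ?_
        simp [e, Pi.single_eq_of_ne (Finset.ne_of_mem_erase ht)]
    rw [h1, setLIntegral_const, hP.measure_countVector_eq hD hdisj, h2,
      ← Finset.mul_prod_erase _ _ (Finset.mem_univ t₀), ← mul_assoc,
      hP.mul_measure_count (hD t₀) hfin, mul_assoc]
  · intro m n hmn
    rw [Function.onFun, Set.disjoint_left]
    intro S h1 h2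
    exact hmn (Subtype.ext (h1.symm.trans h2))
  · intro m n hmn
    rw [Function.onFun, Set.disjoint_left]
    intro S h1 h2
    exact hmn (Subtype.ext (h1.symm.trans h2))

end Family

/-- Reduces every count event to single-set probabilities. Both uniqueness of the law and
measurability in the intensity are read off from this formula. -/
theorem measure_countEvent (hP : IsPoissonLaw μ P) {ι : Type*} [Fintype ι]
    {B : ι → Set (Pt d M)} (hB : ∀ i, MeasurableSet (B i)) (V : Set (ι → ℕ∞)) :
    P {S | (fun i => count (B i) S) ∈ V} =
      ∑' n : sumAtoms ⁻¹' V, ∏ᶠ T : Set ι, P {S | count (atom B T) S = n.1 T} := by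
  classical
  simp only [count_eq_sumAtoms B, finprod_eq_prod_of_fintype]
  exact hP.measure_countVector_mem (fun T => measurableSet_atom hB T) (pairwise_disjoint_atom B)
    (sumAtoms ⁻¹' V)

theorem measure_count_congr {P' : Measure (Config d M)} (hP : IsPoissonLaw μ P)
    (hP' : IsPoissonLaw μ P') {B : Set (Pt d M)} (hB : MeasurableSet B) (k : ℕ∞) :
    P {S | count B S = k} = P' {S | count B S = k} := by
  by_cases htop : μ B = ∞
  · rw [hP.measure_count_of_eq_top hB htop, hP'.measure_count_of_eq_top hB htop]
  · induction k using ENat.recTopCoe with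
    | top => rw [hP.measure_count_eq_top hB htop, hP'.measure_count_eq_top hB htop]
    | coe n => rw [hP.measure_count_eq_natCast hB htop, hP'.measure_count_eq_natCast hB htop]

/-- The law of a Poisson process is determined by its intensity measure. -/
theorem unique {P' : Measure (Config d M)} (hP : IsPoissonLaw μ P) (hP' : IsPoissonLaw μ P') :
    P = P' := by
  have := hP.isProbabilityMeasure
  have := hP'.isProbabilityMeasure
  refine ext_of_generate_finite _ generateFrom_countEvents isPiSystem_countEvents ?_ (by simp)
  intro E hE
  obtain ⟨I, V, rfl⟩ := exists_of_mem_countEvents hE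
  rw [hP.measure_countEvent (B := fun B : I => (B : Set (Pt d M))) (fun B => B.1.2),
    hP'.measure_countEvent (B := fun B : I => (B : Set (Pt d M))) (fun B => B.1.2)]
  refine tsum_congr fun n => finprod_congr fun T => ?_
  exact hP.measure_count_congr hP' (measurableSet_atom (fun B => B.1.2) T) _

/-- The image of a Poisson process under an injective transformation of the points. -/
theorem map (hP : IsPoissonLaw μ P) {t : Pt d M → Pt d M} (ht : Measurable t)
    (hinj : Function.Injective t) {f : Config d M → Config d M}
    (hft : ∀ S, (f S).carrier = t '' S.carrier) : IsPoissonLaw (μ.map t) (P.map f) := by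
  have hc : ∀ B : Set (Pt d M), (fun S => count B (f S)) = count (t ⁻¹' B) := fun B =>
    funext fun S => count_image hinj (hft S) B
  have hf : Measurable f := measurable_of_count fun B hB => by
    rw [hc]; exact measurable_count (ht hB)
  have := hP.isProbabilityMeasure
  refine ⟨Measure.isProbabilityMeasure_map hf.aemeasurable, fun B hB hfin => ?_,
    fun B hB htop => ?_, fun n B hB hdisj => ?_⟩
  · rw [Measure.map_map (measurable_count hB) hf]
    rw [Measure.map_apply ht hB] at hfin ⊢
    rw [← hP.map_count _ (ht hB) hfin, ← hc]
    rfl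
  · rw [Measure.map_apply ht hB] at htop
    have h := hP.count_eq_top _ (ht hB) htop
    refine (ae_map_iff hf.aemeasurable (measurable_count hB (measurableSet_singleton ⊤))).2 ?_
    filter_upwards [h] with S hS
    exact (congrFun (hc B) S).trans hS
  · have h := hP.iIndepFun_count n (fun k => t ⁻¹' B k) (fun k => ht (hB k))
      (fun k l hkl => (hdisj hkl).preimage t)
    rw [iIndepFun_iff_measure_inter_preimage_eq_mul] at h ⊢
    intro I s hs
    rw [Measure.map_apply hf (Finset.measurableSet_biInter _ fun i hi =>
      measurable_count (hB i) (hs i hi))]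
    have h' := h I hs
    simp_rw [← hc] at h'
    convert h' using 1
    · simp only [preimage_iInter]; rfl
    · refine Finset.prod_congr rfl fun i hi => ?_
      rw [Measure.map_apply hf (measurable_count (hB i) (hs i hi))]
      rfl

end IsPoissonLaw

end StabScore

end

/-! ### Independence over disjoint sets and the Mecke equations. -/

noncomputable section

namespace StabScore

open Config

variable {d : ℕ} {M : Type*} [MeasurableSpace M]

namespace IsPoissonLaw

variable {μ : Measure (Pt d M)} {P : Measure (Config d M)}

/-- The restrictions of a Poisson process to disjoint sets are independent. -/
theorem indepFun_restrict (hP : IsPoissonLaw μ P) {K₁ K₂ : Set (Pt d M)} (hK₁ : MeasurableSet K₁)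
    (hK₂ : MeasurableSet K₂) (hK : Disjoint K₁ K₂) {f₁ f₂ : Config d M → Config d M}
    (h₁ : ∀ S, (f₁ S).carrier = S.carrier ∩ K₁) (h₂ : ∀ S, (f₂ S).carrier = S.carrier ∩ K₂) :
    IndepFun f₁ f₂ P := by
  classical
  have := hP.isProbabilityMeasure
  have hc₁ : ∀ B S, count B (f₁ S) = count (B ∩ K₁) S := fun B S => by
    rw [count, count, h₁, inter_assoc, inter_comm K₁]
  have hc₂ : ∀ B S, count B (f₂ S) = count (B ∩ K₂) S := fun B S => by
    rw [count, count, h₂, inter_assoc, inter_comm K₂]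
  have hf₁ : Measurable f₁ := measurable_of_count fun B hB => by
    simp_rw [hc₁]; exact measurable_count (hB.inter hK₁)
  have hf₂ : Measurable f₂ := measurable_of_count fun B hB => by
    simp_rw [hc₂]; exact measurable_count (hB.inter hK₂)
  rw [IndepFun_iff_Indep]
  refine IndepSets.indep hf₁.comap_le hf₂.comap_le (isPiSystem_countEvents.comap f₁)
    (isPiSystem_countEvents.comap f₂)
    ((congrArg _ generateFrom_countEvents).trans MeasurableSpace.comap_generateFrom)
    ((congrArg _ generateFrom_countEvents).trans MeasurableSpace.comap_generateFrom) ?_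
  rw [IndepSets_iff]
  rintro _ _ ⟨E₁, hE₁, rfl⟩ ⟨E₂, hE₂, rfl⟩
  obtain ⟨I₁, V₁, rfl⟩ := exists_of_mem_countEvents hE₁
  obtain ⟨I₂, V₂, rfl⟩ := exists_of_mem_countEvents hE₂
  let B₁ : I₁ → Set (Pt d M) := fun B => B.1.1
  let B₂ : I₂ → Set (Pt d M) := fun B => B.1.1
  -- The atoms of the first family inside `K₁` and those of the second inside `K₂` form one disjoint
  -- family, so their counts are jointly independent and can be grouped into two blocks.
  let D : Set I₁ ⊕ Set I₂ → Set (Pt d M) :=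
    Sum.elim (fun T => atom B₁ T ∩ K₁) (fun T => atom B₂ T ∩ K₂)
  have hD : ∀ t, MeasurableSet (D t) := by
    rintro (T | T)
    · exact (measurableSet_atom (fun B => B.1.2) T).inter hK₁
    · exact (measurableSet_atom (fun B => B.1.2) T).inter hK₂
  have hdisj : Pairwise fun t u => Disjoint (D t) (D u) := by
    rintro (T | T) (U | U) hTU
    · exact (pairwise_disjoint_atom B₁ (fun h => hTU (congrArg _ h))).mono
        inter_subset_left inter_subset_left
    · exact hK.mono inter_subset_right inter_subset_right
    · exact hK.symm.mono inter_subset_right inter_subset_right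
    · exact (pairwise_disjoint_atom B₂ (fun h => hTU (congrArg _ h))).mono
        inter_subset_left inter_subset_left
  let s₁ : Finset (Set I₁ ⊕ Set I₂) := Finset.univ.map ⟨Sum.inl, Sum.inl_injective⟩
  let s₂ : Finset (Set I₁ ⊕ Set I₂) := Finset.univ.map ⟨Sum.inr, Sum.inr_injective⟩
  have hs : Disjoint s₁ s₂ := by
    rw [Finset.disjoint_left]
    simp [s₁, s₂]
  have hi := (hP.iIndepFun_count_fintype hD hdisj).indepFun_finset s₁ s₂ hs
    (fun t => measurable_count (hD t))
  let φ₁ : (s₁ → ℕ∞) → I₁ → ℕ∞ := fun n => sumAtoms fun T => n ⟨Sum.inl T, by simp [s₁]⟩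
  let φ₂ : (s₂ → ℕ∞) → I₂ → ℕ∞ := fun n => sumAtoms fun T => n ⟨Sum.inr T, by simp [s₂]⟩
  have hi' := hi.comp (measurable_of_countable φ₁) (measurable_of_countable φ₂)
  have e₁ : f₁ ⁻¹' {S | (fun B : I₁ => count (B : Set (Pt d M)) S) ∈ V₁} =
      (φ₁ ∘ fun S (t : s₁) => count (D t) S) ⁻¹' V₁ := by
    ext S
    have := count_eq_sumAtoms B₁ (f₁ S)
    simp only [hc₁] at this
    simp only [mem_preimage, mem_ofPred_eq, hc₁]
    exact iff_of_eq (congrArg (· ∈ V₁) this)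
  have e₂ : f₂ ⁻¹' {S | (fun B : I₂ => count (B : Set (Pt d M)) S) ∈ V₂} =
      (φ₂ ∘ fun S (t : s₂) => count (D t) S) ⁻¹' V₂ := by
    ext S
    have := count_eq_sumAtoms B₂ (f₂ S)
    simp only [hc₂] at this
    simp only [mem_preimage, mem_ofPred_eq, hc₂]
    exact iff_of_eq (congrArg (· ∈ V₂) this)
  rw [e₁, e₂]
  exact hi'.meas_inter ⟨V₁, .of_discrete, rfl⟩ ⟨V₂, .of_discrete, rfl⟩

theorem ae_mem_freePairs (hP : IsPoissonLaw μ P)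
    (h0 : ∀ z : EuclideanSpace ℝ (Fin d), μ (Prod.fst ⁻¹' {z}) = 0) (q : Pt d M) :
    ∀ᵐ S ∂P, (S, q) ∈ freePairs d M := by
  have hm : MeasurableSet (Prod.fst ⁻¹' {q.1} : Set (Pt d M)) :=
    (measurableSet_singleton q.1).preimage measurable_fst
  filter_upwards [hP.ae_count_eq_zero hm (h0 q.1)] with S hS
  exact hS

theorem ae_prod_mem_freePairs (hP : IsPoissonLaw μ P) [SFinite μ]
    (h0 : ∀ z : EuclideanSpace ℝ (Fin d), μ (Prod.fst ⁻¹' {z}) = 0) :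
    ∀ᵐ z ∂(P.prod μ), z ∈ freePairs d M := by
  have := hP.isProbabilityMeasure
  rw [Measure.ae_prod_mem_iff_ae_ae_mem measurableSet_freePairs,
    Measure.ae_ae_comm (p := fun S q => (S, q) ∈ freePairs d M) measurableSet_freePairs]
  exact Eventually.of_forall fun q => hP.ae_mem_freePairs h0 q

/-- Mecke for count events: decompose `B` into atoms and apply the disjoint case to each. A point
added in an atom raises that atom's count by one, which on the level of events is exactly the shift
by `Pi.single`. -/
theorem setLIntegral_count_eq_of_mem_countEvents (hP : IsPoissonLaw μ P)
    (h0 : ∀ z : EuclideanSpace ℝ (Fin d), μ (Prod.fst ⁻¹' {z}) = 0) {B : Set (Pt d M)}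
    (hB : MeasurableSet B) (hfin : μ B ≠ ∞) {E : Set (Config d M)} (hE : E ∈ countEvents d M) :
    ∫⁻ S in E, (count B S : ℝ≥0∞) ∂P = ∫⁻ q in B, P {S | S.addFree q ∈ E} ∂μ := by
  classical
  obtain ⟨I, V, rfl⟩ := exists_of_mem_countEvents hE
  -- The set `B` joins the family as the index `none`, so that it is itself a union of atoms.
  let F : Option I → Set (Pt d M) := fun o => o.elim B fun C => C.1.1
  have hF : ∀ o, MeasurableSet (F o) := by
    rintro (_ | C)
    exacts [hB, C.1.2]
  let V' : Set (Set (Option I) → ℕ∞) := {n | (fun i : I => sumAtoms n (some i)) ∈ V}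
  have hcount : ∀ S : Config d M, ∀ o, count (F o) S = sumAtoms (fun T => count (atom F T) S) o :=
    fun S o => congrFun (count_eq_sumAtoms F S) o
  have hEV : {S | (fun C : I => count (C : Set (Pt d M)) S) ∈ V} =
      {S | (fun T => count (atom F T) S) ∈ V'} := by
    ext S
    simp only [mem_ofPred_eq, V', ← hcount]
    rfl
  have hsub : ∀ T : {T : Set (Option I) // none ∈ T}, atom F T ⊆ B := by
    rw [show B = F none from rfl, iUnion_atom F none]
    exact fun T => subset_iUnion (fun T : {T : Set (Option I) // none ∈ T} => atom F T.1) T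
  have hL : ∀ S : Config d M, (count B S : ℝ≥0∞) =
      ∑ T : {T : Set (Option I) // none ∈ T}, (count (atom F T) S : ℝ≥0∞) := fun S => by
    rw [show B = F none from rfl, hcount, sumAtoms]
    exact map_sum ENat.toENNRealRingHom _ _
  simp_rw [hL]
  have hmeas : ∀ T : {T : Set (Option I) // none ∈ T}, Measurable fun S : Config d M =>
      (count (atom F T) S : ℝ≥0∞) := fun T =>
    (measurable_of_countable _).comp (measurable_count (measurableSet_atom hF T.1))
  rw [lintegral_finsetSum _ fun T _ => hmeas T]
  conv_rhs => rw [show B = F none from rfl, iUnion_atom F none]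
  rw [lintegral_iUnion (fun T => measurableSet_atom hF T.1)
    (fun T U hTU => pairwise_disjoint_atom F (fun h => hTU (Subtype.ext h))), tsum_fintype]
  refine Finset.sum_congr rfl fun T _ => ?_
  rw [hEV, hP.setLIntegral_count (fun T => measurableSet_atom hF T) (pairwise_disjoint_atom F) T.1
    ((measure_mono (hsub T)).trans_lt hfin.lt_top).ne]
  rw [mul_comm, ← setLIntegral_const]
  refine setLIntegral_congr_fun (measurableSet_atom hF T.1) fun q hq => ?_
  refine measure_congr ?_
  filter_upwards [hP.ae_mem_freePairs h0 q] with S hS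
  refine propext ?_
  change (fun T => count (atom F T) S) + Pi.single T.1 1 ∈ V' ↔
    (fun T => count (atom F T) (S.addFree q)) ∈ V'
  simp only [V', mem_ofPred_eq]
  refine iff_of_eq (congrArg (· ∈ V) (funext fun i => ?_))
  rw [sumAtoms_add_single, ← hcount, ← hcount, addFree_of_mem hS,
    count_add_of_notMem (notMem_of_mem_freePairs hS)]
  congr 1
  have hq' : {o | q ∈ F o} = T.1 := hq
  rw [← hq']
  simp [indicator]

/-- Both sides are finite measures in `E`, the left one with density `count B` and the right one an
image of `P ⊗ μ|_B`. They agree on the generating π-system, which contains the whole space, so the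
total masses agree too. -/
theorem setLIntegral_count_eq (hP : IsPoissonLaw μ P) [SFinite μ]
    (h0 : ∀ z : EuclideanSpace ℝ (Fin d), μ (Prod.fst ⁻¹' {z}) = 0) {B : Set (Pt d M)}
    (hB : MeasurableSet B) (hfin : μ B ≠ ∞) {E : Set (Config d M)} (hE : MeasurableSet E) :
    ∫⁻ S in E, (count B S : ℝ≥0∞) ∂P = ∫⁻ q in B, P {S | S.addFree q ∈ E} ∂μ := by
  have := hP.isProbabilityMeasure
  have : IsFiniteMeasure (μ.restrict B) := ⟨by simpa using hfin.lt_top⟩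
  have hc : Measurable fun S : Config d M => (count B S : ℝ≥0∞) :=
    (measurable_of_countable _).comp (measurable_count hB)
  have h2 : ∀ {E : Set (Config d M)}, MeasurableSet E →
      ((P.prod (μ.restrict B)).map fun z => z.1.addFree z.2) E =
        ∫⁻ q in B, P {S | S.addFree q ∈ E} ∂μ := by
    intro E hE
    rw [Measure.map_apply measurable_addFree hE, Measure.prod_apply_symm (measurable_addFree hE)]
    rfl
  rw [← h2 hE, ← withDensity_apply _ hE]
  congr 1
  symm
  have key : ∀ E ∈ countEvents d M, ((P.prod (μ.restrict B)).map fun z => z.1.addFree z.2) E =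
      (P.withDensity fun S => (count B S : ℝ≥0∞)) E := by
    intro E hE
    rw [h2 (measurableSet_of_mem_countEvents hE),
      withDensity_apply _ (measurableSet_of_mem_countEvents hE),
      hP.setLIntegral_count_eq_of_mem_countEvents h0 hB hfin hE]
  exact ext_of_generate_finite _ generateFrom_countEvents isPiSystem_countEvents key
    (key _ univ_mem_countEvents)

/-- The Mecke equation. -/
theorem compProd_pointKernel (hP : IsPoissonLaw μ P) [SFinite μ]
    (hfin : ∀ n, μ (shell d M n) ≠ ∞)
    (h0 : ∀ z : EuclideanSpace ℝ (Fin d), μ (Prod.fst ⁻¹' {z}) = 0) :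
    P ⊗ₘ pointKernel d M = (P.prod μ).map fun z => (z.1.addFree z.2, z.2) := by
  have := hP.isProbabilityMeasure
  have hm : Measurable fun z : Config d M × Pt d M => (z.1.addFree z.2, z.2) :=
    measurable_addFree.prodMk measurable_snd
  have key : ∀ {E : Set (Config d M)} {B : Set (Pt d M)}, MeasurableSet E → MeasurableSet B →
      μ B ≠ ∞ → (P ⊗ₘ pointKernel d M) (E ×ˢ B) =
        ((P.prod μ).map fun z => (z.1.addFree z.2, z.2)) (E ×ˢ B) := by
    intro E B hE hB hμB
    rw [Measure.compProd_apply_prod hE hB, Measure.map_apply hm (hE.prod hB),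
      Measure.prod_apply_symm (hm (hE.prod hB))]
    simp_rw [pointKernel_apply, pointMeasure_apply _ hB]
    rw [hP.setLIntegral_count_eq h0 hB hμB hE, ← lintegral_indicator hB]
    refine lintegral_congr fun q => ?_
    by_cases hq : q ∈ B
    · rw [indicator_of_mem hq]
      congr 1
      ext S
      simp [hq]
    · rw [indicator_of_notMem hq]
      symm
      convert measure_empty (μ := P)
      ext S
      simp [hq]
  have hbound : ∀ n, ((P.prod μ).map fun z => (z.1.addFree z.2, z.2)) (univ ×ˢ shell d M n) ≠ ∞ := by
    intro n
    rw [Measure.map_apply hm (MeasurableSet.univ.prod (measurableSet_shell n))]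
    have : (fun z : Config d M × Pt d M => (z.1.addFree z.2, z.2)) ⁻¹' (univ ×ˢ shell d M n) =
        univ ×ˢ shell d M n := by
      ext z; simp
    rw [this, Measure.prod_prod, measure_univ, one_mul]
    exact hfin n
  -- Neither measure need be finite, so they are compared on the slabs over the shells, where both
  -- are finite and rectangles determine them.
  refine (Measure.ext_iff_of_iUnion_eq_univ (s := fun n => univ ×ˢ shell d M n) ?_).2 fun n => ?_
  · rw [← prod_iUnion, iUnion_shell, univ_prod_univ]
  · have : IsFiniteMeasure ((P ⊗ₘ pointKernel d M).restrict (univ ×ˢ shell d M n)) := by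
      refine ⟨?_⟩
      rw [Measure.restrict_apply_univ,
        key MeasurableSet.univ (measurableSet_shell n) (hfin n)]
      exact (hbound n).lt_top
    refine Measure.ext_prod fun {E B} hE hB => ?_
    rw [Measure.restrict_apply (hE.prod hB), Measure.restrict_apply (hE.prod hB), prod_inter_prod]
    exact key (hE.inter MeasurableSet.univ) (hB.inter (measurableSet_shell n))
      ((measure_mono inter_subset_right).trans_lt (hfin n).lt_top).ne

theorem lintegral_pointMeasure (hP : IsPoissonLaw μ P) [SFinite μ]
    (hfin : ∀ n, μ (shell d M n) ≠ ∞)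
    (h0 : ∀ z : EuclideanSpace ℝ (Fin d), μ (Prod.fst ⁻¹' {z}) = 0)
    {h : Config d M × Pt d M → ℝ≥0∞} (hh : Measurable h) :
    ∫⁻ S, ∫⁻ q, h (S, q) ∂S.pointMeasure ∂P = ∫⁻ S, ∫⁻ q, h (S.addFree q, q) ∂μ ∂P := by
  have := hP.isProbabilityMeasure
  have hm : Measurable fun z : Config d M × Pt d M => (z.1.addFree z.2, z.2) :=
    measurable_addFree.prodMk measurable_snd
  have h1 := Measure.lintegral_compProd (μ := P) (κ := pointKernel d M) hh
  rw [hP.compProd_pointKernel hfin h0, lintegral_map hh hm] at h1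
  exact h1.symm.trans (lintegral_prod _ (hh.comp hm).aemeasurable)

/-- The bivariate Mecke equation. -/
theorem compProd_pointKernel_prod (hP : IsPoissonLaw μ P) [SFinite μ]
    (hfin : ∀ n, μ (shell d M n) ≠ ∞)
    (h0 : ∀ z : EuclideanSpace ℝ (Fin d), μ (Prod.fst ⁻¹' {z}) = 0) :
    P ⊗ₘ (pointKernel d M ×ₖ pointKernel d M) =
      (P.prod μ).map (fun z => (z.1.addFree z.2, z.2, z.2)) +
        (P.prod (μ.prod μ)).map fun z => ((z.1.addFree z.2.2).addFree z.2.1, z.2.1, z.2.2) := by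
  have := hP.isProbabilityMeasure
  have ha := measurable_addFree (d := d) (M := M)
  have hm1 : Measurable fun z : Config d M × Pt d M => (z.1.addFree z.2, z.2, z.2) :=
    measurable_addFree.prodMk (measurable_snd.prodMk measurable_snd)
  have hm2 : Measurable fun z : Config d M × Pt d M × Pt d M =>
      ((z.1.addFree z.2.2).addFree z.2.1, z.2.1, z.2.2) :=
    (ha.comp ((ha.comp (measurable_fst.prodMk measurable_snd.snd)).prodMk
      measurable_snd.fst)).prodMk measurable_snd
  ext Z hZ
  have hZi : Measurable (Z.indicator (1 : Config d M × Pt d M × Pt d M → ℝ≥0∞)) := measurable_one.indicator hZ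
  rw [Measure.add_apply, ← lintegral_indicator_one hZ, ← lintegral_indicator_one hZ,
    ← lintegral_indicator_one hZ, Measure.lintegral_compProd hZi, lintegral_map hZi hm1,
    lintegral_map hZi hm2]
  set h : Config d M × Pt d M × Pt d M → ℝ≥0∞ := Z.indicator 1
  clear_value h
  have e1 : ∀ S : Config d M, ∫⁻ b, h (S, b) ∂((pointKernel d M ×ₖ pointKernel d M) S) =
      ∫⁻ q, ∫⁻ q', h (S, q, q') ∂S.pointMeasure ∂S.pointMeasure := by
    intro S
    rw [Kernel.prod_apply, pointKernel_apply]
    exact lintegral_prod _ (hZi.comp measurable_prodMk_left).aemeasurable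
  simp_rw [e1]
  have hH : Measurable fun z : Config d M × Pt d M =>
      ∫⁻ q', h (z.1, z.2, q') ∂z.1.pointMeasure :=
    measurable_lintegral_pointMeasure (h := fun (z : Config d M × Pt d M) q' => h (z.1, z.2, q'))
      measurable_fst (hZi.comp (by fun_prop))
  rw [hP.lintegral_pointMeasure hfin h0 hH]
  have hd : Measurable fun z : Config d M × Pt d M => h (z.1.addFree z.2, z.2, z.2) := hZi.comp hm1
  have hK : Measurable fun z : Config d M × Pt d M =>
      ∫⁻ q', h (z.1.addFree z.2, z.2, q') ∂z.1.pointMeasure :=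
    measurable_lintegral_pointMeasure
      (h := fun (z : Config d M × Pt d M) q' => h (z.1.addFree z.2, z.2, q'))
      measurable_fst (hZi.comp ((ha.comp measurable_fst).prodMk
        (measurable_fst.snd.prodMk measurable_snd)))
  have hae := hP.ae_prod_mem_freePairs h0
  -- After one use of the Mecke equation the inner sum runs over the points of `S ∪ {q}`. The point
  -- `q` gives the diagonal term, and a second Mecke equation treats the points of `S`.
  calc ∫⁻ S, ∫⁻ q, ∫⁻ q', h (S.addFree q, q, q') ∂(S.addFree q).pointMeasure ∂μ ∂P
      = ∫⁻ z, ∫⁻ q', h (z.1.addFree z.2, z.2, q') ∂(z.1.addFree z.2).pointMeasure ∂(P.prod μ) :=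
        (lintegral_prod _ (hH.comp (ha.prodMk measurable_snd)).aemeasurable).symm
    _ = ∫⁻ z, ((∫⁻ q', h (z.1.addFree z.2, z.2, q') ∂z.1.pointMeasure) +
          h (z.1.addFree z.2, z.2, z.2)) ∂(P.prod μ) := by
        refine lintegral_congr_ae ?_
        filter_upwards [hae] with z hz
        have hp : (z.1.addFree z.2).pointMeasure = z.1.pointMeasure + Measure.dirac z.2 := by
          rw [addFree_of_mem hz, pointMeasure_add_of_notMem (notMem_of_mem_freePairs hz)]
        rw [hp, lintegral_add_measure]
        congr 1
        exact lintegral_dirac' _ (hZi.comp (measurable_const.prodMk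
          (measurable_const.prodMk measurable_id)))
    _ = ∫⁻ z, ∫⁻ q', h (z.1.addFree z.2, z.2, q') ∂z.1.pointMeasure ∂(P.prod μ) +
          ∫⁻ z, h (z.1.addFree z.2, z.2, z.2) ∂(P.prod μ) := lintegral_add_left hK _
    _ = ∫⁻ q, ∫⁻ S, ∫⁻ q', h ((S.addFree q').addFree q, q, q') ∂μ ∂P ∂μ +
          ∫⁻ z, h (z.1.addFree z.2, z.2, z.2) ∂(P.prod μ) := by
        rw [lintegral_prod_symm _ hK.aemeasurable]
        congr 1
        refine lintegral_congr fun q => ?_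
        exact hP.lintegral_pointMeasure hfin h0 (h := fun z => h (z.1.addFree q, q, z.2))
          (hZi.comp ((ha.comp (measurable_fst.prodMk measurable_const)).prodMk
            (measurable_const.prodMk measurable_snd)))
    _ = _ := by
        rw [_root_.add_comm]
        congr 1
        refine Eq.trans ?_ (lintegral_prod _ (hZi.comp hm2).aemeasurable).symm
        rw [lintegral_lintegral_swap]
        · refine lintegral_congr fun S => ?_
          exact (lintegral_prod _
            ((hZi.comp hm2).comp measurable_prodMk_left).aemeasurable).symm
        · have hp : Measurable fun w : (Pt d M × Config d M) × Pt d M =>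
            (w.1.2, w.1.1, w.2) := by fun_prop
          have hu : Measurable fun w : (Pt d M × Config d M) × Pt d M =>
            h ((w.1.2.addFree w.2).addFree w.1.1, w.1.1, w.2) := by
            have := (hZi.comp hm2).comp hp
            simpa only [Function.comp_def] using this
          exact hu.lintegral_prod_right'.aemeasurable

end IsPoissonLaw

end StabScore

end

/-! ### Stationary Poisson processes: translation, dilation, dependence on the intensity. -/

noncomputable section

namespace StabScore

open Config

variable {d : ℕ} {M : Type*} [MeasurableSpace M]

section Intensity

variable (Q : Measure M) [IsProbabilityMeasure Q] (u : ℝ)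

theorem stationaryIntensity_eq : stationaryIntensity d Q u =
    (ENNReal.ofReal u • (volume : Measure (EuclideanSpace ℝ (Fin d)))).prod Q := by
  rw [stationaryIntensity, Measure.prod_smul_left]

instance : SFinite (stationaryIntensity d Q u) := by
  rw [stationaryIntensity_eq]; infer_instance

theorem stationaryIntensity_preimage_fst (B : Set (EuclideanSpace ℝ (Fin d))) :
    stationaryIntensity d Q u (Prod.fst ⁻¹' B) = ENNReal.ofReal u * volume B := by
  rw [stationaryIntensity_eq, ← prod_univ, Measure.prod_prod]
  simp

theorem stationaryIntensity_shell_ne_top (n : ℕ) :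
    stationaryIntensity d Q u (shell d M n) ≠ ∞ := by
  refine ((measure_mono (shell_subset n)).trans_lt ?_).ne
  rw [stationaryIntensity_preimage_fst]
  exact ENNReal.mul_lt_top ENNReal.ofReal_lt_top Metric.isBounded_closedBall.measure_lt_top

theorem stationaryIntensity_fst_singleton (hd : d ≠ 0) (z : EuclideanSpace ℝ (Fin d)) :
    stationaryIntensity d Q u (Prod.fst ⁻¹' {z}) = 0 := by
  have : Nonempty (Fin d) := ⟨⟨0, Nat.pos_of_ne_zero hd⟩⟩
  rw [stationaryIntensity_preimage_fst]
  simp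

theorem map_translate_stationaryIntensity (y : EuclideanSpace ℝ (Fin d)) :
    (stationaryIntensity d Q u).map (fun q : Pt d M => (q.1 + y, q.2)) =
      stationaryIntensity d Q u := by
  rw [stationaryIntensity, Measure.map_smul]
  congr 1
  change ((volume : Measure (EuclideanSpace ℝ (Fin d))).prod Q).map (Prod.map (· + y) id) = _
  rw [← Measure.map_prod_map _ _ (measurable_add_const y) measurable_id, Measure.map_id,
    map_add_right_eq_self]

/-- Dilation by `s^{1/d}` divides the density of Lebesgue measure by `s`, which absorbs the extra
factor in the intensity. The map is written with an explicit centre `0` to match `dilateAbout`. -/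
theorem map_dilate_stationaryIntensity {s : ℝ} (hs : 0 < s) (hd : d ≠ 0) :
    (stationaryIntensity d Q (s * u)).map
      (fun q : Pt d M => (0 + s ^ (1 / (d : ℝ)) • (q.1 - 0), q.2)) =
      stationaryIntensity d Q u := by
  have ha : s ^ (1 / (d : ℝ)) ≠ 0 := (Real.rpow_pos_of_pos hs _).ne'
  have had : (s ^ (1 / (d : ℝ))) ^ d = s := by
    rw [one_div, Real.rpow_inv_natCast_pow hs.le hd]
  simp only [zero_add, sub_zero]
  rw [stationaryIntensity, Measure.map_smul]
  change _ • ((volume : Measure (EuclideanSpace ℝ (Fin d))).prod Q).map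
    (Prod.map (s ^ (1 / (d : ℝ)) • ·) id) = _
  rw [← Measure.map_prod_map _ _ (measurable_const_smul _) measurable_id, Measure.map_id,
    Measure.map_addHaar_smul _ ha, Measure.prod_smul_left, smul_smul, stationaryIntensity]
  congr 1
  rw [finrank_euclideanSpace_fin, had, abs_of_pos (inv_pos.2 hs), ENNReal.ofReal_mul hs.le,
    mul_right_comm, ← ENNReal.ofReal_mul hs.le, mul_inv_cancel₀ hs.ne', ENNReal.ofReal_one, one_mul]

end Intensity

namespace IsPoissonLaw

variable {Q : Measure M} [IsProbabilityMeasure Q] {u : ℝ} {P : Measure (Config d M)}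

theorem map_translate (hP : IsPoissonLaw (stationaryIntensity d Q u) P)
    (y : EuclideanSpace ℝ (Fin d)) : P.map (fun S => S.translate y) = P := by
  have h := hP.map (t := fun q : Pt d M => (q.1 + y, q.2)) (by fun_prop)
    (fun p q hpq => by simpa [Prod.ext_iff] using hpq) (f := fun S => S.translate y)
    (fun S => carrier_translate S y)
  rw [map_translate_stationaryIntensity] at h
  exact h.unique hP

theorem measurePreserving_translate (hP : IsPoissonLaw (stationaryIntensity d Q u) P)
    (y : EuclideanSpace ℝ (Fin d)) : MeasurePreserving (fun S => S.translate y) P P :=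
  ⟨measurable_translate_right y, hP.map_translate y⟩

theorem measurePreserving_dilate {P' : Measure (Config d M)} {s : ℝ} (hs : 0 < s) (hd : d ≠ 0)
    (hP : IsPoissonLaw (stationaryIntensity d Q (s * u)) P)
    (hP' : IsPoissonLaw (stationaryIntensity d Q u) P') :
    MeasurePreserving (fun S => S.dilateAbout 0 (s ^ (1 / (d : ℝ)))) P P' := by
  have ha : s ^ (1 / (d : ℝ)) ≠ 0 := (Real.rpow_pos_of_pos hs _).ne'
  have hinj : Function.Injective
      (fun q : Pt d M => (0 + s ^ (1 / (d : ℝ)) • (q.1 - 0), q.2)) := fun p q hpq => by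
    refine Prod.ext (smul_right_injective _ ha ?_) (Prod.ext_iff.1 hpq).2
    simpa using (Prod.ext_iff.1 hpq).1
  have hc := fun S : Config d M => carrier_dilateAbout S 0 ha
  have ht : Measurable (fun q : Pt d M => (0 + s ^ (1 / (d : ℝ)) • (q.1 - 0), q.2)) := by fun_prop
  have h := hP.map ht hinj hc
  rw [map_dilate_stationaryIntensity Q u hs hd] at h
  refine ⟨measurable_of_count fun B hB => ?_, h.unique hP'⟩
  simp_rw [count_image hinj (hc _) B]
  exact measurable_count (ht hB)

end IsPoissonLaw

/-- The laws of the stationary Poisson processes depend measurably on the intensity. -/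
theorem exists_kernel_stationary {Q : Measure M} [IsProbabilityMeasure Q]
    {Pst : ℝ → Measure (Config d M)}
    (hPst : ∀ u, 0 < u → IsPoissonLaw (stationaryIntensity d Q u) (Pst u)) :
    ∃ κ : Kernel ℝ (Config d M), IsMarkovKernel κ ∧ ∀ u, 0 < u → κ u = Pst u := by
  classical
  -- Nothing is known about `Pst u` for `u ≤ 0`; such intensities are replaced by `1` to obtain a
  -- Markov kernel on all of `ℝ`.
  let v : ℝ → ℝ := fun u => if 0 < u then u else 1
  have hv : Measurable v := Measurable.ite measurableSet_Ioi measurable_id measurable_const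
  have hv0 : ∀ u, 0 < v u := fun u => by
    simp only [v]; split_ifs with h
    exacts [h, one_pos]
  have hprob : ∀ u, IsProbabilityMeasure (Pst (v u)) := fun u =>
    (hPst _ (hv0 u)).isProbabilityMeasure
  have hcount : ∀ (B : Set (Pt d M)), MeasurableSet B → ∀ k : ℕ∞,
      Measurable fun u => Pst (v u) {S | count B S = k} := by
    intro B hB k
    have hI : ∀ u, stationaryIntensity d Q (v u) B = ENNReal.ofReal (v u) *
      ((volume : Measure (EuclideanSpace ℝ (Fin d))).prod Q) B := fun u => rfl
    by_cases htop : ((volume : Measure (EuclideanSpace ℝ (Fin d))).prod Q) B = ∞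
    · have h : ∀ u, stationaryIntensity d Q (v u) B = ∞ := fun u => by
        rw [hI, htop, ENNReal.mul_top (by simpa using hv0 u)]
      simp_rw [fun u => (hPst _ (hv0 u)).measure_count_of_eq_top hB (h u) k]
      exact measurable_const
    · have h : ∀ u, stationaryIntensity d Q (v u) B ≠ ∞ := fun u => by
        rw [hI]; exact ENNReal.mul_ne_top ENNReal.ofReal_ne_top htop
      induction k using ENat.recTopCoe with
      | top =>
        simp_rw [fun u => (hPst _ (hv0 u)).measure_count_eq_top hB (h u)]
        exact measurable_const
      | coe n =>
        simp_rw [fun u => (hPst _ (hv0 u)).measure_count_eq_natCast hB (h u) n, hI]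
        fun_prop
  have hm : Measurable fun u => Pst (v u) := by
    refine Measurable.measure_of_isPiSystem_of_isProbabilityMeasure generateFrom_countEvents
      isPiSystem_countEvents fun E hE => ?_
    obtain ⟨I, V, rfl⟩ := exists_of_mem_countEvents hE
    simp_rw [fun u => (hPst _ (hv0 u)).measure_countEvent
      (B := fun B : I => (B : Set (Pt d M))) (fun B => B.1.2) V, finprod_eq_prod_of_fintype]
    refine Measurable.tsum fun n => Finset.measurable_fun_prod _ fun T _ => ?_
    exact hcount _ (measurableSet_atom (fun B => B.1.2) T) _
  refine ⟨⟨fun u => Pst (v u), hm⟩, ⟨hprob⟩, fun u hu => ?_⟩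
  change Pst (v u) = Pst u
  simp [v, hu]

end StabScore

end

/-! ### Covariance estimates from fourth moments and truncation. -/

noncomputable section

namespace StabScore

open Config

section Abstract

variable {Ω : Type*} [MeasurableSpace Ω] {ν : Measure Ω} {a b a₀ b₀ : Ω → ℝ}

theorem integrable_pow_four_of_lintegral_le {K : ℝ} (ha : AEStronglyMeasurable a ν)
    (hK : ∫⁻ w, ‖a w‖ₑ ^ 4 ∂ν ≤ ENNReal.ofReal K) : Integrable (fun w => a w ^ 4) ν := by
  refine ⟨ha.pow 4, ?_⟩
  rw [hasFiniteIntegral_iff_enorm]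
  simp_rw [enorm_pow]
  exact hK.trans_lt ENNReal.ofReal_lt_top

theorem integral_pow_four_le_of_lintegral_le {K : ℝ} (hK0 : 0 ≤ K)
    (ha : AEStronglyMeasurable a ν)
    (hK : ∫⁻ w, ‖a w‖ₑ ^ 4 ∂ν ≤ ENNReal.ofReal K) : ∫ w, a w ^ 4 ∂ν ≤ K := by
  rw [integral_eq_lintegral_of_nonneg_ae (Eventually.of_forall fun w => by positivity)
    (show AEStronglyMeasurable (fun w => a w ^ 4) ν from ha.pow 4)]
  refine ENNReal.toReal_le_of_le_ofReal hK0 (le_trans (le_of_eq ?_) hK)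
  refine lintegral_congr fun w => ?_
  rw [← enorm_pow, Real.enorm_of_nonneg (by positivity)]

variable [IsProbabilityMeasure ν]

/-- This and the next two inequalities let bounds on fourth moments yield integrability of variables
and of products of two, without Hölder's inequality. -/
theorem abs_le_one_add_pow_four (t : ℝ) : |t| ≤ 1 + t ^ 4 := by
  rw [abs_le]
  constructor <;> nlinarith [sq_nonneg (t ^ 2 - 1), sq_nonneg (t - 1), sq_nonneg (t + 1),
    sq_nonneg (t ^ 2)]

theorem sq_le_one_add_pow_four (t : ℝ) : t ^ 2 ≤ 1 + t ^ 4 := by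
  nlinarith [sq_nonneg (t ^ 2 - 1), sq_nonneg (t ^ 2)]

theorem abs_mul_le_pow_four (s t : ℝ) : |s * t| ≤ 1 + s ^ 4 + t ^ 4 := by
  rw [abs_le]
  have h1 := sq_le_one_add_pow_four s
  have h2 := sq_le_one_add_pow_four t
  constructor <;> nlinarith [sq_nonneg (s + t), sq_nonneg (s - t), sq_nonneg (s ^ 2),
    sq_nonneg (t ^ 2)]

theorem integrable_of_pow_four (ha : AEStronglyMeasurable a ν)
    (ha4 : Integrable (fun w => a w ^ 4) ν) : Integrable a ν :=
  ((integrable_const (1 : ℝ)).add ha4).mono' ha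
    (Eventually.of_forall fun w => by simpa using abs_le_one_add_pow_four (a w))

theorem integrable_mul_of_pow_four (ha : AEStronglyMeasurable a ν)
    (ha4 : Integrable (fun w => a w ^ 4) ν) (hb : AEStronglyMeasurable b ν)
    (hb4 : Integrable (fun w => b w ^ 4) ν) : Integrable (fun w => a w * b w) ν :=
  (((integrable_const (1 : ℝ)).add ha4).add hb4).mono' (ha.mul hb)
    (Eventually.of_forall fun w => by
      rw [Real.norm_eq_abs]; exact abs_mul_le_pow_four (a w) (b w))

theorem abs_integral_le_of_pow_four {K : ℝ} (ha4 : Integrable (fun w => a w ^ 4) ν)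
    (haK : ∫ w, a w ^ 4 ∂ν ≤ K) {X : Ω → ℝ} (hX : ∀ w, |X w| ≤ |a w|) :
    |∫ w, X w ∂ν| ≤ 1 + K := by
  calc |∫ w, X w ∂ν| ≤ ∫ w, (1 + a w ^ 4) ∂ν :=
        norm_integral_le_of_norm_le (f := X) ((integrable_const (1 : ℝ)).add ha4)
          (Eventually.of_forall fun w => (hX w).trans (abs_le_one_add_pow_four (a w)))
    _ = 1 + ∫ w, a w ^ 4 ∂ν := by
        rw [integral_add (integrable_const _) ha4]; simp
    _ ≤ 1 + K := by linarith

/-- Truncation of a random variable to an event of probability close to one. -/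
theorem abs_integral_sub_integral_indicator_le {K C δ : ℝ} (hδ : 0 < δ)
    (ha : AEStronglyMeasurable a ν)
    (ha4 : Integrable (fun w => a w ^ 4) ν) (haK : ∫ w, a w ^ 4 ∂ν ≤ K) {G : Set Ω}
    (hG : MeasurableSet G) (hGδ : ν.real Gᶜ ≤ C * δ ^ 2) :
    |∫ w, a w ∂ν - ∫ w, G.indicator a w ∂ν| ≤ δ * (1 + K + C) / 2 := by
  have hai := integrable_of_pow_four ha ha4
  rw [← integral_sub hai (hai.indicator hG)]
  have hint : Integrable (Gᶜ.indicator fun _ : Ω => 1 / (2 * δ)) ν :=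
    (integrable_const _).indicator hG.compl
  have hint' : Integrable (fun w => δ / 2 * (1 + a w ^ 4)) ν :=
    ((integrable_const (1 : ℝ)).add ha4).const_mul _
  calc |∫ w, (a w - G.indicator a w) ∂ν|
      ≤ ∫ w, (δ / 2 * (1 + a w ^ 4) + Gᶜ.indicator (fun _ => 1 / (2 * δ)) w) ∂ν := by
        refine norm_integral_le_of_norm_le (f := fun w => a w - G.indicator a w)
          (hint'.add hint) (Eventually.of_forall fun w => ?_)
        by_cases hw : w ∈ G
        · simp only [hw, indicator_of_mem, sub_self, norm_zero, mem_compl_iff, not_true_eq_false,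
            not_false_eq_true, indicator_of_notMem, add_zero]
          positivity
        · simp only [hw, not_false_eq_true, indicator_of_notMem, sub_zero, Real.norm_eq_abs,
            mem_compl_iff, indicator_of_mem]
          have h1 := sq_le_one_add_pow_four (a w)
          -- Expanding the square gives `|a| ≤ (δ/2) a² + 1/(2δ)`. The constant is paid only off
          -- `G`, whose probability `C δ²` turns it into `C δ/2`.
          have h2 : 0 ≤ (δ * |a w| - 1) ^ 2 / (2 * δ) := by positivity
          have h3 : (δ * |a w| - 1) ^ 2 / (2 * δ) = δ / 2 * |a w| ^ 2 - |a w| + 1 / (2 * δ) := by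
            field_simp; ring
          rw [sq_abs] at h3
          nlinarith
    _ = δ / 2 * (1 + ∫ w, a w ^ 4 ∂ν) + 1 / (2 * δ) * ν.real Gᶜ := by
        rw [integral_add hint' hint, integral_const_mul,
          integral_add (integrable_const _) ha4, integral_indicator hG.compl]
        simp [mul_comm]
    _ ≤ δ / 2 * (1 + K) + 1 / (2 * δ) * (C * δ ^ 2) := by gcongr
    _ = δ * (1 + K + C) / 2 := by field_simp

/-- A covariance estimate for random variables that agree with independent truncated random
variables on events of probability close to one. -/
theorem abs_integral_mul_sub_le {K C δ : ℝ} (hδ : 0 < δ)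
    (ha : AEStronglyMeasurable a ν) (ha4 : Integrable (fun w => a w ^ 4) ν)
    (haK : ∫ w, a w ^ 4 ∂ν ≤ K)
    (hb : AEStronglyMeasurable b ν) (hb4 : Integrable (fun w => b w ^ 4) ν)
    (hbK : ∫ w, b w ^ 4 ∂ν ≤ K)
    (ha₀ : AEStronglyMeasurable a₀ ν) (ha₀4 : Integrable (fun w => a₀ w ^ 4) ν)
    (ha₀K : ∫ w, a₀ w ^ 4 ∂ν ≤ K)
    (hb₀ : AEStronglyMeasurable b₀ ν) (hb₀4 : Integrable (fun w => b₀ w ^ 4) ν)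
    (hb₀K : ∫ w, b₀ w ^ 4 ∂ν ≤ K)
    {G H : Set Ω} (hG : MeasurableSet G) (hGδ : ν.real Gᶜ ≤ C * δ ^ 2)
    (hH : MeasurableSet H) (hHδ : ν.real Hᶜ ≤ C * δ ^ 2)
    (haG : ∀ w ∈ G, a w = a₀ w) (hbH : ∀ w ∈ H, b w = b₀ w)
    (hind : ∫ w, G.indicator a₀ w * H.indicator b₀ w ∂ν =
      (∫ w, G.indicator a₀ w ∂ν) * ∫ w, H.indicator b₀ w ∂ν) :
    |∫ w, a w * b w ∂ν - (∫ w, a₀ w ∂ν) * ∫ w, b₀ w ∂ν| ≤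
      δ * (K + C + (1 + K) * (1 + K + C)) := by
  have hK0 : 0 ≤ K := (integral_nonneg fun w => by positivity).trans haK
  have hi4 : ∀ {f : Ω → ℝ} {G : Set Ω}, MeasurableSet G → Integrable (fun w => f w ^ 4) ν →
      Integrable (fun w => G.indicator f w ^ 4) ν := by
    intro f G hG hf
    refine (hf.indicator hG).congr (Eventually.of_forall fun w => ?_)
    by_cases hw : w ∈ G <;> simp [hw]
  -- On `G ∩ H` the two products agree and elsewhere the truncated one vanishes, so the difference
  -- is `a b` off `G ∩ H`.
  have h1 : |∫ w, a w * b w ∂ν - ∫ w, G.indicator a₀ w * H.indicator b₀ w ∂ν| ≤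
      δ * (K + C) := by
    rw [← integral_sub (integrable_mul_of_pow_four ha ha4 hb hb4)
      (integrable_mul_of_pow_four (ha₀.indicator hG) (hi4 hG ha₀4) (hb₀.indicator hH)
        (hi4 hH hb₀4))]
    have hintG : Integrable (Gᶜ.indicator fun _ : Ω => 1 / (2 * δ)) ν :=
      (integrable_const _).indicator hG.compl
    have hintH : Integrable (Hᶜ.indicator fun _ : Ω => 1 / (2 * δ)) ν :=
      (integrable_const _).indicator hH.compl
    have hint' : Integrable (fun w => δ / 4 * (a w ^ 4 + b w ^ 4)) ν :=
      (ha4.add hb4).const_mul _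
    calc |∫ w, (a w * b w - G.indicator a₀ w * H.indicator b₀ w) ∂ν|
        ≤ ∫ w, (δ / 4 * (a w ^ 4 + b w ^ 4) + (Gᶜ.indicator (fun _ => 1 / (2 * δ)) w +
            Hᶜ.indicator (fun _ => 1 / (2 * δ)) w)) ∂ν := by
          refine norm_integral_le_of_norm_le
            (f := fun w => a w * b w - G.indicator a₀ w * H.indicator b₀ w)
            (hint'.add (hintG.add hintH)) (Eventually.of_forall fun w => ?_)
          have hpos : 0 < 1 / (2 * δ) := by positivity
          have hnn : 0 ≤ δ / 4 * (a w ^ 4 + b w ^ 4) := by positivity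
          -- The same square completion, now for `|a b|`, followed by `2 a² b² ≤ a⁴ + b⁴`.
          have key : |a w * b w| ≤ δ / 4 * (a w ^ 4 + b w ^ 4) + 1 / (2 * δ) := by
            have h2 : 0 ≤ (δ * |a w * b w| - 1) ^ 2 / (2 * δ) := by positivity
            have h3 : (δ * |a w * b w| - 1) ^ 2 / (2 * δ) =
                δ / 2 * |a w * b w| ^ 2 - |a w * b w| + 1 / (2 * δ) := by field_simp; ring
            rw [sq_abs] at h3
            nlinarith [mul_nonneg hδ.le (sq_nonneg (a w ^ 2 - b w ^ 2))]
          rw [Real.norm_eq_abs]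
          by_cases hwG : w ∈ G <;> by_cases hwH : w ∈ H
          · simp only [hwG, hwH, indicator_of_mem, mem_compl_iff, not_true_eq_false,
              not_false_eq_true, indicator_of_notMem, haG w hwG, hbH w hwH, sub_self, abs_zero,
              add_zero]
            positivity
          · simp only [hwG, hwH, mem_compl_iff, not_true_eq_false, not_false_eq_true,
              indicator_of_notMem, indicator_of_mem, mul_zero, sub_zero, zero_add]
            exact key
          · simp only [hwG, hwH, mem_compl_iff, not_true_eq_false, not_false_eq_true,
              indicator_of_notMem, indicator_of_mem, zero_mul, sub_zero, add_zero]
            exact key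
          · simp only [hwG, hwH, mem_compl_iff, not_false_eq_true,
              indicator_of_notMem, indicator_of_mem, zero_mul, sub_zero]
            linarith
      _ = δ / 4 * (∫ w, a w ^ 4 ∂ν + ∫ w, b w ^ 4 ∂ν) +
            (1 / (2 * δ) * ν.real Gᶜ + 1 / (2 * δ) * ν.real Hᶜ) := by
          refine (integral_add hint' (hintG.add hintH)).trans ?_
          rw [integral_const_mul, integral_add ha4 hb4]
          congr 1
          refine (integral_add hintG hintH).trans ?_
          rw [integral_indicator hG.compl, integral_indicator hH.compl]
          simp [mul_comm]
      _ ≤ δ / 4 * (K + K) + (1 / (2 * δ) * (C * δ ^ 2) + 1 / (2 * δ) * (C * δ ^ 2)) := by gcongr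
      _ = δ * (K / 2 + C) := by field_simp; ring
      _ ≤ δ * (K + C) := by gcongr; linarith
  have hA := abs_integral_sub_integral_indicator_le hδ ha₀ ha₀4 ha₀K hG hGδ
  have hB := abs_integral_sub_integral_indicator_le hδ hb₀ hb₀4 hb₀K hH hHδ
  have hE1 : |∫ w, a₀ w ∂ν| ≤ 1 + K := abs_integral_le_of_pow_four ha₀4 ha₀K fun w => le_rfl
  have hE2 : |∫ w, H.indicator b₀ w ∂ν| ≤ 1 + K := by
    refine abs_integral_le_of_pow_four hb₀4 hb₀K fun w => ?_
    by_cases hw : w ∈ H <;> simp [hw]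
  rw [hind] at h1
  generalize (∫ w, a w * b w ∂ν) = e at *
  generalize (∫ w, a₀ w ∂ν) = e₁ at *
  generalize (∫ w, b₀ w ∂ν) = e₂ at *
  generalize (∫ w, G.indicator a₀ w ∂ν) = f₁ at *
  generalize (∫ w, H.indicator b₀ w ∂ν) = f₂ at *
  -- It remains to undo the truncation in the product of the means, one factor at a time.
  have h3 : |f₁ * f₂ - e₁ * e₂| ≤ δ * ((1 + K) * (1 + K + C)) := by
    have h4 : f₁ * f₂ - e₁ * e₂ = -((e₁ - f₁) * f₂ + e₁ * (e₂ - f₂)) := by ring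
    rw [h4, abs_neg]
    have h5 : 0 ≤ δ * (1 + K + C) / 2 := (abs_nonneg _).trans hA
    calc |(e₁ - f₁) * f₂ + e₁ * (e₂ - f₂)| ≤ |e₁ - f₁| * |f₂| + |e₁| * |e₂ - f₂| := by
          rw [← abs_mul, ← abs_mul]; exact abs_add_le _ _
      _ ≤ δ * (1 + K + C) / 2 * (1 + K) + (1 + K) * (δ * (1 + K + C) / 2) := by gcongr
      _ = _ := by ring
  calc |e - e₁ * e₂| = |(e - f₁ * f₂) + (f₁ * f₂ - e₁ * e₂)| := by congr 1; ring
    _ ≤ |e - f₁ * f₂| + |f₁ * f₂ - e₁ * e₂| := abs_add_le _ _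
    _ ≤ δ * (K + C) + δ * ((1 + K) * (1 + K + C)) := by gcongr
    _ = _ := by ring

end Abstract

end StabScore

end

/-! ### Controlled scores and Gaussian decay of the pair covariance. -/

noncomputable section

namespace StabScore

open Config

theorem integral_prod_prod {α β γ : Type*} [MeasurableSpace α] [MeasurableSpace β]
    [MeasurableSpace γ] {μ : Measure α} {ν : Measure β} {ρ : Measure γ} [SFinite μ] [SFinite ν]
    [SFinite ρ] {F : α × β × γ → ℝ} (hF : Integrable F (μ.prod (ν.prod ρ))) :
    ∫ w, F w ∂(μ.prod (ν.prod ρ)) = ∫ a, ∫ b, ∫ c, F (a, b, c) ∂ρ ∂ν ∂μ := by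
  rw [integral_prod _ hF]
  refine integral_congr_ae ?_
  filter_upwards [hF.prod_right_ae] with a ha
  exact integral_prod _ ha

theorem integral_comp_measurePreserving {α β : Type*} [MeasurableSpace α] [MeasurableSpace β]
    {μ : Measure α} {ν : Measure β} {T : α → β} (hT : MeasurePreserving T μ ν) {f : β → ℝ}
    (hf : AEStronglyMeasurable f ν) : ∫ a, f (T a) ∂μ = ∫ b, f b ∂ν := by
  rw [← hT.map_eq] at hf ⊢
  exact (integral_map hT.aemeasurable hf).symm

theorem lintegral_comp_measurePreserving {α β : Type*} [MeasurableSpace α] [MeasurableSpace β]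
    {μ : Measure α} {ν : Measure β} {T : α → β} (hT : MeasurePreserving T μ ν) {f : β → ℝ≥0∞}
    (hf : AEMeasurable f ν) : ∫⁻ a, f (T a) ∂μ = ∫⁻ b, f b ∂ν := by
  rw [← hT.map_eq] at hf ⊢
  exact (lintegral_map' hf hT.aemeasurable).symm

variable {d : ℕ} {M : Type*}

namespace Config

theorem inBall_translate (S : Config d M) (x y : EuclideanSpace ℝ (Fin d)) (r : ℝ) :
    (S.translate (-y)).inBall x r = (S.inBall (x + y) r).translate (-y) := by
  ext1
  simp only [carrier_inBall, carrier_translate]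
  ext p
  constructor
  · rintro ⟨⟨q, hq, rfl⟩, hp⟩
    refine ⟨q, ⟨hq, ?_⟩, rfl⟩
    simp only [mem_preimage, Metric.mem_closedBall, dist_eq_norm] at hp ⊢
    convert hp using 2
    abel
  · rintro ⟨q, ⟨hq, hp⟩, rfl⟩
    refine ⟨⟨q, hq, rfl⟩, ?_⟩
    simp only [mem_preimage, Metric.mem_closedBall, dist_eq_norm] at hp ⊢
    convert hp using 2
    abel

theorem inBall_inBall_of_le (S : Config d M) (x : EuclideanSpace ℝ (Fin d)) {r t : ℝ} (h : t ≤ r) :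
    (S.inBall x r).inBall x t = S.inBall x t := by
  ext1
  simp only [carrier_inBall, inter_assoc, ← preimage_inter]
  rw [inter_eq_right.2 (Metric.closedBall_subset_closedBall h)]

theorem inBall_add_of_lt (S : Config d M) (x : EuclideanSpace ℝ (Fin d)) {p : Pt d M} {r : ℝ}
    (h : r < dist p.1 x) : (S.add p).inBall x r = S.inBall x r := by
  ext1
  simp only [carrier_inBall, carrier_add]
  rw [insert_inter_of_notMem]
  simpa using h

theorem translate_neg_add (S : Config d M) (x y : EuclideanSpace ℝ (Fin d)) (m : M) :
    (S.add (x, m)).translate (-y) = (S.translate (-y)).add (x - y, m) := by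
  rw [translate_add]
  simp [sub_eq_add_neg]

end Config

variable [MeasurableSpace M]

/-- Moment bounds and exponential stabilization of a score at the location `x`, for a
configuration with law `P`. -/
structure ControlledAt (Q : Measure M) (P : Measure (Config d M)) (ξ : Score d M)
    (x : EuclideanSpace ℝ (Fin d)) (R : M → Config d M → ℝ≥0) (K C c : ℝ) : Prop where
  measurable_score : Measurable (Function.uncurry ξ)
  measurable_radius : Measurable (Function.uncurry R)
  moment : ∫⁻ w, ‖ξ (x, w.1) w.2‖ₑ ^ 4 ∂(Q.prod P) ≤ ENNReal.ofReal K
  moment_add : ∀ z, z ≠ x → ∫⁻ w, ‖ξ (x, w.1) (w.2.2.add (z, w.2.1))‖ₑ ^ 4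
    ∂(Q.prod (Q.prod P)) ≤ ENNReal.ofReal K
  stable : ∀ m (S : Config d M), ξ (x, m) (S.inBall x (R m S)) = ξ (x, m) S
  stable_add : ∀ m (S : Config d M) p, ξ (x, m) ((S.add p).inBall x (R m S)) = ξ (x, m) (S.add p)
  anti : ∀ m (S T : Config d M), S.carrier ⊆ T.carrier → R m T ≤ R m S
  radius_le_iff : ∀ m (S : Config d M) (r : ℝ), 0 ≤ r → ((R m S : ℝ) ≤ r ↔ (R m (S.inBall x r) : ℝ) ≤ r)
  tail : ∀ r : ℝ, 0 ≤ r →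
    (Q.prod P) {q | r ≤ R q.1 q.2} ≤ ENNReal.ofReal (C * Real.exp (-c * r ^ d))

namespace ControlledAt

variable {Q : Measure M} {P : Measure (Config d M)} {ξ ξ₁ ξ₂ : Score d M}
  {x : EuclideanSpace ℝ (Fin d)} {R : M → Config d M → ℝ≥0} {K C c : ℝ}

/-- Restricting to a ball of radius `r ≥ R` leaves `R` itself unchanged: removing points can only
enlarge it, while local determination at level `R` and monotonicity bound it from above. Stability
of `S` and of the restricted configuration then gives the same score. -/
theorem eq_inBall (h : ControlledAt Q P ξ x R K C c) {m : M} {S : Config d M} {r : ℝ}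
    (hr : (R m S : ℝ) ≤ r) : ξ (x, m) (S.inBall x r) = ξ (x, m) S := by
  have hR : R m (S.inBall x r) = R m S := by
    refine le_antisymm ?_ (h.anti m _ _ inter_subset_left)
    have h1 := (h.radius_le_iff m S (R m S) (R m S).2).1 le_rfl
    refine le_trans (h.anti m _ _ ?_) (NNReal.coe_le_coe.1 h1)
    exact inter_subset_inter_right _ (preimage_mono (Metric.closedBall_subset_closedBall hr))
  rw [← h.stable m (S.inBall x r), hR, inBall_inBall_of_le _ _ hr, h.stable]

/-- The radius computed from `S` alone is also valid for `S ∪ {p}`, and the ball of that radius does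
not see `p`. -/
theorem eq_add (h : ControlledAt Q P ξ x R K C c) {m : M} {S : Config d M} {p : Pt d M}
    (hp : (R m S : ℝ) < dist p.1 x) : ξ (x, m) (S.add p) = ξ (x, m) S := by
  rw [← h.stable_add, inBall_add_of_lt _ _ hp, h.stable]

open Classical in
/-- The score truncated to the event that the radius of stabilization is at most `r`. -/
def truncated (ξ : Score d M) (R : M → Config d M → ℝ≥0) (x : EuclideanSpace ℝ (Fin d)) (r : ℝ)
    (z : M × Config d M) : ℝ :=
  {z : M × Config d M | (R z.1 z.2 : ℝ) ≤ r}.indicator (fun z => ξ (x, z.1) z.2) z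

theorem measurableSet_radius_le (h : ControlledAt Q P ξ x R K C c) (r : ℝ) :
    MeasurableSet {z : M × Config d M | (R z.1 z.2 : ℝ) ≤ r} :=
  measurableSet_le (measurable_coe_nnreal_real.comp h.measurable_radius) measurable_const

theorem measurable_score_at (h : ControlledAt Q P ξ x R K C c) :
    Measurable fun z : M × Config d M => ξ (x, z.1) z.2 :=
  h.measurable_score.comp (f := fun z : M × Config d M => ((x, z.1), z.2)) (by fun_prop)

theorem measurable_truncated (h : ControlledAt Q P ξ x R K C c) (r : ℝ) :
    Measurable (truncated ξ R x r) :=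
  h.measurable_score_at.indicator (h.measurableSet_radius_le r)

/-- Both the truncating event and the score on it are determined by the points in the ball of radius
`r`. This locality is the source of independence. -/
theorem truncated_inBall (h : ControlledAt Q P ξ x R K C c) {r : ℝ} (hr : 0 ≤ r) (m : M)
    (S : Config d M) : truncated ξ R x r (m, S.inBall x r) = truncated ξ R x r (m, S) := by
  by_cases hS : (R m S : ℝ) ≤ r
  · have hS' := (h.radius_le_iff m S r hr).1 hS
    rw [truncated, truncated, indicator_of_mem (show (m, S) ∈ _ from hS),
      indicator_of_mem (show (m, S.inBall x r) ∈ _ from hS')]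
    exact h.eq_inBall hS
  · have hS' := fun h' => hS ((h.radius_le_iff m S r hr).2 h')
    rw [truncated, truncated, indicator_of_notMem (show (m, S) ∉ _ from hS),
      indicator_of_notMem (show (m, S.inBall x r) ∉ _ from hS')]

/-- Since `d ≥ 2`, one has `r ^ d ≥ r² - 1` for all `r ≥ 0`, which costs the factor `e^c`. The bound
is written as a square because the covariance estimate expects probabilities of order `δ²`. -/
theorem real_radius_gt_le (h : ControlledAt Q P ξ x R K C c) (hd : 2 ≤ d) (hC : 0 ≤ C) (hc : 0 ≤ c)
    {r : ℝ} (hr : 0 ≤ r) :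
    (Q.prod P).real {z | (R z.1 z.2 : ℝ) ≤ r}ᶜ ≤
      C * Real.exp c * Real.exp (-(c / 2) * r ^ 2) ^ 2 := by
  have h1 : (Q.prod P) {z | (R z.1 z.2 : ℝ) ≤ r}ᶜ ≤
      ENNReal.ofReal (C * Real.exp (-c * r ^ d)) := by
    refine (measure_mono fun z hz => ?_).trans (h.tail r hr)
    exact (not_le.1 (show ¬ (R z.1 z.2 : ℝ) ≤ r from hz)).le
  refine (ENNReal.toReal_le_of_le_ofReal (by positivity) h1).trans ?_
  have h2 : r ^ 2 - 1 ≤ r ^ d := by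
    rcases le_total 1 r with hr1 | hr1
    · have := pow_le_pow_right₀ hr1 hd
      linarith
    · have : r ^ 2 ≤ 1 := pow_le_one₀ hr hr1
      have : 0 ≤ r ^ d := by positivity
      linarith
  rw [mul_assoc, ← Real.exp_nat_mul, ← Real.exp_add]
  gcongr
  push_cast
  nlinarith

variable {u : ℝ}

/-- The translated score looks at the ball around `x + y`, which is disjoint from the ball around
`x` once `‖y‖ > 2r`. The marks are frozen here and integrated out later. -/
theorem integral_truncated_mul (hP : IsPoissonLaw (stationaryIntensity d Q u) P)
    (h₁ : ControlledAt Q P ξ₁ x R K C c) (h₂ : ControlledAt Q P ξ₂ x R K C c)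
    {r : ℝ} (hr : 0 ≤ r) {y : EuclideanSpace ℝ (Fin d)} (hy : 2 * r < ‖y‖) (m m' : M) :
    ∫ S, truncated ξ₁ R x r (m, S) * truncated ξ₂ R x r (m', S.translate (-y)) ∂P =
      (∫ S, truncated ξ₁ R x r (m, S) ∂P) *
        ∫ S, truncated ξ₂ R x r (m', S.translate (-y)) ∂P := by
  have hdisj : Disjoint (Prod.fst ⁻¹' Metric.closedBall x r : Set (Pt d M))
      (Prod.fst ⁻¹' Metric.closedBall (x + y) r) := by
    refine Disjoint.preimage _ (Metric.closedBall_disjoint_closedBall ?_)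
    rw [dist_self_add_right]
    linarith
  have hm : ∀ z : EuclideanSpace ℝ (Fin d),
      MeasurableSet (Prod.fst ⁻¹' Metric.closedBall z r : Set (Pt d M)) := fun z =>
    Metric.isClosed_closedBall.measurableSet.preimage measurable_fst
  have hi := hP.indepFun_restrict (hm x) (hm (x + y)) hdisj
    (f₁ := fun S => S.inBall x r) (f₂ := fun S => S.inBall (x + y) r)
    (fun S => rfl) (fun S => rfl)
  have hg₁ : Measurable fun S : Config d M => truncated ξ₁ R x r (m, S) :=
    (h₁.measurable_truncated r).comp measurable_prodMk_left
  have hg₂ : Measurable fun S : Config d M => truncated ξ₂ R x r (m', S.translate (-y)) :=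
    ((h₂.measurable_truncated r).comp measurable_prodMk_left).comp (measurable_translate_right (-y))
  have hi' := hi.comp hg₁ hg₂
  have h := hi'.integral_fun_mul_eq_mul_integral
    (hg₁.comp (measurable_inBall x r)).aestronglyMeasurable
    (hg₂.comp (measurable_inBall (x + y) r)).aestronglyMeasurable
  simp only [Function.comp_apply, ← inBall_translate] at h
  simpa only [h₁.truncated_inBall hr, h₂.truncated_inBall hr] using h

end ControlledAt

section Measurability

/-- The map `(m, m', S) ↦ (m, S)` is measure preserving. -/
theorem measurePreserving_fst_snd_snd (Q : Measure M) [IsProbabilityMeasure Q]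
    (P : Measure (Config d M)) [IsProbabilityMeasure P] :
    MeasurePreserving (fun w : M × M × Config d M => (w.1, w.2.2)) (Q.prod (Q.prod P))
      (Q.prod P) :=
  (MeasurePreserving.id Q).prod measurePreserving_snd

/-- The map `(m, m', S) ↦ (m', m, S)` is measure preserving. -/
theorem measurePreserving_swap_marks (Q : Measure M) [IsProbabilityMeasure Q]
    (P : Measure (Config d M)) [IsProbabilityMeasure P] :
    MeasurePreserving (fun w : M × M × Config d M => (w.2.1, w.1, w.2.2)) (Q.prod (Q.prod P))
      (Q.prod (Q.prod P)) :=
  (measurePreserving_prodAssoc Q Q P).comp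
    (((Measure.measurePreserving_swap (μ := Q) (ν := Q)).prod (MeasurePreserving.id P)).comp
      ((measurePreserving_prodAssoc Q Q P).symm _))

variable {Q : Measure M} [IsProbabilityMeasure Q] {u : ℝ} {P : Measure (Config d M)}

theorem IsPoissonLaw.ae_free (hP : IsPoissonLaw (stationaryIntensity d Q u) P) (hd : d ≠ 0)
    (z : EuclideanSpace ℝ (Fin d)) : ∀ᵐ S ∂P, ∀ m : M, (S, (z, m)) ∈ freePairs d M := by
  have hm : MeasurableSet (Prod.fst ⁻¹' {z} : Set (Pt d M)) :=
    (measurableSet_singleton z).preimage measurable_fst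
  filter_upwards [hP.ae_count_eq_zero hm (stationaryIntensity_fst_singleton Q u hd z)] with S hS
  exact fun m => hS

theorem IsPoissonLaw.ae_prod_free (hP : IsPoissonLaw (stationaryIntensity d Q u) P) (hd : d ≠ 0)
    (z : EuclideanSpace ℝ (Fin d)) :
    ∀ᵐ w ∂(Q.prod (Q.prod P)), ∀ m : M, (w.2.2, (z, m)) ∈ freePairs d M := by
  have := hP.isProbabilityMeasure
  exact ((Measure.quasiMeasurePreserving_snd.comp
    Measure.quasiMeasurePreserving_snd).ae (hP.ae_free hd z))

theorem measurable_score_addFree {ξ : Score d M} (hξ : Measurable (Function.uncurry ξ))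
    {α : Type*} [MeasurableSpace α] {f g : α → Pt d M} {S : α → Config d M} (hf : Measurable f)
    (hg : Measurable g) (hS : Measurable S) :
    Measurable fun a => ξ (f a) ((S a).addFree (g a)) :=
  hξ.comp (hf.prodMk (measurable_addFree.comp (hS.prodMk hg)))

/-- Almost surely no point of the process sits at the fixed location `z`, so `add` may be replaced
by the jointly measurable `addFree`. -/
theorem aestronglyMeasurable_score_add {ξ : Score d M} (hξ : Measurable (Function.uncurry ξ))
    (hP : IsPoissonLaw (stationaryIntensity d Q u) P) (hd : d ≠ 0)
    (x z : EuclideanSpace ℝ (Fin d)) :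
    AEStronglyMeasurable (fun w : M × M × Config d M => ξ (x, w.1) (w.2.2.add (z, w.2.1)))
      (Q.prod (Q.prod P)) := by
  refine (measurable_score_addFree hξ (f := fun w : M × M × Config d M => (x, w.1))
    (g := fun w => (z, w.2.1)) (S := fun w => w.2.2) (by fun_prop) (by fun_prop)
    (by fun_prop)).aestronglyMeasurable.congr ?_
  filter_upwards [hP.ae_prod_free hd z] with w hw
  rw [addFree_of_mem (hw _)]

/-- The map `(m, m', S) ↦ (m', m, S - y)` is measure preserving. -/
theorem IsPoissonLaw.measurePreserving_swap_translate
    (hP : IsPoissonLaw (stationaryIntensity d Q u) P) (y : EuclideanSpace ℝ (Fin d)) :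
    MeasurePreserving (fun w : M × M × Config d M => (w.2.1, w.1, w.2.2.translate y))
      (Q.prod (Q.prod P)) (Q.prod (Q.prod P)) := by
  have := hP.isProbabilityMeasure
  exact (((MeasurePreserving.id Q).prod ((MeasurePreserving.id Q).prod
    (hP.measurePreserving_translate y)))).comp (measurePreserving_swap_marks Q P)

theorem aestronglyMeasurable_score_add_translate {ξ : Score d M}
    (hξ : Measurable (Function.uncurry ξ))
    (hP : IsPoissonLaw (stationaryIntensity d Q u) P) (hd : d ≠ 0)
    (x y : EuclideanSpace ℝ (Fin d)) :
    AEStronglyMeasurable (fun w : M × M × Config d M =>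
      ξ (x, w.2.1) ((w.2.2.add (x, w.1)).translate (-y))) (Q.prod (Q.prod P)) := by
  simp_rw [translate_neg_add]
  exact (aestronglyMeasurable_score_add hξ hP hd x (x - y)).comp_measurePreserving
    (hP.measurePreserving_swap_translate (-y))

end Measurability

namespace ControlledAt

variable {Q : Measure M} {P : Measure (Config d M)} {ξ ξ₁ ξ₂ : Score d M}
  {x : EuclideanSpace ℝ (Fin d)} {R : M → Config d M → ℝ≥0} {K C c : ℝ}
  [IsProbabilityMeasure Q] {u : ℝ}

/-- Translating `S ∪ {x}` by `-y` yields `S - y` with the point `x - y` added. By stationarity and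
exchange of the two marks this is the moment bound for one added point, which needs `x - y ≠ x`. -/
theorem lintegral_add_translate_le (h : ControlledAt Q P ξ x R K C c)
    (hP : IsPoissonLaw (stationaryIntensity d Q u) P) (hd : d ≠ 0)
    {y : EuclideanSpace ℝ (Fin d)} (hy : y ≠ 0) :
    ∫⁻ w : M × M × Config d M, ‖ξ (x, w.2.1) ((w.2.2.add (x, w.1)).translate (-y))‖ₑ ^ 4
      ∂(Q.prod (Q.prod P)) ≤ ENNReal.ofReal K := by
  refine le_trans (le_of_eq ?_) (h.moment_add (x - y) (by simpa using hy))
  simp_rw [translate_neg_add]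
  exact lintegral_comp_measurePreserving (hP.measurePreserving_swap_translate (-y))
    (f := fun w => ‖ξ (x, w.1) (w.2.2.add (x - y, w.2.1))‖ₑ ^ 4)
    ((aestronglyMeasurable_score_add h.measurable_score hP hd x (x - y)).enorm.pow_const 4)

theorem integrable_offDiagProd (h₁ : ControlledAt Q P ξ₁ x R K C c)
    (h₂ : ControlledAt Q P ξ₂ x R K C c) (hP : IsPoissonLaw (stationaryIntensity d Q u) P)
    (hd : d ≠ 0) {y : EuclideanSpace ℝ (Fin d)} (hy : y ≠ 0) :
    Integrable (offDiagProd ξ₁ ξ₂ x y) (Q.prod (Q.prod P)) := by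
  have := hP.isProbabilityMeasure
  have ha := aestronglyMeasurable_score_add h₁.measurable_score hP hd x (x + y)
  have hb := aestronglyMeasurable_score_add_translate h₂.measurable_score hP hd x y
  exact integrable_mul_of_pow_four ha
    (integrable_pow_four_of_lintegral_le ha (h₁.moment_add (x + y) (by simpa using hy))) hb
    (integrable_pow_four_of_lintegral_le hb (h₂.lintegral_add_translate_le hP hd hy))

theorem integrable_score (h : ControlledAt Q P ξ x R K C c)
    (hP : IsPoissonLaw (stationaryIntensity d Q u) P) :
    Integrable (fun w => ξ (x, w.1) w.2) (Q.prod P) := by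
  have := hP.isProbabilityMeasure
  have ha := h.measurable_score_at.aestronglyMeasurable (μ := Q.prod P)
  exact integrable_of_pow_four ha (integrable_pow_four_of_lintegral_le ha h.moment)

theorem integrable_diagProd (h₁ : ControlledAt Q P ξ₁ x R K C c)
    (h₂ : ControlledAt Q P ξ₂ x R K C c) (hP : IsPoissonLaw (stationaryIntensity d Q u) P) :
    Integrable (diagProd ξ₁ ξ₂ x) (Q.prod P) := by
  have := hP.isProbabilityMeasure
  have ha := h₁.measurable_score_at.aestronglyMeasurable (μ := Q.prod P)
  have hb := h₂.measurable_score_at.aestronglyMeasurable (μ := Q.prod P)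
  exact integrable_mul_of_pow_four ha (integrable_pow_four_of_lintegral_le ha h₁.moment) hb
    (integrable_pow_four_of_lintegral_le hb h₂.moment)

theorem integral_translate (h : ControlledAt Q P ξ x R K C c)
    (hP : IsPoissonLaw (stationaryIntensity d Q u) P) (y : EuclideanSpace ℝ (Fin d)) :
    ∫ w, ξ (x, w.1) (w.2.translate y) ∂(Q.prod P) = ∫ w, ξ (x, w.1) w.2 ∂(Q.prod P) := by
  have := hP.isProbabilityMeasure
  exact integral_comp_measurePreserving
    ((MeasurePreserving.id Q).prod (hP.measurePreserving_translate y))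
    (f := fun w => ξ (x, w.1) w.2) h.measurable_score_at.aestronglyMeasurable

theorem integrable_score_translate (h : ControlledAt Q P ξ x R K C c)
    (hP : IsPoissonLaw (stationaryIntensity d Q u) P) (y : EuclideanSpace ℝ (Fin d)) :
    Integrable (fun w => ξ (x, w.1) (w.2.translate y)) (Q.prod P) := by
  have := hP.isProbabilityMeasure
  exact ((MeasurePreserving.id Q).prod (hP.measurePreserving_translate y)).integrable_comp_of_integrable
    (h.integrable_score hP)

/-- The covariance estimate is applied with `δ = exp(-(c/2) r²)` and truncation at `r = ‖y‖/3`,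
hence the rate `c/18`. The unperturbed scores serve as the comparison variables `a₀` and `b₀`. -/
theorem abs_pairCov_le (h₁ : ControlledAt Q P ξ₁ x R K C c) (h₂ : ControlledAt Q P ξ₂ x R K C c)
    (hP : IsPoissonLaw (stationaryIntensity d Q u) P) (hd : 2 ≤ d) (hK : 0 ≤ K) (hC : 0 ≤ C)
    (hc : 0 ≤ c) {y : EuclideanSpace ℝ (Fin d)} (hy : y ≠ 0) :
    |pairCov Q P ξ₁ ξ₂ x y| ≤ Real.exp (-(c / 18) * ‖y‖ ^ 2) *
      (K + C * Real.exp c + (1 + K) * (1 + K + C * Real.exp c)) := by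
  have := hP.isProbabilityMeasure
  have hd0 : d ≠ 0 := by omega
  have hy0 : 0 < ‖y‖ := norm_pos_iff.2 hy
  -- A third and not a half, so that `2r < ‖y‖` strictly and the closed balls are disjoint.
  set r := ‖y‖ / 3 with hr
  have hr0 : 0 ≤ r := by positivity
  have hyr : 2 * r < ‖y‖ := by rw [hr]; linarith
  set ν := Q.prod (Q.prod P)
  have hT₁ := measurePreserving_fst_snd_snd Q P
  have hT₂ : MeasurePreserving (fun w : M × M × Config d M => (w.2.1, w.2.2.translate (-y)))
      ν (Q.prod P) :=
    ((MeasurePreserving.id Q).prod (hP.measurePreserving_translate (-y))).comp measurePreserving_snd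
  have ha := aestronglyMeasurable_score_add h₁.measurable_score hP hd0 x (x + y)
  have hb := aestronglyMeasurable_score_add_translate h₂.measurable_score hP hd0 x y
  have haK := h₁.moment_add (x + y) (by simpa using hy)
  have hbK := h₂.lintegral_add_translate_le hP hd0 hy
  have ha₀ : AEStronglyMeasurable (fun w : M × M × Config d M => ξ₁ (x, w.1) w.2.2) ν :=
    (h₁.measurable_score_at.comp hT₁.measurable).aestronglyMeasurable
  have hb₀ : AEStronglyMeasurable
      (fun w : M × M × Config d M => ξ₂ (x, w.2.1) (w.2.2.translate (-y))) ν :=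
    (h₂.measurable_score_at.comp hT₂.measurable).aestronglyMeasurable
  have ha₀K : ∫⁻ w : M × M × Config d M, ‖ξ₁ (x, w.1) w.2.2‖ₑ ^ 4 ∂ν ≤ ENNReal.ofReal K :=
    (lintegral_comp_measurePreserving hT₁ (f := fun z => ‖ξ₁ (x, z.1) z.2‖ₑ ^ 4)
      (h₁.measurable_score_at.enorm.pow_const 4).aemeasurable).le.trans h₁.moment
  have hb₀K : ∫⁻ w : M × M × Config d M, ‖ξ₂ (x, w.2.1) (w.2.2.translate (-y))‖ₑ ^ 4 ∂ν ≤
      ENNReal.ofReal K :=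
    (lintegral_comp_measurePreserving hT₂ (f := fun z => ‖ξ₂ (x, z.1) z.2‖ₑ ^ 4)
      (h₂.measurable_score_at.enorm.pow_const 4).aemeasurable).le.trans h₂.moment
  set A : Set (M × Config d M) := {z | (R z.1 z.2 : ℝ) ≤ r}
  have hA : MeasurableSet A := h₁.measurableSet_radius_le r
  set G : Set (M × M × Config d M) := (fun w => (w.1, w.2.2)) ⁻¹' A
  set H : Set (M × M × Config d M) := (fun w => (w.2.1, w.2.2.translate (-y))) ⁻¹' A
  have hδ : Real.exp (-(c / 18) * ‖y‖ ^ 2) = Real.exp (-(c / 2) * r ^ 2) := by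
    rw [hr]; congr 1; ring
  have hG : ν.real Gᶜ ≤ C * Real.exp c * Real.exp (-(c / 18) * ‖y‖ ^ 2) ^ 2 := by
    rw [hδ, measureReal_def, ← preimage_compl, hT₁.measure_preimage hA.compl.nullMeasurableSet]
    exact h₁.real_radius_gt_le hd hC hc hr0
  have hH : ν.real Hᶜ ≤ C * Real.exp c * Real.exp (-(c / 18) * ‖y‖ ^ 2) ^ 2 := by
    rw [hδ, measureReal_def, ← preimage_compl, hT₂.measure_preimage hA.compl.nullMeasurableSet]
    exact h₂.real_radius_gt_le hd hC hc hr0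
  have ha₀4 := integrable_pow_four_of_lintegral_le ha₀ ha₀K
  have hb₀4 := integrable_pow_four_of_lintegral_le hb₀ hb₀K
  have hGa : ∀ w, G.indicator (fun w : M × M × Config d M => ξ₁ (x, w.1) w.2.2) w =
      truncated ξ₁ R x r (w.1, w.2.2) := fun w => rfl
  have hHb : ∀ w, H.indicator
      (fun w : M × M × Config d M => ξ₂ (x, w.2.1) (w.2.2.translate (-y))) w =
      truncated ξ₂ R x r (w.2.1, w.2.2.translate (-y)) := fun w => rfl
  have hGm : MeasurableSet G := hT₁.measurable hA
  have hHm : MeasurableSet H := hT₂.measurable hA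
  have hi4 : ∀ {f : M × M × Config d M → ℝ} {G : Set (M × M × Config d M)}, MeasurableSet G →
      Integrable (fun w => f w ^ 4) ν → Integrable (fun w => G.indicator f w ^ 4) ν := by
    intro f G hG hf
    refine (hf.indicator hG).congr (Eventually.of_forall fun w => ?_)
    by_cases hw : w ∈ G <;> simp [hw]
  have hind : ∫ w, G.indicator (fun w : M × M × Config d M => ξ₁ (x, w.1) w.2.2) w *
      H.indicator (fun w : M × M × Config d M => ξ₂ (x, w.2.1) (w.2.2.translate (-y))) w ∂ν =
      (∫ w, G.indicator (fun w : M × M × Config d M => ξ₁ (x, w.1) w.2.2) w ∂ν) *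
      ∫ w, H.indicator
        (fun w : M × M × Config d M => ξ₂ (x, w.2.1) (w.2.2.translate (-y))) w ∂ν := by
    -- For fixed marks the truncated scores are independent; integrating over the two independent
    -- marks preserves the factorization.
    rw [integral_prod_prod (integrable_mul_of_pow_four (ha₀.indicator hGm) (hi4 hGm ha₀4)
        (hb₀.indicator hHm) (hi4 hHm hb₀4)),
      integral_prod_prod ((integrable_of_pow_four ha₀ ha₀4).indicator hGm),
      integral_prod_prod ((integrable_of_pow_four hb₀ hb₀4).indicator hHm)]
    simp only [hGa, hHb, integral_truncated_mul hP h₁ h₂ hr0 hyr, integral_const_mul,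
      integral_mul_const, integral_const, probReal_univ, smul_eq_mul, one_mul]
  have key := abs_integral_mul_sub_le (Real.exp_pos _) ha
    (integrable_pow_four_of_lintegral_le ha haK) (integral_pow_four_le_of_lintegral_le hK ha haK)
    hb (integrable_pow_four_of_lintegral_le hb hbK) (integral_pow_four_le_of_lintegral_le hK hb hbK)
    ha₀ ha₀4 (integral_pow_four_le_of_lintegral_le hK ha₀ ha₀K)
    hb₀ hb₀4 (integral_pow_four_le_of_lintegral_le hK hb₀ hb₀K)
    hGm hG hHm hH ?_ ?_ hind
  · have e₁ : ∫ w, ξ₁ (x, w.1) w.2.2 ∂ν = ∫ w, ξ₁ (x, w.1) w.2 ∂(Q.prod P) :=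
      integral_comp_measurePreserving hT₁ (f := fun w => ξ₁ (x, w.1) w.2)
        h₁.measurable_score_at.aestronglyMeasurable
    have e₂ : ∫ w, ξ₂ (x, w.2.1) (w.2.2.translate (-y)) ∂ν =
        ∫ w, ξ₂ (x, w.1) (w.2.translate (-y)) ∂(Q.prod P) := by
      rw [h₂.integral_translate hP]
      exact integral_comp_measurePreserving hT₂ (f := fun w => ξ₂ (x, w.1) w.2)
        h₂.measurable_score_at.aestronglyMeasurable
    rw [e₁, e₂] at key
    exact key
  -- On the truncating events the radius is at most `r < ‖y‖`, so the added point at distance `‖y‖`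
  -- has no effect.
  · intro w hw
    refine h₁.eq_add ?_
    simp only [dist_self_add_left]
    exact lt_of_le_of_lt hw (by linarith)
  · intro w hw
    simp only [translate_neg_add]
    refine h₂.eq_add ?_
    simp only [dist_eq_norm, sub_sub_cancel_left, norm_neg]
    exact lt_of_le_of_lt hw (by linarith)

end ControlledAt

end StabScore

end

/-! ### Score sums as integrals, and reordering of locations, marks and configurations. -/

noncomputable section

namespace StabScore

open Config

/-- Tailored to the Mecke formulas: `p` is a location or a pair of locations in a bounded set, and
stationarity gives the fibre integral `Ψ p` with a bound `L` independent of `p`. -/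
theorem integrable_and_integral_eq_of_fibre {X Ω : Type*} [MeasurableSpace X] [MeasurableSpace Ω]
    {μ : Measure X} {ν : Measure Ω} [SFinite μ] [SFinite ν] {h : X × Ω → ℝ} (hm : Measurable h)
    {B : Set X} (hB : MeasurableSet B) (hμB : μ B ≠ ∞) {L : ℝ≥0∞} (hL : L ≠ ∞) {Ψ : X → ℝ}
    (hle : ∀ᵐ p ∂μ, p ∈ B → ∫⁻ w, ‖h (p, w)‖ₑ ∂ν ≤ L)
    (heq : ∀ᵐ p ∂μ, p ∈ B → ∫ w, h (p, w) ∂ν = Ψ p)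
    (hout : ∀ p, p ∉ B → ∀ w, h (p, w) = 0) :
    Integrable h (μ.prod ν) ∧ ∫ z, h z ∂(μ.prod ν) = ∫ p in B, Ψ p ∂μ := by
  have hint : Integrable h (μ.prod ν) := by
    refine ⟨hm.aestronglyMeasurable, ?_⟩
    rw [hasFiniteIntegral_iff_enorm, lintegral_prod _ hm.enorm.aemeasurable]
    calc ∫⁻ p, ∫⁻ w, ‖h (p, w)‖ₑ ∂ν ∂μ ≤ ∫⁻ p, B.indicator (fun _ => L) p ∂μ := by
          refine lintegral_mono_ae ?_
          filter_upwards [hle] with p hp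
          by_cases hpB : p ∈ B
          · simpa [hpB] using hp hpB
          · simp [hpB, hout p hpB]
      _ = L * μ B := by rw [lintegral_indicator hB, setLIntegral_const]
      _ < ∞ := ENNReal.mul_lt_top hL.lt_top hμB.lt_top
  refine ⟨hint, ?_⟩
  rw [integral_prod _ hint, ← integral_indicator hB]
  refine integral_congr_ae ?_
  filter_upwards [heq] with p hp
  by_cases hpB : p ∈ B
  · simpa [hpB] using hp hpB
  · simp [hpB, hout p hpB]

theorem lintegral_enorm_mul_le {Ω : Type*} [MeasurableSpace Ω] {ν : Measure Ω}
    [IsProbabilityMeasure ν] {a b : Ω → ℝ} {K : ℝ} (hK : 0 ≤ K) (ha : AEStronglyMeasurable a ν)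
    (haK : ∫⁻ w, ‖a w‖ₑ ^ 4 ∂ν ≤ ENNReal.ofReal K) (hb : AEStronglyMeasurable b ν)
    (hbK : ∫⁻ w, ‖b w‖ₑ ^ 4 ∂ν ≤ ENNReal.ofReal K) :
    ∫⁻ w, ‖a w * b w‖ₑ ∂ν ≤ ENNReal.ofReal (1 + K + K) := by
  have ha4 := integrable_pow_four_of_lintegral_le ha haK
  have hb4 := integrable_pow_four_of_lintegral_le hb hbK
  rw [← ofReal_integral_norm_eq_lintegral_enorm (integrable_mul_of_pow_four ha ha4 hb hb4)]
  refine ENNReal.ofReal_le_ofReal ?_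
  calc ∫ w, ‖a w * b w‖ ∂ν ≤ ∫ w, (1 + a w ^ 4 + b w ^ 4) ∂ν :=
        integral_mono (integrable_mul_of_pow_four ha ha4 hb hb4).norm
          (((integrable_const (1 : ℝ)).add ha4).add hb4) fun w => abs_mul_le_pow_four (a w) (b w)
    _ = 1 + ∫ w, a w ^ 4 ∂ν + ∫ w, b w ^ 4 ∂ν := by
        refine (integral_add ((integrable_const (1 : ℝ)).add ha4) hb4).trans ?_
        congr 1
        refine (integral_add (integrable_const (1 : ℝ)) ha4).trans ?_
        simp
    _ ≤ 1 + K + K := by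
        gcongr
        exacts [integral_pow_four_le_of_lintegral_le hK ha haK,
          integral_pow_four_le_of_lintegral_le hK hb hbK]

variable {d : ℕ} {M : Type*}

open Classical in
/-- The score `ξ` restricted to points with location in `D`. -/
def scoreOn (D : Set (EuclideanSpace ℝ (Fin d))) (ξ : Score d M) : Score d M :=
  fun q S => if q.1 ∈ D then ξ q S else 0

variable [MeasurableSpace M]

theorem measurable_scoreOn {D : Set (EuclideanSpace ℝ (Fin d))} (hD : MeasurableSet D)
    {ξ : Score d M} (hξ : Measurable (Function.uncurry ξ)) :
    Measurable (Function.uncurry (scoreOn D ξ)) :=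
  Measurable.ite (measurable_fst.fst hD) hξ measurable_const

theorem restrict_pointMeasure (S : Config d M) {D : Set (EuclideanSpace ℝ (Fin d))}
    (hD : MeasurableSet D) (hfin : (S.carrier ∩ Prod.fst ⁻¹' D).Finite) :
    S.pointMeasure.restrict (Prod.fst ⁻¹' D) = (ofFinite _ hfin).pointMeasure := by
  ext B hB
  rw [Measure.restrict_apply hB, pointMeasure_apply _ (hB.inter (hD.preimage measurable_fst)),
    pointMeasure_apply _ hB, count, count, carrier_ofFinite, inter_assoc,
    inter_comm (Prod.fst ⁻¹' D)]

/-- Rewriting the finite sum as an integral against the counting measure gives measurability in `S`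
and opens the way to the Mecke equations. -/
theorem scoreSum_eq_integral {ξ : Score d M} (hξ : Measurable (Function.uncurry ξ))
    {D : Set (EuclideanSpace ℝ (Fin d))} (hD : MeasurableSet D) (hDb : Bornology.IsBounded D)
    (S : Config d M) : scoreSum ξ D S = ∫ q, scoreOn D ξ q S ∂S.pointMeasure := by
  classical
  have hfin := S.locallyFinite D hDb
  have hm : Measurable fun q => ξ q S := hξ.comp (measurable_id.prodMk measurable_const)
  have h1 : (fun q => scoreOn D ξ q S) = (Prod.fst ⁻¹' D).indicator fun q => ξ q S := by
    ext q; simp [scoreOn, indicator]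
  rw [h1, integral_indicator (hD.preimage measurable_fst), restrict_pointMeasure S hD hfin,
    pointMeasure]
  have := hfin.fintype
  change _ = ∫ q, ξ q S ∂(Measure.sum fun q : ↥(S.carrier ∩ Prod.fst ⁻¹' D) => Measure.dirac q.1)
  rw [Measure.sum_fintype, integral_finsetSum_measure]
  · simp_rw [integral_dirac' _ _ hm.stronglyMeasurable]
    rw [scoreSum, ← finsum_set_coe_eq_finsum_mem, finsum_eq_sum_of_fintype]
  · intro q _
    refine ⟨hm.aestronglyMeasurable, ?_⟩
    rw [hasFiniteIntegral_iff_enorm, lintegral_dirac' _ hm.enorm]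
    exact enorm_lt_top

theorem measurable_scoreSum {ξ : Score d M} (hξ : Measurable (Function.uncurry ξ))
    {D : Set (EuclideanSpace ℝ (Fin d))} (hD : MeasurableSet D) (hDb : Bornology.IsBounded D) :
    StronglyMeasurable (scoreSum ξ D) := by
  rw [show scoreSum ξ D = fun S => ∫ q, scoreOn D ξ q S ∂(pointKernel d M S) from
    funext fun S => scoreSum_eq_integral hξ hD hDb S]
  refine StronglyMeasurable.integral_kernel_prod_right (κ := pointKernel d M)
    (f := fun S q => scoreOn D ξ q S) ?_
  exact ((measurable_scoreOn hD hξ).comp measurable_swap).stronglyMeasurable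

section Rearrange

variable (Q : Measure M) [IsProbabilityMeasure Q] (P : Measure (Config d M))
  [IsProbabilityMeasure P] (u : ℝ)

theorem measurePreserving_location_mark :
    MeasurePreserving (fun z : EuclideanSpace ℝ (Fin d) × M × Config d M => (z.2.2, z.1, z.2.1))
      (volume.prod (Q.prod P)) (P.prod (volume.prod Q)) :=
  Measure.measurePreserving_swap.comp ((measurePreserving_prodAssoc volume Q P).symm _)

theorem measurePreserving_prod_prod_comm {α β : Type*} [MeasurableSpace α] [MeasurableSpace β]
    (μ : Measure α) (ν : Measure β) [SFinite μ] [SFinite ν] :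
    MeasurePreserving (fun z : (α × α) × (β × β) => ((z.1.1, z.2.1), (z.1.2, z.2.2)))
      ((μ.prod μ).prod (ν.prod ν)) ((μ.prod ν).prod (μ.prod ν)) := by
  have h1 : MeasurePreserving (fun z : (α × α) × (β × β) => (z.1, z.2.swap))
      ((μ.prod μ).prod (ν.prod ν)) ((μ.prod μ).prod (ν.prod ν)) :=
    (MeasurePreserving.id _).prod Measure.measurePreserving_swap
  have h2 := measurePreserving_prodAssoc μ μ (ν.prod ν)
  have h3 : MeasurePreserving (fun z : α × (α × (β × β)) => (z.1, ((z.2.1, z.2.2.1), z.2.2.2)))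
      (μ.prod (μ.prod (ν.prod ν))) (μ.prod ((μ.prod ν).prod ν)) :=
    (MeasurePreserving.id μ).prod ((measurePreserving_prodAssoc μ ν ν).symm _)
  have h4 : MeasurePreserving (fun z : α × ((α × β) × β) => (z.1, z.2.swap))
      (μ.prod ((μ.prod ν).prod ν)) (μ.prod (ν.prod (μ.prod ν))) :=
    (MeasurePreserving.id μ).prod Measure.measurePreserving_swap
  have h5 := (measurePreserving_prodAssoc μ ν (μ.prod ν)).symm _
  exact h5.comp (h4.comp (h3.comp (h2.comp h1)))

theorem measurePreserving_locations_marks :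
    MeasurePreserving (fun z : (EuclideanSpace ℝ (Fin d) × EuclideanSpace ℝ (Fin d)) ×
        M × M × Config d M => (z.2.2.2, (z.1.1, z.2.1), (z.1.2, z.2.2.1)))
      ((volume.prod volume).prod (Q.prod (Q.prod P)))
      (P.prod ((volume.prod Q).prod (volume.prod Q))) := by
  have h1 : MeasurePreserving (fun z : (EuclideanSpace ℝ (Fin d) × EuclideanSpace ℝ (Fin d)) ×
        M × M × Config d M => (z.1, ((z.2.1, z.2.2.1), z.2.2.2)))
      ((volume.prod volume).prod (Q.prod (Q.prod P)))
      ((volume.prod volume).prod ((Q.prod Q).prod P)) :=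
    (MeasurePreserving.id _).prod ((measurePreserving_prodAssoc Q Q P).symm _)
  have h2 := (measurePreserving_prodAssoc
    ((volume : Measure (EuclideanSpace ℝ (Fin d))).prod
      (volume : Measure (EuclideanSpace ℝ (Fin d)))) (Q.prod Q) P).symm _
  have h3 : MeasurePreserving (Prod.swap : ((EuclideanSpace ℝ (Fin d) ×
      EuclideanSpace ℝ (Fin d)) × M × M) × Config d M → _)
      ((((volume : Measure (EuclideanSpace ℝ (Fin d))).prod
      (volume : Measure (EuclideanSpace ℝ (Fin d)))).prod (Q.prod Q)).prod P)
      (P.prod (((volume : Measure (EuclideanSpace ℝ (Fin d))).prod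
      (volume : Measure (EuclideanSpace ℝ (Fin d)))).prod (Q.prod Q))) :=
    Measure.measurePreserving_swap
  have h4 := (MeasurePreserving.id P).prod (measurePreserving_prod_prod_comm
    (volume : Measure (EuclideanSpace ℝ (Fin d))) Q)
  exact h4.comp (h3.comp (h2.comp h1))

theorem integrable_and_integral_prod_intensity (hu : 0 ≤ u) {h : Config d M × Pt d M → ℝ}
    (hm : Measurable h)
    (hi : Integrable (fun z : EuclideanSpace ℝ (Fin d) × M × Config d M =>
      h (z.2.2, z.1, z.2.1)) (volume.prod (Q.prod P))) :
    Integrable h (P.prod (stationaryIntensity d Q u)) ∧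
      ∫ z, h z ∂(P.prod (stationaryIntensity d Q u)) =
        u * ∫ z : EuclideanSpace ℝ (Fin d) × M × Config d M, h (z.2.2, z.1, z.2.1)
          ∂(volume.prod (Q.prod P)) := by
  have hT := measurePreserving_location_mark (d := d) Q P
  have e : P.prod (stationaryIntensity d Q u) =
      ENNReal.ofReal u • P.prod ((volume : Measure (EuclideanSpace ℝ (Fin d))).prod Q) := by
    rw [stationaryIntensity, Measure.prod_smul_right]
  rw [e, integral_smul_measure, ENNReal.toReal_ofReal hu, smul_eq_mul,
    integral_comp_measurePreserving hT (f := h) hm.aestronglyMeasurable]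
  refine ⟨Integrable.smul_measure ?_ ENNReal.ofReal_ne_top, rfl⟩
  exact (hT.integrable_comp hm.aestronglyMeasurable).1 hi

theorem integrable_and_integral_prod_intensity_prod (hu : 0 ≤ u)
    {h : Config d M × Pt d M × Pt d M → ℝ} (hm : Measurable h)
    (hi : Integrable (fun z : (EuclideanSpace ℝ (Fin d) × EuclideanSpace ℝ (Fin d)) ×
      M × M × Config d M => h (z.2.2.2, (z.1.1, z.2.1), (z.1.2, z.2.2.1)))
        ((volume.prod volume).prod (Q.prod (Q.prod P)))) :
    Integrable h (P.prod ((stationaryIntensity d Q u).prod (stationaryIntensity d Q u))) ∧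
      ∫ z, h z ∂(P.prod ((stationaryIntensity d Q u).prod (stationaryIntensity d Q u))) =
        u ^ 2 * ∫ z : (EuclideanSpace ℝ (Fin d) × EuclideanSpace ℝ (Fin d)) × M × M × Config d M,
          h (z.2.2.2, (z.1.1, z.2.1), (z.1.2, z.2.2.1))
          ∂((volume.prod volume).prod (Q.prod (Q.prod P))) := by
  have hT := measurePreserving_locations_marks (d := d) Q P
  have e : P.prod ((stationaryIntensity d Q u).prod (stationaryIntensity d Q u)) =
      (ENNReal.ofReal u * ENNReal.ofReal u) •
        P.prod (((volume : Measure (EuclideanSpace ℝ (Fin d))).prod Q).prod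
          ((volume : Measure (EuclideanSpace ℝ (Fin d))).prod Q)) := by
    rw [stationaryIntensity, Measure.prod_smul_left, Measure.prod_smul_right,
      Measure.prod_smul_right, Measure.prod_smul_right, smul_smul]
  rw [e, integral_smul_measure, ENNReal.toReal_mul, ENNReal.toReal_ofReal hu, smul_eq_mul,
    pow_two u,
    integral_comp_measurePreserving hT (f := h) hm.aestronglyMeasurable]
  refine ⟨Integrable.smul_measure ?_
    (ENNReal.mul_ne_top ENNReal.ofReal_ne_top ENNReal.ofReal_ne_top), rfl⟩
  exact (hT.integrable_comp hm.aestronglyMeasurable).1 hi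

end Rearrange

end StabScore

end

/-! ### First and second moments of score sums. -/

noncomputable section

namespace StabScore

open Config

variable {d : ℕ} {M : Type*}

theorem mem_freePairs_add {S : Config d M} {p q : Pt d M} (h : (S, p) ∈ freePairs d M)
    (hne : q.1 ≠ p.1) : (S.add q, p) ∈ freePairs d M := by
  change (S.carrier ∩ Prod.fst ⁻¹' {p.1}).encard = 0 at h
  change ((S.add q).carrier ∩ Prod.fst ⁻¹' {p.1}).encard = 0
  rw [carrier_add, insert_inter_of_notMem (by simpa using hne)]
  exact h

variable [MeasurableSpace M]

namespace ControlledAt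

variable {Q : Measure M} {P : Measure (Config d M)} {ξ ξ₁ ξ₂ : Score d M}
  {x : EuclideanSpace ℝ (Fin d)} {R : M → Config d M → ℝ≥0} {K C c : ℝ}
  [IsProbabilityMeasure Q] {u : ℝ}

/-- By Mecke the sum becomes an integral over a location `x'`. The added point is absorbed by
`hown`, and a translation by `x - x'` moves it to `x`, so the fibre integral is constant on `D`. -/
theorem integrable_scoreOn_and_integral (h : ControlledAt Q P ξ x R K C c)
    (hP : IsPoissonLaw (stationaryIntensity d Q u) P) (hd : d ≠ 0) (hu : 0 ≤ u)
    (hT : TranslationInvariant ξ) (hown : ∀ p S, ξ p (S.add p) = ξ p S)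
    {D : Set (EuclideanSpace ℝ (Fin d))} (hD : MeasurableSet D) (hDb : Bornology.IsBounded D) :
    Integrable (fun z : Config d M × Pt d M => scoreOn D ξ z.2 z.1) (P ⊗ₘ pointKernel d M) ∧
      ∫ z, scoreOn D ξ z.2 z.1 ∂(P ⊗ₘ pointKernel d M) =
        u * (volume.real D * ∫ w, ξ (x, w.1) w.2 ∂(Q.prod P)) := by
  have := hP.isProbabilityMeasure
  have hm := measurable_scoreOn hD h.measurable_score
  have hm' : Measurable fun z : Config d M × Pt d M => scoreOn D ξ z.2 z.1 :=
    hm.comp measurable_swap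
  have hma : Measurable fun z : Config d M × Pt d M => (z.1.addFree z.2, z.2) :=
    measurable_addFree.prodMk measurable_snd
  have hmc : Measurable fun z : Config d M × Pt d M => scoreOn D ξ z.2 (z.1.addFree z.2) :=
    hm'.comp hma
  rw [hP.compProd_pointKernel (stationaryIntensity_shell_ne_top Q u)
    (stationaryIntensity_fst_singleton Q u hd),
    integrable_map_measure hm'.aestronglyMeasurable hma.aemeasurable,
    integral_map hma.aemeasurable hm'.aestronglyMeasurable]
  have hfib : ∀ x' ∈ D, (fun w : M × Config d M =>
      scoreOn D ξ (x', w.1) (w.2.addFree (x', w.1))) =ᵐ[Q.prod P]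
      fun w => ξ (x, w.1) (w.2.translate (x - x')) := by
    intro x' hx'
    filter_upwards [Measure.quasiMeasurePreserving_snd.ae (hP.ae_free hd x')] with w hw
    rw [addFree_of_mem (hw _), scoreOn, if_pos hx', hown, hT x' (x - x'), add_sub_cancel]
  have hTr : ∀ x', MeasurePreserving (fun w : M × Config d M => (w.1, w.2.translate (x - x')))
      (Q.prod P) (Q.prod P) := fun x' =>
    (MeasurePreserving.id Q).prod (hP.measurePreserving_translate (x - x'))
  have key := integrable_and_integral_eq_of_fibre (μ := (volume : Measure (EuclideanSpace ℝ (Fin d))))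
    (ν := Q.prod P)
    (h := fun z => scoreOn D ξ (z.1, z.2.1) (z.2.2.addFree (z.1, z.2.1)))
    (Ψ := fun _ => ∫ w, ξ (x, w.1) w.2 ∂(Q.prod P))
    (hmc.comp (measurePreserving_location_mark Q P).measurable) hD hDb.measure_lt_top.ne
    (h.integrable_score hP).2.ne
    (Eventually.of_forall fun x' hx' => ?_) (Eventually.of_forall fun x' hx' => ?_)
    (fun x' hx' w => if_neg hx')
  · obtain ⟨hi, he⟩ := key
    have := integrable_and_integral_prod_intensity Q P u hu hmc hi
    refine ⟨this.1, this.2.trans ?_⟩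
    rw [he, setIntegral_const, smul_eq_mul]
  · refine (lintegral_congr_ae ((hfib x' hx').fun_comp enorm)).trans_le ?_
    exact (lintegral_comp_measurePreserving (hTr x') (f := fun w => ‖ξ (x, w.1) w.2‖ₑ)
      h.measurable_score_at.enorm.aemeasurable).le
  · refine (integral_congr_ae (hfib x' hx')).trans ?_
    exact h.integral_translate hP _

theorem integrable_scoreOn_diag_and_integral (h₁ : ControlledAt Q P ξ₁ x R K C c)
    (h₂ : ControlledAt Q P ξ₂ x R K C c)
    (hP : IsPoissonLaw (stationaryIntensity d Q u) P) (hd : d ≠ 0) (hu : 0 ≤ u)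
    (hT₁ : TranslationInvariant ξ₁) (hown₁ : ∀ p S, ξ₁ p (S.add p) = ξ₁ p S)
    (hT₂ : TranslationInvariant ξ₂) (hown₂ : ∀ p S, ξ₂ p (S.add p) = ξ₂ p S)
    {D : Set (EuclideanSpace ℝ (Fin d))} (hD : MeasurableSet D) (hDb : Bornology.IsBounded D) :
    Integrable (fun z : Config d M × Pt d M => scoreOn D ξ₁ z.2 (z.1.addFree z.2) *
        scoreOn D ξ₂ z.2 (z.1.addFree z.2)) (P.prod (stationaryIntensity d Q u)) ∧
      ∫ z, scoreOn D ξ₁ z.2 (z.1.addFree z.2) * scoreOn D ξ₂ z.2 (z.1.addFree z.2)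
        ∂(P.prod (stationaryIntensity d Q u)) =
        u * (volume.real D * ∫ w, diagProd ξ₁ ξ₂ x w ∂(Q.prod P)) := by
  have := hP.isProbabilityMeasure
  have hma : Measurable fun z : Config d M × Pt d M => (z.2, z.1.addFree z.2) :=
    measurable_snd.prodMk measurable_addFree
  have hmc : Measurable fun z : Config d M × Pt d M => scoreOn D ξ₁ z.2 (z.1.addFree z.2) *
        scoreOn D ξ₂ z.2 (z.1.addFree z.2) :=
    ((measurable_scoreOn hD h₁.measurable_score).comp hma).mul
      ((measurable_scoreOn hD h₂.measurable_score).comp hma)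
  have hfib : ∀ x' ∈ D, (fun w : M × Config d M =>
      scoreOn D ξ₁ (x', w.1) (w.2.addFree (x', w.1)) *
        scoreOn D ξ₂ (x', w.1) (w.2.addFree (x', w.1))) =ᵐ[Q.prod P]
      fun w => diagProd ξ₁ ξ₂ x (w.1, w.2.translate (x - x')) := by
    intro x' hx'
    filter_upwards [Measure.quasiMeasurePreserving_snd.ae (hP.ae_free hd x')] with w hw
    rw [addFree_of_mem (hw _), scoreOn, if_pos hx', scoreOn, if_pos hx', hown₁, hown₂,
      hT₁ x' (x - x'), hT₂ x' (x - x'), add_sub_cancel, diagProd]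
  have hTr : ∀ x', MeasurePreserving (fun w : M × Config d M => (w.1, w.2.translate (x - x')))
      (Q.prod P) (Q.prod P) := fun x' =>
    (MeasurePreserving.id Q).prod (hP.measurePreserving_translate (x - x'))
  have hdm : Measurable (diagProd ξ₁ ξ₂ x) := h₁.measurable_score_at.mul h₂.measurable_score_at
  have key := integrable_and_integral_eq_of_fibre (μ := (volume : Measure (EuclideanSpace ℝ (Fin d))))
    (ν := Q.prod P)
    (h := fun z => scoreOn D ξ₁ (z.1, z.2.1) (z.2.2.addFree (z.1, z.2.1)) *
      scoreOn D ξ₂ (z.1, z.2.1) (z.2.2.addFree (z.1, z.2.1)))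
    (Ψ := fun _ => ∫ w, diagProd ξ₁ ξ₂ x w ∂(Q.prod P))
    (hmc.comp (measurePreserving_location_mark Q P).measurable) hD hDb.measure_lt_top.ne
    (h₁.integrable_diagProd h₂ hP).2.ne
    (Eventually.of_forall fun x' hx' => ?_) (Eventually.of_forall fun x' hx' => ?_)
    (fun x' hx' w => by simp [scoreOn, hx'])
  · obtain ⟨hi, he⟩ := key
    have := integrable_and_integral_prod_intensity Q P u hu hmc hi
    refine ⟨this.1, this.2.trans ?_⟩
    rw [he, setIntegral_const, smul_eq_mul]
  · refine (lintegral_congr_ae ((hfib x' hx').fun_comp enorm)).trans_le ?_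
    exact (lintegral_comp_measurePreserving (hTr x') (f := fun w => ‖diagProd ξ₁ ξ₂ x w‖ₑ)
      hdm.enorm.aemeasurable).le
  · refine (integral_congr_ae (hfib x' hx')).trans ?_
    exact integral_comp_measurePreserving (hTr x') hdm.aestronglyMeasurable

theorem lintegral_offDiagProd_le (h₁ : ControlledAt Q P ξ₁ x R K C c)
    (h₂ : ControlledAt Q P ξ₂ x R K C c) (hP : IsPoissonLaw (stationaryIntensity d Q u) P)
    (hd : d ≠ 0) (hK : 0 ≤ K) {y : EuclideanSpace ℝ (Fin d)} (hy : y ≠ 0) :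
    ∫⁻ w, ‖offDiagProd ξ₁ ξ₂ x y w‖ₑ ∂(Q.prod (Q.prod P)) ≤ ENNReal.ofReal (1 + K + K) := by
  have := hP.isProbabilityMeasure
  exact lintegral_enorm_mul_le hK
    (aestronglyMeasurable_score_add h₁.measurable_score hP hd x (x + y))
    (h₁.moment_add (x + y) (by simpa using hy))
    (aestronglyMeasurable_score_add_translate h₂.measurable_score hP hd x y)
    (h₂.lintegral_add_translate_le hP hd hy)

/-- For locations `a ≠ b`, translating the first score by `x - a` and the second by `x - b` brings
both to `x`. Relative to the process `S + (x - a)` this is exactly `offDiagProd` at `y = b - a`, and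
stationarity removes the shift. -/
theorem integrable_scoreOn_offDiag_and_integral (h₁ : ControlledAt Q P ξ₁ x R K C c)
    (h₂ : ControlledAt Q P ξ₂ x R K C c)
    (hP : IsPoissonLaw (stationaryIntensity d Q u) P) (hd : d ≠ 0) (hu : 0 ≤ u) (hK : 0 ≤ K)
    (hT₁ : TranslationInvariant ξ₁) (hown₁ : ∀ p S, ξ₁ p (S.add p) = ξ₁ p S)
    (hT₂ : TranslationInvariant ξ₂) (hown₂ : ∀ p S, ξ₂ p (S.add p) = ξ₂ p S)
    {D : Set (EuclideanSpace ℝ (Fin d))} (hD : MeasurableSet D) (hDb : Bornology.IsBounded D) :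
    Integrable (fun z : Config d M × Pt d M × Pt d M =>
        scoreOn D ξ₁ z.2.1 ((z.1.addFree z.2.2).addFree z.2.1) *
        scoreOn D ξ₂ z.2.2 ((z.1.addFree z.2.2).addFree z.2.1))
        (P.prod ((stationaryIntensity d Q u).prod (stationaryIntensity d Q u))) ∧
      ∫ z : Config d M × Pt d M × Pt d M,
        scoreOn D ξ₁ z.2.1 ((z.1.addFree z.2.2).addFree z.2.1) *
        scoreOn D ξ₂ z.2.2 ((z.1.addFree z.2.2).addFree z.2.1)
        ∂(P.prod ((stationaryIntensity d Q u).prod (stationaryIntensity d Q u))) =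
        u ^ 2 * ∫ z in D ×ˢ D, ∫ w, offDiagProd ξ₁ ξ₂ x (z.2 - z.1) w ∂(Q.prod (Q.prod P)) := by
  have := hP.isProbabilityMeasure
  have : Nonempty (Fin d) := ⟨⟨0, Nat.pos_of_ne_zero hd⟩⟩
  have hm2 : Measurable fun z : Config d M × Pt d M × Pt d M =>
      (z.1.addFree z.2.2).addFree z.2.1 := by
    have h1 : Measurable fun z : Config d M × Pt d M × Pt d M => z.1.addFree z.2.2 := by
      have := measurable_addFree.comp (g := fun z : Config d M × Pt d M => z.1.addFree z.2)
        (measurable_fst.prodMk (measurable_snd.comp measurable_snd) :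
          Measurable fun z : Config d M × Pt d M × Pt d M => (z.1, z.2.2))
      simpa only [Function.comp_def] using this
    have := measurable_addFree.comp (h1.prodMk (measurable_fst.comp measurable_snd))
    simpa only [Function.comp_def] using this
  have hmc : Measurable fun z : Config d M × Pt d M × Pt d M =>
      scoreOn D ξ₁ z.2.1 ((z.1.addFree z.2.2).addFree z.2.1) *
        scoreOn D ξ₂ z.2.2 ((z.1.addFree z.2.2).addFree z.2.1) := by
    have a1 := (measurable_scoreOn hD h₁.measurable_score).comp
      ((measurable_fst.comp measurable_snd).prodMk hm2)
    have a2 := (measurable_scoreOn hD h₂.measurable_score).comp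
      ((measurable_snd.comp measurable_snd).prodMk hm2)
    simpa only [Function.comp_def, Function.uncurry] using! a1.mul a2
  have hfib : ∀ p : EuclideanSpace ℝ (Fin d) × EuclideanSpace ℝ (Fin d), p ∈ D ×ˢ D →
      p.2 - p.1 ≠ 0 → (fun w : M × M × Config d M =>
      scoreOn D ξ₁ (p.1, w.1) ((w.2.2.addFree (p.2, w.2.1)).addFree (p.1, w.1)) *
        scoreOn D ξ₂ (p.2, w.2.1) ((w.2.2.addFree (p.2, w.2.1)).addFree (p.1, w.1)))
      =ᵐ[Q.prod (Q.prod P)]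
      fun w => offDiagProd ξ₁ ξ₂ x (p.2 - p.1) (w.1, w.2.1, w.2.2.translate (x - p.1)) := by
    rintro ⟨a, b⟩ ⟨ha, hb⟩ hne
    have hab : b ≠ a := fun h => hne (by simp [h])
    filter_upwards [hP.ae_prod_free hd a, hP.ae_prod_free hd b] with w hwa hwb
    simp only at ha hb
    simp only [addFree_of_mem (hwb _)]
    rw [addFree_of_mem (mem_freePairs_add (hwa w.1) (q := (b, w.2.1)) hab), scoreOn, if_pos ha,
      scoreOn, if_pos hb, hown₁, Config.add_comm, hown₂, offDiagProd, hT₁ a (x - a),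
      hT₂ b (x - b), Config.translate_add, add_sub_cancel, add_sub_cancel]
    simp only
    rw [Config.translate_add, Config.translate_add, Config.translate_translate]
    rw [show b + (x - a) = x + (b - a) by abel, show a + (x - b) = x + -(b - a) by abel,
      show x - b = x - a + -(b - a) by abel]
  have hTr : ∀ p, MeasurePreserving
      (fun w : M × M × Config d M => (w.1, w.2.1, w.2.2.translate (x - p)))
      (Q.prod (Q.prod P)) (Q.prod (Q.prod P)) := fun p =>
    (MeasurePreserving.id Q).prod ((MeasurePreserving.id Q).prod
      (hP.measurePreserving_translate (x - p)))
  have hdm : ∀ y, AEStronglyMeasurable (offDiagProd ξ₁ ξ₂ x y) (Q.prod (Q.prod P)) := fun y =>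
    (aestronglyMeasurable_score_add h₁.measurable_score hP hd x (x + y)).mul
      (aestronglyMeasurable_score_add_translate h₂.measurable_score hP hd x y)
  -- Coinciding locations form a null set; off it the moment bound with an added point at a
  -- different location is available.
  have hnd : ∀ᵐ p : EuclideanSpace ℝ (Fin d) × EuclideanSpace ℝ (Fin d)
      ∂(volume.prod volume), p.2 - p.1 ≠ 0 := by
    have hms : MeasurableSet {p : EuclideanSpace ℝ (Fin d) × EuclideanSpace ℝ (Fin d) |
        p.2 - p.1 ≠ 0} :=
      ((measurable_snd.sub measurable_fst) (measurableSet_singleton 0)).compl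
    refine (Measure.ae_prod_iff_ae_ae hms).2 (Eventually.of_forall fun a => ?_)
    filter_upwards [Measure.ae_ne volume a] with b hb
    exact sub_ne_zero.2 hb
  have key := integrable_and_integral_eq_of_fibre
    (μ := (volume : Measure (EuclideanSpace ℝ (Fin d))).prod
      (volume : Measure (EuclideanSpace ℝ (Fin d))))
    (ν := Q.prod (Q.prod P))
    (h := fun z => scoreOn D ξ₁ (z.1.1, z.2.1)
      ((z.2.2.2.addFree (z.1.2, z.2.2.1)).addFree (z.1.1, z.2.1)) *
        scoreOn D ξ₂ (z.1.2, z.2.2.1)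
      ((z.2.2.2.addFree (z.1.2, z.2.2.1)).addFree (z.1.1, z.2.1)))
    (Ψ := fun z => ∫ w, offDiagProd ξ₁ ξ₂ x (z.2 - z.1) w ∂(Q.prod (Q.prod P)))
    (hmc.comp (measurePreserving_locations_marks Q P).measurable) (hD.prod hD)
    (hDb.prod hDb).measure_lt_top.ne (L := ENNReal.ofReal (1 + K + K)) ENNReal.ofReal_ne_top
    (hnd.mono fun p hp hpD => ?_) (hnd.mono fun p hp hpD => ?_)
    (fun p hp w => by
      rw [mem_prod, not_and_or] at hp
      rcases hp with hp | hp <;> simp [scoreOn, hp])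
  · obtain ⟨hi, he⟩ := key
    have := integrable_and_integral_prod_intensity_prod Q P u hu hmc hi
    refine ⟨this.1, this.2.trans ?_⟩
    rw [he]
    rfl
  · refine (lintegral_congr_ae ((hfib p hpD hp).fun_comp enorm)).trans_le ?_
    exact (lintegral_comp_measurePreserving (hTr p.1)
      (f := fun w => ‖offDiagProd ξ₁ ξ₂ x (p.2 - p.1) w‖ₑ) (hdm _).enorm).le.trans
        (h₁.lintegral_offDiagProd_le h₂ hP hd hK hp)
  · refine (integral_congr_ae (hfib p hpD hp)).trans ?_
    exact integral_comp_measurePreserving (hTr p.1) (hdm _)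

theorem integral_scoreSum (h : ControlledAt Q P ξ x R K C c)
    (hP : IsPoissonLaw (stationaryIntensity d Q u) P) (hd : d ≠ 0) (hu : 0 ≤ u)
    (hT : TranslationInvariant ξ) (hown : ∀ p S, ξ p (S.add p) = ξ p S)
    {D : Set (EuclideanSpace ℝ (Fin d))} (hD : MeasurableSet D) (hDb : Bornology.IsBounded D) :
    ∫ S, scoreSum ξ D S ∂P = u * (volume.real D * ∫ w, ξ (x, w.1) w.2 ∂(Q.prod P)) := by
  have := hP.isProbabilityMeasure
  obtain ⟨hi, he⟩ := h.integrable_scoreOn_and_integral hP hd hu hT hown hD hDb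
  rw [← he, Measure.integral_compProd hi]
  exact integral_congr_ae (Eventually.of_forall fun S =>
    scoreSum_eq_integral h.measurable_score hD hDb S)

/-- The product of two sums is a double sum over points; the bivariate Mecke equation splits it into
coinciding and distinct pairs. -/
theorem integrable_scoreSum_mul_and_integral (h₁ : ControlledAt Q P ξ₁ x R K C c)
    (h₂ : ControlledAt Q P ξ₂ x R K C c)
    (hP : IsPoissonLaw (stationaryIntensity d Q u) P) (hd : d ≠ 0) (hu : 0 ≤ u) (hK : 0 ≤ K)
    (hT₁ : TranslationInvariant ξ₁) (hown₁ : ∀ p S, ξ₁ p (S.add p) = ξ₁ p S)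
    (hT₂ : TranslationInvariant ξ₂) (hown₂ : ∀ p S, ξ₂ p (S.add p) = ξ₂ p S)
    {D : Set (EuclideanSpace ℝ (Fin d))} (hD : MeasurableSet D) (hDb : Bornology.IsBounded D) :
    Integrable (fun S => scoreSum ξ₁ D S * scoreSum ξ₂ D S) P ∧
      ∫ S, scoreSum ξ₁ D S * scoreSum ξ₂ D S ∂P =
        u * (volume.real D * ∫ w, diagProd ξ₁ ξ₂ x w ∂(Q.prod P)) +
        u ^ 2 * ∫ z in D ×ˢ D, ∫ w, offDiagProd ξ₁ ξ₂ x (z.2 - z.1) w ∂(Q.prod (Q.prod P)) := by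
  have := hP.isProbabilityMeasure
  obtain ⟨hi1, he1⟩ := h₁.integrable_scoreOn_diag_and_integral h₂ hP hd hu hT₁ hown₁ hT₂ hown₂ hD hDb
  obtain ⟨hi2, he2⟩ :=
    h₁.integrable_scoreOn_offDiag_and_integral h₂ hP hd hu hK hT₁ hown₁ hT₂ hown₂ hD hDb
  have hF : Measurable fun z : Config d M × Pt d M × Pt d M =>
      scoreOn D ξ₁ z.2.1 z.1 * scoreOn D ξ₂ z.2.2 z.1 := by
    have a1 := (measurable_scoreOn hD h₁.measurable_score).comp
      ((measurable_fst.comp measurable_snd).prodMk measurable_fst :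
        Measurable fun z : Config d M × Pt d M × Pt d M => (z.2.1, z.1))
    have a2 := (measurable_scoreOn hD h₂.measurable_score).comp
      ((measurable_snd.comp measurable_snd).prodMk measurable_fst :
        Measurable fun z : Config d M × Pt d M × Pt d M => (z.2.2, z.1))
    exact a1.mul a2
  have hm1 : Measurable fun z : Config d M × Pt d M => (z.1.addFree z.2, z.2, z.2) :=
    measurable_addFree.prodMk (measurable_snd.prodMk measurable_snd)
  have hm2 : Measurable fun z : Config d M × Pt d M × Pt d M =>
      ((z.1.addFree z.2.2).addFree z.2.1, z.2.1, z.2.2) := by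
    have h1 : Measurable fun z : Config d M × Pt d M × Pt d M => z.1.addFree z.2.2 := by
      have := measurable_addFree.comp (g := fun z : Config d M × Pt d M => z.1.addFree z.2)
        (measurable_fst.prodMk (measurable_snd.comp measurable_snd) :
          Measurable fun z : Config d M × Pt d M × Pt d M => (z.1, z.2.2))
      simpa only [Function.comp_def] using this
    have := measurable_addFree.comp (h1.prodMk (measurable_fst.comp measurable_snd))
    exact (by simpa only [Function.comp_def] using this : Measurable _).prodMk measurable_snd
  have hsum : ∀ S, ∫ q, scoreOn D ξ₁ q.1 S * scoreOn D ξ₂ q.2 S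
      ∂((pointKernel d M ×ₖ pointKernel d M) S) = scoreSum ξ₁ D S * scoreSum ξ₂ D S := by
    intro S
    rw [Kernel.prod_apply, integral_prod_mul (fun q => scoreOn D ξ₁ q S)
      (fun q => scoreOn D ξ₂ q S), scoreSum_eq_integral h₁.measurable_score hD hDb,
      scoreSum_eq_integral h₂.measurable_score hD hDb, pointKernel_apply]
  have i1 := (integrable_map_measure (f := fun z : Config d M × Pt d M =>
    (z.1.addFree z.2, z.2, z.2)) hF.aestronglyMeasurable hm1.aemeasurable).2 hi1
  have i2 := (integrable_map_measure (f := fun z : Config d M × Pt d M × Pt d M =>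
      ((z.1.addFree z.2.2).addFree z.2.1, z.2.1, z.2.2)) hF.aestronglyMeasurable
      hm2.aemeasurable).2 hi2
  have hi := i1.add_measure i2
  have he := integral_add_measure i1 i2
  rw [integral_map hm1.aemeasurable hF.aestronglyMeasurable,
    integral_map hm2.aemeasurable hF.aestronglyMeasurable, he1, he2] at he
  rw [← hP.compProd_pointKernel_prod (stationaryIntensity_shell_ne_top Q u)
    (stationaryIntensity_fst_singleton Q u hd)] at hi he
  have hi' : Integrable (fun S => ∫ q, scoreOn D ξ₁ q.1 S * scoreOn D ξ₂ q.2 S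
      ∂((pointKernel d M ×ₖ pointKernel d M) S)) P :=
    Integrable.integral_compProd (κ := Kernel.const Unit P) (a := ()) hi
  have he' := Measure.integral_compProd hi
  simp only [hsum] at hi' he'
  exact ⟨hi', he'.symm.trans he⟩

end ControlledAt

end StabScore

end

/-! ### Integrability of the pair covariance and the covariance formula on bounded sets. -/

noncomputable section

namespace StabScore

open Config

/-- The known value of the Gaussian integral is positive, whereas the integral of a nonintegrable
function is `0` by convention. -/
theorem integrable_exp_neg_mul_sq_norm {V : Type*} [NormedAddCommGroup V] [InnerProductSpace ℝ V]
    [FiniteDimensional ℝ V] [MeasurableSpace V] [BorelSpace V] {b : ℝ} (hb : 0 < b) :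
    Integrable fun v : V => Real.exp (-b * ‖v‖ ^ 2) := by
  by_contra H
  have h1 := GaussianFourier.integral_rexp_neg_mul_sq_norm (V := V) hb
  rw [integral_undef H] at h1
  have : 0 < (Real.pi / b) ^ (Module.finrank ℝ V / 2 : ℝ) := by positivity
  linarith

variable {d : ℕ} {M : Type*} [MeasurableSpace M]

section Measurability

variable (Q : Measure M) (P : Measure (Config d M)) (ξ₁ ξ₂ : Score d M)

/-- A measurable version of `offDiagProd`. -/
def offDiagProdFree (x y : EuclideanSpace ℝ (Fin d)) (w : M × M × Config d M) : ℝ :=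
  ξ₁ (x, w.1) (w.2.2.addFree (x + y, w.2.1)) *
    ξ₂ (x, w.2.1) ((w.2.2.addFree (x, w.1)).translate (-y))

/-- A measurable version of `pairCov`. -/
def pairCovFree (x y : EuclideanSpace ℝ (Fin d)) : ℝ :=
  ∫ w, offDiagProdFree ξ₁ ξ₂ x y w ∂(Q.prod (Q.prod P)) -
    (∫ w, ξ₁ (x, w.1) w.2 ∂(Q.prod P)) * ∫ w, ξ₂ (x, w.1) (w.2.translate (-y)) ∂(Q.prod P)

variable {Q P ξ₁ ξ₂} [IsProbabilityMeasure Q]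

theorem IsPoissonLaw.pairCov_eq {u : ℝ} (hP : IsPoissonLaw (stationaryIntensity d Q u) P)
    (hd : d ≠ 0) (x y : EuclideanSpace ℝ (Fin d)) :
    pairCov Q P ξ₁ ξ₂ x y = pairCovFree Q P ξ₁ ξ₂ x y := by
  rw [pairCov, pairCovFree]
  congr 1
  refine integral_congr_ae ?_
  filter_upwards [hP.ae_prod_free hd x, hP.ae_prod_free hd (x + y)] with w h1 h2
  rw [offDiagProd, offDiagProdFree, addFree_of_mem (h1 _), addFree_of_mem (h2 _)]

theorem measurable_offDiagProdFree (hξ₁ : Measurable (Function.uncurry ξ₁))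
    (hξ₂ : Measurable (Function.uncurry ξ₂)) :
    Measurable fun z : (EuclideanSpace ℝ (Fin d) × EuclideanSpace ℝ (Fin d)) × M × M × Config d M =>
      offDiagProdFree ξ₁ ξ₂ z.1.1 z.1.2 z.2 := by
  have h1 := measurable_score_addFree hξ₁
    (f := fun z : (EuclideanSpace ℝ (Fin d) × EuclideanSpace ℝ (Fin d)) × M × M × Config d M =>
      (z.1.1, z.2.1)) (g := fun z => (z.1.1 + z.1.2, z.2.2.1)) (S := fun z => z.2.2.2)
    (by fun_prop) (by fun_prop) (by fun_prop)
  have h2 : Measurable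
      fun z : (EuclideanSpace ℝ (Fin d) × EuclideanSpace ℝ (Fin d)) × M × M × Config d M =>
      z.2.2.2.addFree (z.1.1, z.2.1) := by
    have h : Measurable
      fun z : (EuclideanSpace ℝ (Fin d) × EuclideanSpace ℝ (Fin d)) × M × M × Config d M =>
      (z.2.2.2, (z.1.1, z.2.1)) := by fun_prop
    have := measurable_addFree.comp h
    simpa only [Function.comp_def] using this
  have h3 : Measurable
      fun z : (EuclideanSpace ℝ (Fin d) × EuclideanSpace ℝ (Fin d)) × M × M × Config d M =>
      (z.2.2.2.addFree (z.1.1, z.2.1)).translate (-z.1.2) := by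
    have h : Measurable
      fun z : (EuclideanSpace ℝ (Fin d) × EuclideanSpace ℝ (Fin d)) × M × M × Config d M =>
      -z.1.2 := by fun_prop
    have := measurable_translate.comp (h2.prodMk h)
    simpa only [Function.comp_def] using this
  have h4 : Measurable
      fun z : (EuclideanSpace ℝ (Fin d) × EuclideanSpace ℝ (Fin d)) × M × M × Config d M =>
      ((z.1.1, z.2.2.1) : Pt d M) := by fun_prop
  have h5 := hξ₂.comp (h4.prodMk h3)
  simp only [Function.comp_def, Function.uncurry] at h5
  exact h1.mul h5

theorem stronglyMeasurable_integral_kernel {X : Type*} [MeasurableSpace X]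
    {η : Kernel X (Config d M)} [IsSFiniteKernel η] {F : X → M × Config d M → ℝ}
    (hF : Measurable (Function.uncurry F)) :
    StronglyMeasurable fun x => ∫ w, F x w ∂(Q.prod (η x)) := by
  have := StronglyMeasurable.integral_kernel_prod_right (κ := Kernel.const X Q ×ₖ η) (f := F)
    hF.stronglyMeasurable
  simpa only [Kernel.prod_apply, Kernel.const_apply] using this

/-- The law may vary with `x` through a kernel. This is needed when the intensity is the local
density `g x` and `pairCov` is integrated over `y` and then over `x`. -/
theorem stronglyMeasurable_pairCovFree (hξ₁ : Measurable (Function.uncurry ξ₁))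
    (hξ₂ : Measurable (Function.uncurry ξ₂))
    (η : Kernel (EuclideanSpace ℝ (Fin d)) (Config d M)) [IsSFiniteKernel η] :
    StronglyMeasurable fun z : EuclideanSpace ℝ (Fin d) × EuclideanSpace ℝ (Fin d) =>
      pairCovFree Q (η z.1) ξ₁ ξ₂ z.1 z.2 := by
  let η' : Kernel (EuclideanSpace ℝ (Fin d) × EuclideanSpace ℝ (Fin d)) (Config d M) :=
    η.comap Prod.fst measurable_fst
  have h1 := StronglyMeasurable.integral_kernel_prod_right
    (κ := Kernel.const _ Q ×ₖ (Kernel.const _ Q ×ₖ η'))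
    (f := fun z w => offDiagProdFree ξ₁ ξ₂ z.1 z.2 w)
    (measurable_offDiagProdFree hξ₁ hξ₂).stronglyMeasurable
  simp only [Kernel.prod_apply, Kernel.const_apply, η', Kernel.comap_apply] at h1
  have h2 := stronglyMeasurable_integral_kernel (Q := Q) (η := η')
    (F := fun z w => ξ₁ (z.1, w.1) w.2)
    (hξ₁.comp (f := fun z : (EuclideanSpace ℝ (Fin d) × EuclideanSpace ℝ (Fin d)) × M × Config d M =>
      ((z.1.1, z.2.1), z.2.2)) (by fun_prop))
  have h3 : Measurable
      fun z : (EuclideanSpace ℝ (Fin d) × EuclideanSpace ℝ (Fin d)) × M × Config d M =>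
      z.2.2.translate (-z.1.2) := by
    have h : Measurable
      fun z : (EuclideanSpace ℝ (Fin d) × EuclideanSpace ℝ (Fin d)) × M × Config d M =>
      (z.2.2, -z.1.2) := by fun_prop
    have := measurable_translate.comp h
    simpa only [Function.comp_def] using this
  have h4 : Measurable
      fun z : (EuclideanSpace ℝ (Fin d) × EuclideanSpace ℝ (Fin d)) × M × Config d M =>
      ((z.1.1, z.2.1) : Pt d M) := by fun_prop
  have h5 := stronglyMeasurable_integral_kernel (Q := Q) (η := η')
    (F := fun z w => ξ₂ (z.1, w.1) (w.2.translate (-z.2)))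
    (hξ₂.comp (h4.prodMk h3))
  exact h1.sub (h2.mul h5)

theorem stronglyMeasurable_pairCovFree_right [IsProbabilityMeasure P]
    (hξ₁ : Measurable (Function.uncurry ξ₁)) (hξ₂ : Measurable (Function.uncurry ξ₂))
    (x : EuclideanSpace ℝ (Fin d)) : StronglyMeasurable (pairCovFree Q P ξ₁ ξ₂ x) :=
  (stronglyMeasurable_pairCovFree (Q := Q) hξ₁ hξ₂ (Kernel.const _ P)).comp_measurable
    measurable_prodMk_left

end Measurability

namespace ControlledAt

variable {Q : Measure M} {P : Measure (Config d M)} {ξ ξ₁ ξ₂ : Score d M}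
  {x : EuclideanSpace ℝ (Fin d)} {R : M → Config d M → ℝ≥0} {K C c : ℝ}
  [IsProbabilityMeasure Q] {u : ℝ}

theorem integrable_pairCov (h₁ : ControlledAt Q P ξ₁ x R K C c)
    (h₂ : ControlledAt Q P ξ₂ x R K C c) (hP : IsPoissonLaw (stationaryIntensity d Q u) P)
    (hd : 2 ≤ d) (hK : 0 ≤ K) (hC : 0 ≤ C) (hc : 0 < c) :
    Integrable (pairCov Q P ξ₁ ξ₂ x) := by
  have := hP.isProbabilityMeasure
  have hd0 : d ≠ 0 := by omega
  have : Nonempty (Fin d) := ⟨⟨0, by omega⟩⟩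
  refine Integrable.mono' ((integrable_exp_neg_mul_sq_norm (b := c / 18) (by positivity)).mul_const
    (K + C * Real.exp c + (1 + K) * (1 + K + C * Real.exp c))) ?_ ?_
  · rw [show pairCov Q P ξ₁ ξ₂ x = pairCovFree Q P ξ₁ ξ₂ x from
      funext fun y => hP.pairCov_eq hd0 x y]
    exact (stronglyMeasurable_pairCovFree_right h₁.measurable_score h₂.measurable_score
      x).aestronglyMeasurable
  · filter_upwards [Measure.ae_ne volume 0] with y hy
    exact h₁.abs_pairCov_le h₂ hP hd hK hC hc.le hy

end ControlledAt

section Overlap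

/-- The volume of the intersection of `D` with its translate. -/
def overlap (D : Set (EuclideanSpace ℝ (Fin d))) (y : EuclideanSpace ℝ (Fin d)) : ℝ :=
  volume.real (D ∩ (fun a => a + y) ⁻¹' D)

/-- The shear `(a, b) ↦ (a, b - a)` preserves volume. For fixed difference `y`, the admissible `a`
are those with `a` and `a + y` in `D`. -/
theorem integrableOn_comp_sub_and_setIntegral {D : Set (EuclideanSpace ℝ (Fin d))}
    (hD : MeasurableSet D) (hDb : Bornology.IsBounded D) {p : EuclideanSpace ℝ (Fin d) → ℝ}
    (hp : Integrable p) :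
    IntegrableOn (fun z : EuclideanSpace ℝ (Fin d) × EuclideanSpace ℝ (Fin d) => p (z.2 - z.1))
      (D ×ˢ D) ∧
      ∫ z in D ×ˢ D, p (z.2 - z.1) = ∫ y, p y * overlap D y := by
  classical
  let H : EuclideanSpace ℝ (Fin d) × EuclideanSpace ℝ (Fin d) → ℝ :=
    {z : EuclideanSpace ℝ (Fin d) × EuclideanSpace ℝ (Fin d) | z.1 ∈ D ∧ z.1 + z.2 ∈ D}.indicator
      fun z => p z.2
  have hS : MeasurableSet {z : EuclideanSpace ℝ (Fin d) × EuclideanSpace ℝ (Fin d) |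
      z.1 ∈ D ∧ z.1 + z.2 ∈ D} :=
    (measurable_fst hD).inter ((measurable_fst.add measurable_snd) hD)
  have hHi : Integrable H (volume.prod volume) := by
    have h1 : Integrable (fun z : EuclideanSpace ℝ (Fin d) × EuclideanSpace ℝ (Fin d) =>
        D.indicator (fun _ => (1 : ℝ)) z.1 * p z.2) (volume.prod volume) :=
      ((integrable_indicator_iff hD).2
        (integrableOn_const hDb.measure_lt_top.ne)).mul_prod hp
    refine (h1.indicator hS).congr (Eventually.of_forall fun z => ?_)
    by_cases hz : z.1 ∈ D ∧ z.1 + z.2 ∈ D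
    · simp [H, indicator, hz.1]
    · simp [H, indicator, hz]
  have hT := measurePreserving_prod_neg_add (volume : Measure (EuclideanSpace ℝ (Fin d)))
    (volume : Measure (EuclideanSpace ℝ (Fin d)))
  have hHT : (fun z : EuclideanSpace ℝ (Fin d) × EuclideanSpace ℝ (Fin d) => H (z.1, -z.1 + z.2)) =
      (D ×ˢ D).indicator fun z => p (z.2 - z.1) := by
    ext z
    simp only [H, indicator_apply]
    exact if_congr (by simp [mem_prod]) (by simp [neg_add_eq_sub]) rfl
  constructor
  · rw [← integrable_indicator_iff (hD.prod hD), ← hHT]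
    exact hT.integrable_comp_of_integrable hHi
  · rw [← integral_indicator (hD.prod hD), ← hHT]
    refine (integral_comp_measurePreserving hT hHi.aestronglyMeasurable).trans ?_
    rw [integral_prod_symm _ hHi]
    refine integral_congr_ae (Eventually.of_forall fun y => ?_)
    have : ∀ a, H (a, y) = (D ∩ (fun a => a + y) ⁻¹' D).indicator (fun _ => p y) a := fun a => by
      simp only [H, indicator_apply]
      exact if_congr Iff.rfl rfl rfl
    simp only [this]
    rw [integral_indicator (hD.inter (measurable_add_const y hD)), setIntegral_const,
      smul_eq_mul, mul_comm, overlap]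

end Overlap

namespace ControlledAt

variable {Q : Measure M} {P : Measure (Config d M)} {ξ ξ₁ ξ₂ : Score d M}
  {x : EuclideanSpace ℝ (Fin d)} {R : M → Config d M → ℝ≥0} {K C c : ℝ}
  [IsProbabilityMeasure Q] {u : ℝ}

/-- The second moment contributes the uncentred pair expectation. Centring it to `pairCov` leaves
`u² |D|²` times the product of the mean scores, which is the product of the means of the two sums
and cancels in the covariance. -/
theorem covariance_scoreSum (h₁ : ControlledAt Q P ξ₁ x R K C c)
    (h₂ : ControlledAt Q P ξ₂ x R K C c)
    (hP : IsPoissonLaw (stationaryIntensity d Q u) P) (hd : 2 ≤ d) (hu : 0 ≤ u) (hK : 0 ≤ K)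
    (hC : 0 ≤ C) (hc : 0 < c)
    (hT₁ : TranslationInvariant ξ₁) (hown₁ : ∀ p S, ξ₁ p (S.add p) = ξ₁ p S)
    (hT₂ : TranslationInvariant ξ₂) (hown₂ : ∀ p S, ξ₂ p (S.add p) = ξ₂ p S)
    {D : Set (EuclideanSpace ℝ (Fin d))} (hD : MeasurableSet D) (hDb : Bornology.IsBounded D) :
    covariance (scoreSum ξ₁ D) (scoreSum ξ₂ D) P =
      u * (volume.real D * ∫ w, diagProd ξ₁ ξ₂ x w ∂(Q.prod P)) +
        u ^ 2 * ∫ y, pairCov Q P ξ₁ ξ₂ x y * overlap D y := by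
  have := hP.isProbabilityMeasure
  have hd0 : d ≠ 0 := by omega
  have hL : ∀ {ξ : Score d M}, ControlledAt Q P ξ x R K C c → TranslationInvariant ξ →
      (∀ p S, ξ p (S.add p) = ξ p S) → MemLp (scoreSum ξ D) 2 P := by
    intro ξ h hT hown
    rw [memLp_two_iff_integrable_sq
      (measurable_scoreSum h.measurable_score hD hDb).aestronglyMeasurable]
    simpa only [sq] using
      (h.integrable_scoreSum_mul_and_integral h hP hd0 hu hK hT hown hT hown hD hDb).1
  rw [covariance_eq_sub (hL h₁ hT₁ hown₁) (hL h₂ hT₂ hown₂)]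
  have e := (h₁.integrable_scoreSum_mul_and_integral h₂ hP hd0 hu hK hT₁ hown₁ hT₂ hown₂ hD hDb).2
  simp only [Pi.mul_apply]
  rw [e, h₁.integral_scoreSum hP hd0 hu hT₁ hown₁ hD hDb,
    h₂.integral_scoreSum hP hd0 hu hT₂ hown₂ hD hDb]
  obtain ⟨hi, hs⟩ := integrableOn_comp_sub_and_setIntegral hD hDb
    (h₁.integrable_pairCov h₂ hP hd hK hC hc)
  have hO : ∫ z in D ×ˢ D, ∫ w, offDiagProd ξ₁ ξ₂ x (z.2 - z.1) w ∂(Q.prod (Q.prod P)) =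
      (∫ y, pairCov Q P ξ₁ ξ₂ x y * overlap D y) +
        volume.real D * volume.real D * ((∫ w, ξ₁ (x, w.1) w.2 ∂(Q.prod P)) *
          ∫ w, ξ₂ (x, w.1) w.2 ∂(Q.prod P)) := by
    have h1 : ∀ z : EuclideanSpace ℝ (Fin d) × EuclideanSpace ℝ (Fin d),
        ∫ w, offDiagProd ξ₁ ξ₂ x (z.2 - z.1) w ∂(Q.prod (Q.prod P)) =
        pairCov Q P ξ₁ ξ₂ x (z.2 - z.1) + (∫ w, ξ₁ (x, w.1) w.2 ∂(Q.prod P)) *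
          ∫ w, ξ₂ (x, w.1) w.2 ∂(Q.prod P) := fun z => by
      rw [pairCov, h₂.integral_translate hP]
      ring
    simp only [h1]
    rw [integral_add hi (integrableOn_const (hDb.prod hDb).measure_lt_top.ne), hs,
      setIntegral_const, smul_eq_mul]
    congr 2
    rw [measureReal_def, Measure.volume_eq_prod, Measure.prod_prod, ENNReal.toReal_mul]
    rfl
  rw [hO]
  ring

end ControlledAt

end StabScore

end

/-! ### Scaling and the limit of the normalized covariances. -/

noncomputable section

namespace StabScore

open Config

variable {d : ℕ} {M : Type*}

theorem Config.translate_dilateAbout (S : Config d M) (x : EuclideanSpace ℝ (Fin d)) {a : ℝ}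
    (ha : a ≠ 0) : (S.dilateAbout x a).translate (a • x - x) = S.dilateAbout 0 a := by
  ext1
  rw [carrier_translate, carrier_dilateAbout _ _ ha, carrier_dilateAbout _ _ ha, image_image]
  refine image_congr fun q _ => Prod.ext ?_ rfl
  simp only [smul_sub]
  abel_nf
  simp

/-- Each scaled score dilates about its own point; by translation invariance all these dilations can
be replaced by the single dilation about the origin, with the set dilated as well. -/
theorem scoreSum_scaledScore {ξ : Score d M} (hT : TranslationInvariant ξ) {s : ℝ} (hs : 0 < s)
    (A : Set (EuclideanSpace ℝ (Fin d))) (S : Config d M) :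
    scoreSum (scaledScore ξ s) A S =
      scoreSum ξ ((fun z => (s ^ (1 / (d : ℝ)))⁻¹ • z) ⁻¹' A)
        (S.dilateAbout 0 (s ^ (1 / (d : ℝ)))) := by
  have ha : s ^ (1 / (d : ℝ)) ≠ 0 := (Real.rpow_pos_of_pos hs _).ne'
  set a := s ^ (1 / (d : ℝ)) with hadef
  have hinj : Function.Injective (fun q : Pt d M => (a • q.1, q.2)) := fun p q hpq =>
    Prod.ext (smul_right_injective _ ha (Prod.ext_iff.1 hpq).1) (Prod.ext_iff.1 hpq).2
  have himg : (S.dilateAbout 0 a).carrier ∩ Prod.fst ⁻¹' ((fun z => a⁻¹ • z) ⁻¹' A) =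
      (fun q : Pt d M => (a • q.1, q.2)) '' (S.carrier ∩ Prod.fst ⁻¹' A) := by
    rw [carrier_dilateAbout _ _ ha]
    ext p
    constructor
    · rintro ⟨⟨q, hq, rfl⟩, hp⟩
      refine ⟨q, ⟨hq, ?_⟩, by simp⟩
      simpa [smul_smul, inv_mul_cancel₀ ha] using hp
    · rintro ⟨q, ⟨hq, hqA⟩, rfl⟩
      refine ⟨⟨q, hq, by simp⟩, ?_⟩
      simpa [smul_smul, inv_mul_cancel₀ ha] using hqA
  rw [scoreSum, scoreSum, himg, finsum_mem_image hinj.injOn]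
  refine finsum_mem_congr rfl fun q _ => ?_
  rw [scaledScore, ← hadef, ← S.translate_dilateAbout q.1 ha]
  have := hT q.1 (a • q.1 - q.1) q.2 (S.dilateAbout q.1 a)
  rwa [add_sub_cancel] at this

section Overlap

theorem measurable_overlap {D : Set (EuclideanSpace ℝ (Fin d))} (hD : MeasurableSet D) :
    Measurable (overlap D) := by
  have hS : MeasurableSet {z : EuclideanSpace ℝ (Fin d) × EuclideanSpace ℝ (Fin d) |
      z.1 ∈ D ∧ z.1 + z.2 ∈ D} :=
    (measurable_fst hD).inter ((measurable_fst.add measurable_snd) hD)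
  exact (measurable_measure_prodMk_right (μ := volume) hS).ennreal_toReal

theorem overlap_le {D : Set (EuclideanSpace ℝ (Fin d))} (hDb : Bornology.IsBounded D)
    (y : EuclideanSpace ℝ (Fin d)) : overlap D y ≤ volume.real D :=
  measureReal_mono inter_subset_left hDb.measure_lt_top.ne

theorem volume_real_preimage_smul_inv {a : ℝ} (ha : 0 < a) (D : Set (EuclideanSpace ℝ (Fin d))) :
    volume.real ((fun z => a⁻¹ • z) ⁻¹' D) = a ^ d * volume.real D := by
  rw [measureReal_def, Measure.addHaar_preimage_smul _ (inv_ne_zero ha.ne'), ENNReal.toReal_mul,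
    ENNReal.toReal_ofReal (abs_nonneg _), finrank_euclideanSpace_fin, inv_pow, inv_inv,
    abs_of_pos (by positivity), measureReal_def]

theorem overlap_preimage_smul_inv {a : ℝ} (ha : 0 < a) (D : Set (EuclideanSpace ℝ (Fin d)))
    (y : EuclideanSpace ℝ (Fin d)) :
    overlap ((fun z => a⁻¹ • z) ⁻¹' D) y = a ^ d * overlap D (a⁻¹ • y) := by
  rw [overlap, overlap, ← volume_real_preimage_smul_inv ha]
  congr 1
  ext z
  simp [smul_add]

/-- The defect `|D| - overlap D y` is at most the volume of the symmetric difference of `D` and its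
translate, and translation is continuous in measure. -/
theorem tendsto_overlap_zero {D : Set (EuclideanSpace ℝ (Fin d))} (hD : MeasurableSet D)
    (hDb : Bornology.IsBounded D) : Tendsto (overlap D) (𝓝 0) (𝓝 (volume.real D)) := by
  let F : C(EuclideanSpace ℝ (Fin d) × EuclideanSpace ℝ (Fin d), EuclideanSpace ℝ (Fin d)) :=
    ⟨fun p => p.2 + p.1, by fun_prop⟩
  have h1 := tendsto_measure_symmDiff_preimage_nhds_zero (μ := volume) (ν := volume)
    (F.curry.continuous.tendsto 0)
    (Eventually.of_forall fun y => measurePreserving_add_right volume y)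
    (measurePreserving_add_right volume 0) hD.nullMeasurableSet hDb.measure_lt_top.ne
  have h2 := (ENNReal.tendsto_toReal ENNReal.zero_ne_top).comp h1
  have h3 : Tendsto (fun y => volume.real D - overlap D y) (𝓝 0) (𝓝 0) := by
    refine squeeze_zero (fun y => sub_nonneg.2 (overlap_le hDb y)) (fun y => ?_) h2
    have hm : MeasurableSet ((fun a => a + y) ⁻¹' D) := measurable_add_const y hD
    rw [overlap, sub_le_iff_le_add', ← measureReal_inter_add_sdiff (s := D) hm hDb.measure_lt_top.ne]
    gcongr
    refine ENNReal.toReal_mono ?_ (measure_mono ?_)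
    · refine ((measure_mono symmDiff_subset_union).trans_lt
        ((measure_union_le _ _).trans_lt (ENNReal.add_lt_top.2 ⟨?_, ?_⟩))).ne
      · exact ((measurePreserving_add_right volume y).measure_preimage
          hD.nullMeasurableSet).trans_lt hDb.measure_lt_top
      · exact ((measurePreserving_add_right volume 0).measure_preimage
          hD.nullMeasurableSet).trans_lt hDb.measure_lt_top
    · rintro z ⟨hz, hz'⟩
      exact Or.inr ⟨by simpa [F] using hz, hz'⟩
  simpa using h3.const_sub (volume.real D)

end Overlap

variable [MeasurableSpace M]

/-- The limit of the normalized covariances of score sums per unit volume. -/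
def covDensity (Q : Measure M) (P : Measure (Config d M)) (ξ₁ ξ₂ : Score d M)
    (x : EuclideanSpace ℝ (Fin d)) (u : ℝ) : ℝ :=
  u * (∫ w, diagProd ξ₁ ξ₂ x w ∂(Q.prod P)) + u ^ 2 * ∫ y, pairCov Q P ξ₁ ξ₂ x y

namespace ControlledAt

variable {Q : Measure M} {P : Measure (Config d M)} {ξ ξ₁ ξ₂ : Score d M}
  {x : EuclideanSpace ℝ (Fin d)} {R : M → Config d M → ℝ≥0} {K C c : ℝ}
  [IsProbabilityMeasure Q] {u : ℝ}

/-- Dilation carries intensity `s u` to `u` and multiplies volumes by `s`, which cancels the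
normalization `1/√s · 1/√s`. The only remaining trace of `s` is the argument of the overlap. -/
theorem covariance_scaled (h₁ : ControlledAt Q P ξ₁ x R K C c)
    (h₂ : ControlledAt Q P ξ₂ x R K C c)
    (hP : IsPoissonLaw (stationaryIntensity d Q u) P) (hd : 2 ≤ d) (hu : 0 ≤ u) (hK : 0 ≤ K)
    (hC : 0 ≤ C) (hc : 0 < c)
    (hT₁ : TranslationInvariant ξ₁) (hown₁ : ∀ p S, ξ₁ p (S.add p) = ξ₁ p S)
    (hT₂ : TranslationInvariant ξ₂) (hown₂ : ∀ p S, ξ₂ p (S.add p) = ξ₂ p S)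
    {A : Set (EuclideanSpace ℝ (Fin d))} (hA : MeasurableSet A) (hAb : Bornology.IsBounded A)
    {s : ℝ} (hs : 0 < s) {P' : Measure (Config d M)}
    (hP' : IsPoissonLaw (stationaryIntensity d Q (s * u)) P') :
    covariance (fun S => 1 / √s * scoreSum (scaledScore ξ₁ s) A S)
      (fun S => 1 / √s * scoreSum (scaledScore ξ₂ s) A S) P' =
      u * (volume.real A * ∫ w, diagProd ξ₁ ξ₂ x w ∂(Q.prod P)) +
        u ^ 2 * ∫ y, pairCov Q P ξ₁ ξ₂ x y * overlap A ((s ^ (1 / (d : ℝ)))⁻¹ • y) := by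
  have hd0 : d ≠ 0 := by omega
  have ha : 0 < s ^ (1 / (d : ℝ)) := Real.rpow_pos_of_pos hs _
  have had : (s ^ (1 / (d : ℝ))) ^ d = s := by
    rw [one_div, Real.rpow_inv_natCast_pow hs.le hd0]
  have hmp := IsPoissonLaw.measurePreserving_dilate hs hd0 hP' hP
  simp only [scoreSum_scaledScore hT₁ hs, scoreSum_scaledScore hT₂ hs]
  set a := s ^ (1 / (d : ℝ)) with hadef
  have hD : MeasurableSet ((fun z => a⁻¹ • z) ⁻¹' A) := measurable_const_smul a⁻¹ hA
  have hDb : Bornology.IsBounded ((fun z : EuclideanSpace ℝ (Fin d) => a⁻¹ • z) ⁻¹' A) := by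
    obtain ⟨r, hr⟩ := hAb.exists_norm_le
    refine isBounded_iff_forall_norm_le.2 ⟨a * r, fun z hz => ?_⟩
    have := hr _ hz
    rw [norm_smul, norm_inv, Real.norm_of_nonneg ha.le] at this
    rwa [inv_mul_le_iff₀ ha] at this
  have hm₁ := measurable_scoreSum h₁.measurable_score hD hDb
  have hm₂ := measurable_scoreSum h₂.measurable_score hD hDb
  have hcov := covariance_map_fun (μ := P') (Z := fun S => S.dilateAbout 0 a)
    hm₁.aestronglyMeasurable hm₂.aestronglyMeasurable hmp.aemeasurable
  rw [hmp.map_eq, h₁.covariance_scoreSum h₂ hP hd hu hK hC hc hT₁ hown₁ hT₂ hown₂ hD hDb,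
    volume_real_preimage_smul_inv ha, had] at hcov
  rw [covariance_const_mul_left, covariance_const_mul_right, ← hcov]
  simp only [overlap_preimage_smul_inv ha, had, mul_left_comm _ s]
  rw [integral_const_mul]
  have hsq : √s * √s = s := Real.mul_self_sqrt hs.le
  have hs0 : √s ≠ 0 := (Real.sqrt_pos.2 hs).ne'
  have : 1 / √s * (1 / √s) * s = 1 := by
    rw [one_div_mul_one_div, hsq, one_div_mul_cancel hs.ne']
  linear_combination (u * (volume.real A * ∫ w, diagProd ξ₁ ξ₂ x w ∂(Q.prod P)) +
        u ^ 2 * ∫ y, pairCov Q P ξ₁ ξ₂ x y * overlap A (a⁻¹ • y)) * this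

/-- The overlap is bounded by `|A|` and tends to it as its argument shrinks to `0`, so the
integrable function `‖pairCov‖ |A|` dominates. -/
theorem tendsto_covariance_scaled (h₁ : ControlledAt Q P ξ₁ x R K C c)
    (h₂ : ControlledAt Q P ξ₂ x R K C c)
    (hP : IsPoissonLaw (stationaryIntensity d Q u) P) (hd : 2 ≤ d) (hu : 0 < u) (hK : 0 ≤ K)
    (hC : 0 ≤ C) (hc : 0 < c)
    (hT₁ : TranslationInvariant ξ₁) (hown₁ : ∀ p S, ξ₁ p (S.add p) = ξ₁ p S)
    (hT₂ : TranslationInvariant ξ₂) (hown₂ : ∀ p S, ξ₂ p (S.add p) = ξ₂ p S)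
    {A : Set (EuclideanSpace ℝ (Fin d))} (hA : MeasurableSet A) (hAb : Bornology.IsBounded A)
    {Pst : ℝ → Measure (Config d M)}
    (hPst : ∀ u, 0 < u → IsPoissonLaw (stationaryIntensity d Q u) (Pst u)) :
    Tendsto (fun s : ℝ => covariance (fun S => 1 / √s * scoreSum (scaledScore ξ₁ s) A S)
      (fun S => 1 / √s * scoreSum (scaledScore ξ₂ s) A S) (Pst (s * u))) atTop
      (𝓝 (volume.real A * covDensity Q P ξ₁ ξ₂ x u)) := by
  have hd0 : d ≠ 0 := by omega
  have hp := h₁.integrable_pairCov h₂ hP hd hK hC hc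
  have hev : (fun s : ℝ => u * (volume.real A * ∫ w, diagProd ξ₁ ξ₂ x w ∂(Q.prod P)) +
        u ^ 2 * ∫ y, pairCov Q P ξ₁ ξ₂ x y * overlap A ((s ^ (1 / (d : ℝ)))⁻¹ • y)) =ᶠ[atTop]
      fun s : ℝ => covariance (fun S => 1 / √s * scoreSum (scaledScore ξ₁ s) A S)
      (fun S => 1 / √s * scoreSum (scaledScore ξ₂ s) A S) (Pst (s * u)) := by
    filter_upwards [eventually_gt_atTop 0] with s hs
    exact (h₁.covariance_scaled h₂ hP hd hu.le hK hC hc hT₁ hown₁ hT₂ hown₂ hA hAb hs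
      (hPst _ (mul_pos hs hu))).symm
  refine Tendsto.congr' hev ?_
  have hlim : Tendsto (fun s : ℝ => ∫ y, pairCov Q P ξ₁ ξ₂ x y *
      overlap A ((s ^ (1 / (d : ℝ)))⁻¹ • y)) atTop
      (𝓝 (∫ y, pairCov Q P ξ₁ ξ₂ x y * volume.real A)) := by
    refine tendsto_integral_filter_of_dominated_convergence
      (fun y => ‖pairCov Q P ξ₁ ξ₂ x y‖ * volume.real A) ?_ ?_ (hp.norm.mul_const _) ?_
    · exact Eventually.of_forall fun s => hp.aestronglyMeasurable.mul
        ((measurable_overlap hA).comp (measurable_const_smul _)).aestronglyMeasurable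
    · refine Eventually.of_forall fun s => Eventually.of_forall fun y => ?_
      rw [norm_mul, Real.norm_of_nonneg (show 0 ≤ overlap A _ from measureReal_nonneg)]
      gcongr
      exact overlap_le hAb _
    · refine Eventually.of_forall fun y => Tendsto.const_mul _ ?_
      refine (tendsto_overlap_zero hA hAb).comp ?_
      have : Tendsto (fun s : ℝ => (s ^ (1 / (d : ℝ)))⁻¹) atTop (𝓝 0) :=
        (tendsto_rpow_atTop (by positivity)).inv_tendsto_atTop
      simpa using this.smul_const y
  rw [integral_mul_const] at hlim
  have := (hlim.const_mul (u ^ 2)).const_add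
    (u * (volume.real A * ∫ w, diagProd ξ₁ ξ₂ x w ∂(Q.prod P)))
  convert this using 2
  rw [covDensity]
  ring

end ControlledAt

end StabScore

end

/-! ### From the standing assumptions to control at a point. -/

noncomputable section

namespace StabScore

open Config

variable {d : ℕ} {M : Type*}

theorem scaledScore_one (ξ : Score d M) : scaledScore ξ 1 = ξ := by
  funext p S
  rw [scaledScore, Real.one_rpow, dilateAbout_one]

/-- The convention is available only over `W`; one point of `W` and translation invariance extend it
to every location. -/
theorem AddsOwnPoint.score_add {W : Set (EuclideanSpace ℝ (Fin d))} {ξ : Score d M}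
    (h : AddsOwnPoint W ξ) (hT : TranslationInvariant ξ) {x : EuclideanSpace ℝ (Fin d)}
    (hx : x ∈ W) (p : Pt d M) (S : Config d M) : ξ p (S.add p) = ξ p S := by
  have h1 : ∀ (m : M) (S : Config d M), ξ (x, m) (S.add (x, m)) = ξ (x, m) S := by
    intro m S
    by_cases hm : (x, m) ∈ S.carrier
    · rw [add_of_mem hm]
    · simpa only [scaledScore_one] using (h 1 le_rfl x hx m S hm).symm
  obtain ⟨z, m⟩ := p
  rw [hT z (x - z) m (S.add (z, m)), hT z (x - z) m S, Config.translate_add]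
  simp only [add_sub_cancel]
  exact h1 m _

theorem union_withMarks_empty (S : Config d M)
    (t : (∅ : Finset (EuclideanSpace ℝ (Fin d))) → M) : S ∪ withMarks ∅ t = S := by
  ext1
  simp only [withMarks, carrier_union, carrier_ofFinite, union_eq_left]
  rintro _ ⟨⟨a, ha⟩, rfl⟩
  simp at ha

theorem union_withMarks_singleton (S : Config d M) (z : EuclideanSpace ℝ (Fin d))
    (t : ({z} : Finset (EuclideanSpace ℝ (Fin d))) → M) :
    S ∪ withMarks {z} t = S.add (z, t default) := by
  rw [Config.add]
  congr 1
  ext1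
  simp only [withMarks, carrier_ofFinite]
  rw [range_unique]
  rfl

theorem pow_four_le_one_add_rpow (a : ℝ≥0∞) {q : ℝ} (hq : 4 ≤ q) : a ^ 4 ≤ 1 + a ^ q := by
  rcases le_total a 1 with ha | ha
  · exact (pow_le_one₀ zero_le ha).trans le_self_add
  · refine le_trans ?_ le_add_self
    rw [← ENNReal.rpow_natCast]
    exact ENNReal.rpow_le_rpow_of_exponent_le ha (by exact_mod_cast hq)

variable [MeasurableSpace M]

theorem lintegral_pow_four_le {Ω : Type*} [MeasurableSpace Ω] {ν : Measure Ω}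
    [IsProbabilityMeasure ν] {a : Ω → ℝ} {q C : ℝ} (hq : 4 ≤ q) (hC : 0 ≤ C)
    (h : ∫⁻ w, ‖a w‖ₑ ^ q ∂ν ≤ ENNReal.ofReal C) :
    ∫⁻ w, ‖a w‖ₑ ^ 4 ∂ν ≤ ENNReal.ofReal (1 + C) := by
  calc ∫⁻ w, ‖a w‖ₑ ^ 4 ∂ν ≤ ∫⁻ w, (1 + ‖a w‖ₑ ^ q) ∂ν :=
        lintegral_mono fun w => pow_four_le_one_add_rpow _ hq
    _ = 1 + ∫⁻ w, ‖a w‖ₑ ^ q ∂ν := by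
        rw [lintegral_add_left measurable_const]
        simp
    _ ≤ ENNReal.ofReal (1 + C) := by
        rw [ENNReal.ofReal_add zero_le_one hC, ENNReal.ofReal_one]
        gcongr

/-- The assumptions are read at `s = 1` and `y = x`. The moment bound with `𝒜 = ∅` and `𝒜 = {z}`
gives the two fourth-moment fields, where `K = 1 + C'` comes from `a⁴ ≤ 1 + a^{6+p}`; sets `T` with
at most one point give the two stability fields. -/
theorem exists_controlledAt {k : ℕ} {Q : Measure M} [IsProbabilityMeasure Q]
    {W : Set (EuclideanSpace ℝ (Fin d))} {g : EuclideanSpace ℝ (Fin d) → ℝ}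
    {Pg Pst : ℝ → Measure (Config d M)} {ξ : Fin k → Score d M} (hd : d ≠ 0)
    (hgpos : ∀ x ∈ W, 0 < g x)
    (hPst : ∀ u, 0 < u → IsPoissonLaw (stationaryIntensity d Q u) (Pst u))
    (hξ : ∀ i, Measurable (Function.uncurry (ξ i)))
    (hstab : IntrinsicallyExponentiallyStabilizing Q W g Pg Pst ξ)
    (hmom : ∃ p : ℝ, 0 < p ∧ MomentCondition Q W g Pg Pst ξ p) :
    ∃ (R : Pt d M → Config d M → ℝ≥0) (K C c : ℝ), 0 ≤ K ∧ 0 ≤ C ∧ 0 < c ∧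
      ∀ i, ∀ x ∈ W, ControlledAt Q (Pst (g x)) (ξ i) x (fun m => R (x, m)) K C c := by
  obtain ⟨R, hRm, hRs, hRmono, hRloc, C, c, hC, hc, -, htail⟩ := hstab
  obtain ⟨p, hp, C', hC', -, hmom⟩ := hmom
  refine ⟨R 1, 1 + C', C, c, by positivity, hC.le, hc, fun i x hx => ?_⟩
  have hP := hPst (g x) (hgpos x hx)
  have := hP.isProbabilityMeasure
  have hmom' := fun 𝒜 h𝒜 hx𝒜 => hmom i 𝒜 h𝒜 1 le_rfl x hx x hx hx𝒜
  simp only [scaledScore_one, one_mul, scoreMoment] at hmom'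
  have hst := hRs 1 le_rfl i x hx
  simp only [scaledScore_one] at hst
  refine ⟨hξ i, ?_, ?_, fun z hz => ?_, fun m S => ?_, fun m S q => ?_,
    fun m S T h => hRmono 1 le_rfl x hx m S T h, fun m S r hr => hRloc 1 le_rfl x hx m S r hr,
    fun r hr => ?_⟩
  · exact (hRm 1 le_rfl).comp
      (f := fun z : M × Config d M => (((x, z.1) : Pt d M), z.2)) (by fun_prop)
  · refine lintegral_pow_four_le (q := 6 + p) (by linarith) hC'.le ?_
    have h := hmom' ∅ (by simp) (by simp)
    simp only [union_withMarks_empty] at h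
    refine le_trans (le_of_eq ?_) h
    have hT : MeasurePreserving
        (fun w : M × ((∅ : Finset (EuclideanSpace ℝ (Fin d))) → M) × Config d M => (w.1, w.2.2))
        (Q.prod ((Measure.pi fun _ => Q).prod (Pst (g x)))) (Q.prod (Pst (g x))) :=
      (MeasurePreserving.id Q).prod measurePreserving_snd
    have hm : Measurable fun w : M × Config d M => ξ i (x, w.1) w.2 :=
      (hξ i).comp (f := fun z : M × Config d M => ((x, z.1), z.2)) (by fun_prop)
    exact (lintegral_comp_measurePreserving hT (f := fun w => ‖ξ i (x, w.1) w.2‖ₑ ^ (6 + p))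
      (hm.enorm.pow_const _).aemeasurable).symm
  · refine lintegral_pow_four_le (q := 6 + p) (by linarith) hC'.le ?_
    have h := hmom' {z} (by simp) (by simpa using hz.symm)
    simp only [union_withMarks_singleton] at h
    refine le_trans (le_of_eq ?_) h
    have hT : MeasurePreserving
        (fun w : M × (({z} : Finset (EuclideanSpace ℝ (Fin d))) → M) × Config d M =>
          (w.1, w.2.1 default, w.2.2))
        (Q.prod ((Measure.pi fun _ => Q).prod (Pst (g x)))) (Q.prod (Q.prod (Pst (g x)))) :=
      (MeasurePreserving.id Q).prod
        ((measurePreserving_piUnique fun _ : ({z} : Finset (EuclideanSpace ℝ (Fin d))) => Q).prod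
          (MeasurePreserving.id _))
    exact (lintegral_comp_measurePreserving hT
      (f := fun w => ‖ξ i (x, w.1) (w.2.2.add (z, w.2.1))‖ₑ ^ (6 + p))
      ((aestronglyMeasurable_score_add (hξ i) hP hd x z).enorm.pow_const _)).symm
  · have h := hst m S ∅ finite_empty (by simp)
    have e : S ∪ ofFinite ∅ finite_empty = S := by ext1; simp
    rwa [e] at h
  · exact hst m S {q} (finite_singleton q) (by simp)
  · have h := htail 1 le_rfl x hx x hx r hr
    simpa only [one_mul, mul_one] using h

end StabScore

end

/-! ### Absolute convergence, and `σ_ij` as an integral of the local covariance density. -/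

noncomputable section

namespace StabScore

open Config

variable {d : ℕ} {M : Type*}

/-- The coefficient `b` agrees with a measurable function only on `W`, because outside `W` the
density may be nonpositive and the law `Pst (g x)` arbitrary. -/
theorem integrableOn_mul_mul_of_bounded {W A₁ A₂ : Set (EuclideanSpace ℝ (Fin d))}
    {b b' f₁ f₂ : EuclideanSpace ℝ (Fin d) → ℝ} {F₁ F₂ B : ℝ}
    (hA₁ : MeasurableSet A₁) (hA₂ : MeasurableSet A₂) (hAb : Bornology.IsBounded A₁)
    (hAW : A₁ ⊆ W) (hf₁ : Measurable f₁) (hf₂ : Measurable f₂) (hF₁ : ∀ x ∈ A₁, |f₁ x| ≤ F₁)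
    (hF₂ : ∀ x ∈ A₂, |f₂ x| ≤ F₂) (hb' : Measurable b') (hbb' : ∀ x ∈ W, b x = b' x)
    (hB : ∀ x ∈ W, |b x| ≤ B) : IntegrableOn (fun x => b x * f₁ x * f₂ x) (A₁ ∩ A₂) := by
  have : IsFiniteMeasure (volume.restrict (A₁ ∩ A₂)) :=
    isFiniteMeasure_restrict.2 (hAb.subset inter_subset_left).measure_lt_top.ne
  refine Integrable.of_bound (C := B * F₁ * F₂) ?_ ?_
  · refine ((hb'.mul hf₁).mul hf₂).aestronglyMeasurable.congr ?_
    filter_upwards [ae_restrict_mem (hA₁.inter hA₂)] with x hx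
    simp only [Pi.mul_apply, hbb' x (hAW hx.1)]
  · filter_upwards [ae_restrict_mem (hA₁.inter hA₂)] with x hx
    have h1 := hF₁ x hx.1
    have h2 := hF₂ x hx.2
    have h3 := hB x (hAW hx.1)
    have h4 := (abs_nonneg _).trans h1
    have h5 := (abs_nonneg _).trans h3
    rw [norm_mul, norm_mul]
    simp only [Real.norm_eq_abs]
    gcongr

variable [MeasurableSpace M]

/-- The scores `ξ₁` and `ξ₂` are controlled at every location of `W` for the stationary Poisson
process with the local intensity, uniformly in the location. -/
structure LocallyControlled (Q : Measure M) (W : Set (EuclideanSpace ℝ (Fin d)))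
    (g : EuclideanSpace ℝ (Fin d) → ℝ) (Pst : ℝ → Measure (Config d M)) (ξ₁ ξ₂ : Score d M)
    (R : Pt d M → Config d M → ℝ≥0) (K C c G : ℝ) : Prop where
  two_le : 2 ≤ d
  measurable_density : Measurable g
  density_pos : ∀ x ∈ W, 0 < g x
  density_le : ∀ x ∈ W, g x ≤ G
  isPoissonLaw : ∀ u, 0 < u → IsPoissonLaw (stationaryIntensity d Q u) (Pst u)
  moment_nonneg : 0 ≤ K
  tail_nonneg : 0 ≤ C
  rate_pos : 0 < c
  measurable_left : Measurable (Function.uncurry ξ₁)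
  measurable_right : Measurable (Function.uncurry ξ₂)
  left : ∀ x ∈ W, ControlledAt Q (Pst (g x)) ξ₁ x (fun m => R (x, m)) K C c
  right : ∀ x ∈ W, ControlledAt Q (Pst (g x)) ξ₂ x (fun m => R (x, m)) K C c

namespace LocallyControlled

variable {Q : Measure M} {W : Set (EuclideanSpace ℝ (Fin d))}
  {g : EuclideanSpace ℝ (Fin d) → ℝ} {Pst : ℝ → Measure (Config d M)} {ξ₁ ξ₂ : Score d M}
  {R : Pt d M → Config d M → ℝ≥0} {K C c G : ℝ}
  {A₁ A₂ : Set (EuclideanSpace ℝ (Fin d))} {f₁ f₂ : EuclideanSpace ℝ (Fin d) → ℝ} {F₁ F₂ : ℝ}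

theorem isPoissonLaw_at (h : LocallyControlled Q W g Pst ξ₁ ξ₂ R K C c G)
    {x : EuclideanSpace ℝ (Fin d)} (hx : x ∈ W) :
    IsPoissonLaw (stationaryIntensity d Q (g x)) (Pst (g x)) :=
  h.isPoissonLaw _ (h.density_pos x hx)

variable [IsProbabilityMeasure Q]

theorem abs_integral_diagProd_le (h : LocallyControlled Q W g Pst ξ₁ ξ₂ R K C c G)
    {x : EuclideanSpace ℝ (Fin d)} (hx : x ∈ W) :
    |∫ w, diagProd ξ₁ ξ₂ x w ∂(Q.prod (Pst (g x)))| ≤ 1 + K + K := by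
  have hP := h.isPoissonLaw_at hx
  have := hP.isProbabilityMeasure
  have hK := h.moment_nonneg
  have h1 := lintegral_enorm_mul_le hK
    ((h.left x hx).measurable_score_at.aestronglyMeasurable) (h.left x hx).moment
    ((h.right x hx).measurable_score_at.aestronglyMeasurable) (h.right x hx).moment
  refine (norm_integral_le_integral_norm (diagProd ξ₁ ξ₂ x)).trans ?_
  rw [integral_norm_eq_lintegral_enorm
    ((h.left x hx).integrable_diagProd (h.right x hx) hP).aestronglyMeasurable]
  exact ENNReal.toReal_le_of_le_ofReal (by positivity) h1

theorem ae_norm_pairCov_le (h : LocallyControlled Q W g Pst ξ₁ ξ₂ R K C c G)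
    {x : EuclideanSpace ℝ (Fin d)} (hx : x ∈ W) :
    ∀ᵐ y, ‖pairCov Q (Pst (g x)) ξ₁ ξ₂ x y‖ ≤ Real.exp (-(c / 18) * ‖y‖ ^ 2) *
      (K + C * Real.exp c + (1 + K) * (1 + K + C * Real.exp c)) := by
  have : Nonempty (Fin d) := ⟨⟨0, by have := h.two_le; omega⟩⟩
  filter_upwards [Measure.ae_ne volume 0] with y hy
  exact (h.left x hx).abs_pairCov_le (h.right x hx) (h.isPoissonLaw_at hx) h.two_le
    h.moment_nonneg h.tail_nonneg h.rate_pos.le hy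

theorem integrable_pairCov (h : LocallyControlled Q W g Pst ξ₁ ξ₂ R K C c G)
    {x : EuclideanSpace ℝ (Fin d)} (hx : x ∈ W) :
    Integrable (pairCov Q (Pst (g x)) ξ₁ ξ₂ x) :=
  (h.left x hx).integrable_pairCov (h.right x hx) (h.isPoissonLaw_at hx) h.two_le
    h.moment_nonneg h.tail_nonneg h.rate_pos

/-- The point of the bound is that its right side does not depend on `x`, so integration over a
bounded set of locations is harmless. -/
theorem integral_norm_pairCov_le (h : LocallyControlled Q W g Pst ξ₁ ξ₂ R K C c G)
    {x : EuclideanSpace ℝ (Fin d)} (hx : x ∈ W) :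
    ∫ y, ‖pairCov Q (Pst (g x)) ξ₁ ξ₂ x y‖ ≤
      ∫ y : EuclideanSpace ℝ (Fin d), Real.exp (-(c / 18) * ‖y‖ ^ 2) *
        (K + C * Real.exp c + (1 + K) * (1 + K + C * Real.exp c)) := by
  have hc := h.rate_pos
  exact integral_mono_ae (h.integrable_pairCov hx).norm
    ((integrable_exp_neg_mul_sq_norm (b := c / 18) (by positivity)).mul_const _)
    (h.ae_norm_pairCov_le hx)

/-- Pulling the kernel of stationary laws back along `g` makes these expectations measurable in the
location; the kernel agrees with `Pst (g x)` where `g x > 0`, in particular on `W`. -/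
theorem exists_stronglyMeasurable_eqOn (h : LocallyControlled Q W g Pst ξ₁ ξ₂ R K C c G) :
    ∃ (a : EuclideanSpace ℝ (Fin d) → ℝ)
      (p : EuclideanSpace ℝ (Fin d) × EuclideanSpace ℝ (Fin d) → ℝ),
      StronglyMeasurable a ∧ StronglyMeasurable p ∧
      (∀ x ∈ W, ∫ w, diagProd ξ₁ ξ₂ x w ∂(Q.prod (Pst (g x))) = a x) ∧
      ∀ x ∈ W, ∀ y, pairCov Q (Pst (g x)) ξ₁ ξ₂ x y = p (x, y) := by
  obtain ⟨κ, hκ, hκe⟩ := exists_kernel_stationary h.isPoissonLaw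
  have hd0 : d ≠ 0 := by have := h.two_le; omega
  have hF : Measurable (Function.uncurry (diagProd ξ₁ ξ₂)) := by
    have hm : Measurable fun z : EuclideanSpace ℝ (Fin d) × M × Config d M =>
      (((z.1, z.2.1) : Pt d M), z.2.2) := by fun_prop
    exact (h.measurable_left.comp hm).mul (h.measurable_right.comp hm)
  refine ⟨_, _, stronglyMeasurable_integral_kernel (Q := Q)
    (η := κ.comap g h.measurable_density) hF,
    stronglyMeasurable_pairCovFree (Q := Q) h.measurable_left h.measurable_right
      (κ.comap g h.measurable_density), fun x hx => ?_, fun x hx y => ?_⟩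
  · rw [Kernel.comap_apply, hκe _ (h.density_pos x hx)]
  · simp only
    rw [Kernel.comap_apply, hκe _ (h.density_pos x hx), (h.isPoissonLaw_at hx).pairCov_eq hd0]

theorem integrableOn_diag (h : LocallyControlled Q W g Pst ξ₁ ξ₂ R K C c G)
    (hA₁ : MeasurableSet A₁) (hA₂ : MeasurableSet A₂) (hAb : Bornology.IsBounded A₁)
    (hAW : A₁ ⊆ W) (hf₁ : Measurable f₁) (hf₂ : Measurable f₂) (hF₁ : ∀ x ∈ A₁, |f₁ x| ≤ F₁)
    (hF₂ : ∀ x ∈ A₂, |f₂ x| ≤ F₂) :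
    IntegrableOn (fun x => (∫ w, diagProd ξ₁ ξ₂ x w ∂(Q.prod (Pst (g x)))) * f₁ x * f₂ x * g x)
      (A₁ ∩ A₂) := by
  obtain ⟨a, -, ha, -, hae, -⟩ := h.exists_stronglyMeasurable_eqOn
  have hK := h.moment_nonneg
  refine (integrableOn_mul_mul_of_bounded (W := W)
    (b := fun x => (∫ w, diagProd ξ₁ ξ₂ x w ∂(Q.prod (Pst (g x)))) * g x)
    (b' := fun x => a x * g x) (B := (1 + K + K) * G) hA₁ hA₂ hAb hAW hf₁ hf₂ hF₁ hF₂
    (ha.measurable.mul h.measurable_density) (fun x hx => by simp only [hae x hx])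
    fun x hx => ?_).congr_fun (fun x _ => ?_) (hA₁.inter hA₂)
  · rw [abs_mul, abs_of_pos (h.density_pos x hx)]
    have h1 := h.abs_integral_diagProd_le hx
    have h2 := h.density_le x hx
    have h3 := (h.density_pos x hx).le
    gcongr
  · ring

theorem integrableOn_integral_norm_pairCov (h : LocallyControlled Q W g Pst ξ₁ ξ₂ R K C c G)
    (hA₁ : MeasurableSet A₁) (hA₂ : MeasurableSet A₂) (hAb : Bornology.IsBounded A₁)
    (hAW : A₁ ⊆ W) (hf₁ : Measurable f₁) (hf₂ : Measurable f₂) (hF₁ : ∀ x ∈ A₁, |f₁ x| ≤ F₁)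
    (hF₂ : ∀ x ∈ A₂, |f₂ x| ≤ F₂) :
    IntegrableOn (fun x => ∫ y, ‖pairCov Q (Pst (g x)) ξ₁ ξ₂ x y * f₁ x * f₂ x * g x ^ 2‖)
      (A₁ ∩ A₂) := by
  obtain ⟨-, p, -, hp, -, hpe⟩ := h.exists_stronglyMeasurable_eqOn
  refine (integrableOn_mul_mul_of_bounded (W := W)
    (b := fun x => (∫ y, ‖pairCov Q (Pst (g x)) ξ₁ ξ₂ x y‖) * g x ^ 2)
    (b' := fun x => (∫ y, ‖p (x, y)‖) * g x ^ 2)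
    (B := (∫ y : EuclideanSpace ℝ (Fin d), Real.exp (-(c / 18) * ‖y‖ ^ 2) *
        (K + C * Real.exp c + (1 + K) * (1 + K + C * Real.exp c))) * G ^ 2)
    hA₁ hA₂ hAb hAW (f₁ := fun x => |f₁ x|) (f₂ := fun x => |f₂ x|) hf₁.abs hf₂.abs
    (fun x hx => (abs_abs (f₁ x)).trans_le (hF₁ x hx))
    (fun x hx => (abs_abs (f₂ x)).trans_le (hF₂ x hx))
    (hp.norm.integral_prod_right'.measurable.mul (h.measurable_density.pow_const 2))
    (fun x hx => by simp only [hpe x hx])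
    fun x hx => ?_).congr_fun (fun x _ => ?_) (hA₁.inter hA₂)
  · have h1 := h.integral_norm_pairCov_le hx
    have h2 := h.density_le x hx
    have h3 := (h.density_pos x hx).le
    have h4 : 0 ≤ ∫ y, ‖pairCov Q (Pst (g x)) ξ₁ ξ₂ x y‖ := by positivity
    rw [abs_mul, abs_of_nonneg h4, abs_of_nonneg (by positivity)]
    have h5 := h4.trans h1
    gcongr
  · simp only [norm_mul, Real.norm_eq_abs, integral_mul_const, abs_pow, sq_abs]
    ring

theorem integrableOn_integral_pairCov (h : LocallyControlled Q W g Pst ξ₁ ξ₂ R K C c G)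
    (hA₁ : MeasurableSet A₁) (hA₂ : MeasurableSet A₂) (hAb : Bornology.IsBounded A₁)
    (hAW : A₁ ⊆ W) (hf₁ : Measurable f₁) (hf₂ : Measurable f₂) (hF₁ : ∀ x ∈ A₁, |f₁ x| ≤ F₁)
    (hF₂ : ∀ x ∈ A₂, |f₂ x| ≤ F₂) :
    IntegrableOn (fun x => ∫ y, pairCov Q (Pst (g x)) ξ₁ ξ₂ x y * f₁ x * f₂ x * g x ^ 2)
      (A₁ ∩ A₂) := by
  obtain ⟨-, p, -, hp, -, hpe⟩ := h.exists_stronglyMeasurable_eqOn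
  refine (h.integrableOn_integral_norm_pairCov hA₁ hA₂ hAb hAW hf₁ hf₂ hF₁ hF₂).mono' ?_
    (Eventually.of_forall fun x => norm_integral_le_integral_norm _)
  have hm : Measurable fun x => (∫ y, p (x, y)) * f₁ x * f₂ x * g x ^ 2 :=
    ((hp.integral_prod_right'.measurable.mul hf₁).mul hf₂).mul (h.measurable_density.pow_const 2)
  refine hm.aestronglyMeasurable.congr ?_
  filter_upwards [ae_restrict_mem (hA₁.inter hA₂)] with x hx
  simp only [integral_mul_const, hpe x (hAW hx.1)]

theorem sigmaEntryConverges (h : LocallyControlled Q W g Pst ξ₁ ξ₂ R K C c G)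
    (hA₁ : MeasurableSet A₁) (hA₂ : MeasurableSet A₂) (hAb : Bornology.IsBounded A₁)
    (hAW : A₁ ⊆ W) (hf₁ : Measurable f₁) (hf₂ : Measurable f₂) (hF₁ : ∀ x ∈ A₁, |f₁ x| ≤ F₁)
    (hF₂ : ∀ x ∈ A₂, |f₂ x| ≤ F₂) :
    SigmaEntryConverges Q g Pst ξ₁ ξ₂ A₁ A₂ f₁ f₂ := by
  have hd0 : d ≠ 0 := by have := h.two_le; omega
  have : Nonempty (Fin d) := ⟨⟨0, Nat.pos_of_ne_zero hd0⟩⟩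
  refine ⟨fun x hx => ?_, h.integrableOn_diag hA₁ hA₂ hAb hAW hf₁ hf₂ hF₁ hF₂,
    h.integrableOn_integral_norm_pairCov hA₁ hA₂ hAb hAW hf₁ hf₂ hF₁ hF₂⟩
  have hxW := hAW hx.1
  have hP := h.isPoissonLaw_at hxW
  have h₁ := h.left x hxW
  have h₂ := h.right x hxW
  refine ⟨h₁.integrable_diagProd h₂ hP, h₁.integrable_score hP, ?_,
    (((h.integrable_pairCov hxW).mul_const _).mul_const _).mul_const _⟩
  filter_upwards [Measure.ae_ne volume 0] with y hy
  exact ⟨h₁.integrable_offDiagProd h₂ hP hd0 hy, h₂.integrable_score_translate hP _⟩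

theorem integrableOn_covDensity_and_sigmaEntry_eq
    (h : LocallyControlled Q W g Pst ξ₁ ξ₂ R K C c G)
    (hA₁ : MeasurableSet A₁) (hA₂ : MeasurableSet A₂) (hAb : Bornology.IsBounded A₁)
    (hAW : A₁ ⊆ W) (hf₁ : Measurable f₁) (hf₂ : Measurable f₂) (hF₁ : ∀ x ∈ A₁, |f₁ x| ≤ F₁)
    (hF₂ : ∀ x ∈ A₂, |f₂ x| ≤ F₂) :
    IntegrableOn (fun x => covDensity Q (Pst (g x)) ξ₁ ξ₂ x (g x) * f₁ x * f₂ x) (A₁ ∩ A₂) ∧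
    sigmaEntry Q g Pst ξ₁ ξ₂ A₁ A₂ f₁ f₂ =
      ∫ x in A₁ ∩ A₂, covDensity Q (Pst (g x)) ξ₁ ξ₂ x (g x) * f₁ x * f₂ x := by
  have h1 := h.integrableOn_diag hA₁ hA₂ hAb hAW hf₁ hf₂ hF₁ hF₂
  have h2 := h.integrableOn_integral_pairCov hA₁ hA₂ hAb hAW hf₁ hf₂ hF₁ hF₂
  have e : (fun x => covDensity Q (Pst (g x)) ξ₁ ξ₂ x (g x) * f₁ x * f₂ x) = fun x =>
      (∫ w, diagProd ξ₁ ξ₂ x w ∂(Q.prod (Pst (g x)))) * f₁ x * f₂ x * g x +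
        ∫ y, pairCov Q (Pst (g x)) ξ₁ ξ₂ x y * f₁ x * f₂ x * g x ^ 2 := by
    funext x
    simp only [integral_mul_const, covDensity]
    ring
  rw [e]
  exact ⟨h1.add h2, (integral_add h1 h2).symm⟩

end LocallyControlled

end StabScore

end

/-! ### Positive definiteness: from the local matrices to the integrated one. -/

noncomputable section

namespace StabScore

variable {d : ℕ}

/-- The quadratic form of `V` is `a` times that of `D`. A positive product with `a ≥ 0` forces the
other factor to be positive, so `a > 0` need not be known beforehand. -/
theorem sum_mul_pos_of_posDef {k : ℕ} {V : Matrix (Fin k) (Fin k) ℝ} (hV : V.PosDef) {a : ℝ}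
    (ha : 0 ≤ a) {D : Fin k → Fin k → ℝ} (hVD : ∀ i j, V i j = a * D i j) {v : Fin k → ℝ}
    (hv : v ≠ 0) : 0 < ∑ i, ∑ j, v i * v j * D i j := by
  have h1 := hV.dotProduct_mulVec_pos hv
  refine pos_of_mul_pos_right (a := a) (h1.trans_eq ?_) ha
  simp only [dotProduct, Matrix.mulVec, Finset.mul_sum, hVD, star_trivial]
  exact Finset.sum_congr rfl fun i _ => Finset.sum_congr rfl fun j _ => by ring

/-- A positive diagonal entry of `V` excludes `a = 0`, so symmetry of `V` passes to `D`. -/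
theorem eq_swap_of_posDef {k : ℕ} {V : Matrix (Fin k) (Fin k) ℝ} (hV : V.PosDef) {a : ℝ}
    {D : Fin k → Fin k → ℝ} (hVD : ∀ i j, V i j = a * D i j) (i j : Fin k) :
    D i j = D j i := by
  have ha : a ≠ 0 := fun h => by
    have := hV.diag_pos (i := i)
    simp [hVD, h] at this
  have h1 := hV.isHermitian.apply i j
  rw [star_trivial, hVD, hVD] at h1
  exact (mul_left_cancel₀ ha h1).symm

/-- The quadratic form of `V` at `c` is the integral of the quadratic forms of `D x` at `v x`. The
integrand is nonnegative, and its support contains the set where `f i ≠ 0` in `A i` for any `i` with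
`c i ≠ 0`. -/
theorem posDef_of_setIntegral {k : ℕ} {W : Set (EuclideanSpace ℝ (Fin d))}
    {D : EuclideanSpace ℝ (Fin d) → Fin k → Fin k → ℝ}
    (hsymm : ∀ x ∈ W, ∀ i j, D x i j = D x j i)
    (hpos : ∀ x ∈ W, ∀ v : Fin k → ℝ, v ≠ 0 → 0 < ∑ i, ∑ j, v i * v j * D x i j)
    {A : Fin k → Set (EuclideanSpace ℝ (Fin d))} (hA : ∀ i, MeasurableSet (A i))
    (hAW : ∀ i, A i ⊆ W) {f : Fin k → EuclideanSpace ℝ (Fin d) → ℝ}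
    (hf0 : ∀ i, 0 < volume {x ∈ A i | f i x ≠ 0})
    (hint : ∀ i j, IntegrableOn (fun x => D x i j * f i x * f j x) (A i ∩ A j))
    {V : Matrix (Fin k) (Fin k) ℝ}
    (hV : ∀ i j, V i j = ∫ x in A i ∩ A j, D x i j * f i x * f j x) : V.PosDef := by
  classical
  refine Matrix.PosDef.of_dotProduct_mulVec_pos ?_ fun c hc => ?_
  · ext i j
    rw [Matrix.conjTranspose_apply, star_trivial, hV, hV, inter_comm]
    refine setIntegral_congr_fun ((hA i).inter (hA j)) fun x hx => ?_
    simp only [hsymm x (hAW i hx.1) j i]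
    ring
  -- The indicators extend all terms from the varying domains `A i ∩ A j` to the whole space, so
  -- that the double sum can be formed pointwise.
  let v : EuclideanSpace ℝ (Fin d) → Fin k → ℝ := fun x i => c i * (A i).indicator (f i) x
  have hterm : ∀ i j x, c i * c j *
      (A i ∩ A j).indicator (fun x => D x i j * f i x * f j x) x = v x i * v x j * D x i j := by
    intro i j x
    by_cases hi : x ∈ A i <;> by_cases hj : x ∈ A j <;> simp [v, hi, hj]
    ring
  have hti : ∀ i j, Integrable fun x => v x i * v x j * D x i j := fun i j => by
    simp only [← hterm]
    exact ((integrable_indicator_iff ((hA i).inter (hA j))).2 (hint i j)).const_mul _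
  have hquad : star c ⬝ᵥ V.mulVec c = ∫ x, ∑ i, ∑ j, v x i * v x j * D x i j := by
    rw [integral_finsetSum _ fun i _ => integrable_finsetSum _ fun j _ => hti i j]
    simp only [dotProduct, Matrix.mulVec, Finset.mul_sum, star_trivial]
    refine Finset.sum_congr rfl fun i _ => ?_
    rw [integral_finsetSum _ fun j _ => hti i j]
    refine Finset.sum_congr rfl fun j _ => ?_
    simp only [← hterm]
    rw [integral_const_mul, integral_indicator ((hA i).inter (hA j)), hV]
    ring
  have hv : ∀ x, v x ≠ 0 → x ∈ W := by
    intro x hx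
    obtain ⟨i, hi⟩ := Function.ne_iff.1 hx
    by_contra hxW
    have hxA : x ∉ A i := fun h => hxW (hAW i h)
    exact hi (by simp [v, hxA])
  rw [hquad, integral_pos_iff_support_of_nonneg]
  · obtain ⟨i, hi⟩ := Function.ne_iff.1 hc
    refine (hf0 i).trans_le (measure_mono fun x hx => ?_)
    have hvx : v x ≠ 0 := fun h => by
      have := congrFun h i
      simp only [v, indicator_of_mem hx.1, Pi.zero_apply, mul_eq_zero] at this
      exact this.elim hi hx.2
    exact (hpos x (hv x hvx) (v x) hvx).ne'
  · intro x
    by_cases hvx : v x = 0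
    · simp [hvx]
    · exact (hpos x (hv x hvx) (v x) hvx).le
  · exact integrable_finsetSum _ fun i _ => integrable_finsetSum _ fun j _ => hti i j

end StabScore

end

theorem mainTheorem7 {d k : ℕ} (hd : 2 ≤ d) {M : Type*} [MeasurableSpace M]
    (Q : Measure M) [IsProbabilityMeasure Q]
    -- the observation window and the density
    (W : Set (EuclideanSpace ℝ (Fin d))) (hW : MeasurableSet W) (hW0 : volume (frontier W) = 0)
    (g : EuclideanSpace ℝ (Fin d) → ℝ) (hg : Measurable g) (hgb : ∃ K, ∀ x ∈ W, g x ≤ K)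
    (hgpos : ∀ x ∈ W, 0 < g x)
    (hgc : ∀ᵐ x ∂(volume.restrict W), ContinuousWithinAt g W x)
    -- the laws of the Poisson processes `P_{sg}` and `P_u`
    (Pg Pst : ℝ → Measure (StabScore.Config d M))
    (hPg : ∀ s, 1 ≤ s → StabScore.IsPoissonLaw (StabScore.intensity Q W g s) (Pg s))
    (hPst : ∀ u, 0 < u → StabScore.IsPoissonLaw (StabScore.stationaryIntensity d Q u) (Pst u))
    -- the scores, with scaled versions `StabScore.scaledScore (ξ i) s`
    (ξ : Fin k → StabScore.Score d M) (hξ : ∀ i, Measurable (Function.uncurry (ξ i)))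
    (hξown : ∀ i, StabScore.AddsOwnPoint W (ξ i))
    (hξtrans : ∀ i, StabScore.TranslationInvariant (ξ i))
    (hstab : StabScore.IntrinsicallyExponentiallyStabilizing Q W g Pg Pst ξ)
    (hmom : ∃ p : ℝ, 0 < p ∧ StabScore.MomentCondition Q W g Pg Pst ξ p)
    -- positive definiteness for stationary input
    (hpos : ∃ A : Set (EuclideanSpace ℝ (Fin d)), MeasurableSet A ∧ Bornology.IsBounded A ∧
      ∀ u, 0 < u → ∃ V : Matrix (Fin k) (Fin k) ℝ,
        StabScore.IsAsymptoticCovariance Pst ξ A u V ∧ V.PosDef)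
    -- the sets and the test functions
    (A : Fin k → Set (EuclideanSpace ℝ (Fin d))) (hA : ∀ i, MeasurableSet (A i))
    (hAb : ∀ i, Bornology.IsBounded (A i)) (hAW : ∀ i, A i ⊆ W)
    (f : Fin k → EuclideanSpace ℝ (Fin d) → ℝ) (hf : ∀ i, Measurable (f i))
    (hfb : ∀ i, ∃ K, ∀ x ∈ A i, |f i x| ≤ K)
    (hf0 : ∀ i, 0 < volume {x ∈ A i | f i x ≠ 0}) :
    (∀ i j, StabScore.SigmaEntryConverges Q g Pst (ξ i) (ξ j) (A i) (A j) (f i) (f j)) ∧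
      (StabScore.sigmaMatrix Q g Pst ξ A f).PosDef := by
  have hd0 : d ≠ 0 := by omega
  obtain ⟨G, hG⟩ := hgb
  obtain ⟨R, K, C, c, hK, hC, hc, hctl⟩ :=
    StabScore.exists_controlledAt hd0 hgpos hPst hξ hstab hmom
  obtain ⟨A₀, hA₀, hA₀b, hpos⟩ := hpos
  choose F hF using hfb
  have hloc : ∀ i j, StabScore.LocallyControlled Q W g Pst (ξ i) (ξ j) R K C c G := fun i j =>
    ⟨hd, hg, hgpos, hG, hPst, hK, hC, hc, hξ i, hξ j, hctl i, hctl j⟩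
  refine ⟨fun i j => (hloc i j).sigmaEntryConverges (hA i) (hA j) (hAb i) (hAW i) (hf i) (hf j)
    (hF i) (hF j), ?_⟩
  have hsig := fun i j => (hloc i j).integrableOn_covDensity_and_sigmaEntry_eq (hA i) (hA j)
    (hAb i) (hAW i) (hf i) (hf j) (hF i) (hF j)
  -- The limit matrix assumed positive definite at intensity `g x` must coincide with the computed
  -- limit `|A₀|` times the covariance density, by uniqueness of limits.
  have hV : ∀ x ∈ W, ∃ V : Matrix (Fin k) (Fin k) ℝ, V.PosDef ∧ ∀ i j, V i j =
      volume.real A₀ * StabScore.covDensity Q (Pst (g x)) (ξ i) (ξ j) x (g x) := by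
    intro x hx
    obtain ⟨V, hVlim, hVpos⟩ := hpos (g x) (hgpos x hx)
    refine ⟨V, hVpos, fun i j => tendsto_nhds_unique (hVlim i j) ?_⟩
    exact (hctl i x hx).tendsto_covariance_scaled (hctl j x hx) (hPst _ (hgpos x hx)) hd
      (hgpos x hx) hK hC hc (hξtrans i) ((hξown i).score_add (hξtrans i) hx)
      (hξtrans j) ((hξown j).score_add (hξtrans j) hx) hA₀ hA₀b hPst
  refine StabScore.posDef_of_setIntegral (W := W)
    (D := fun x i j => StabScore.covDensity Q (Pst (g x)) (ξ i) (ξ j) x (g x))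
    (fun x hx i j => ?_) (fun x hx v hv => ?_) hA hAW hf0 (fun i j => (hsig i j).1)
    fun i j => (hsig i j).2
  · obtain ⟨V, hVpos, hVD⟩ := hV x hx
    exact StabScore.eq_swap_of_posDef hVpos hVD i j
  · obtain ⟨V, hVpos, hVD⟩ := hV x hx
    exact StabScore.sum_mul_pos_of_posDef hVpos measureReal_nonneg hVD hv
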